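/- Let $k$ be a perfect field of characteristic different from $3$ with algebraic closure $\bar k$ and absolute Galois group $G_k$, and let $E, E'$ be elliptic curves over $k$, each given by a Weierstrass equation (every elliptic curve over $k$ has one); write $E: F=0$ with $$F=Y^2Z+a_1XYZ+a_3YZ^2-(X^3+a_2X^2Z+a_4XZ^2+a_6Z^3).$$ If $\operatorname{char} k\neq 2$, let $\operatorname{Hess}(E)$ be the determinant of the $3\times 3$ matrix of second partial derivatives of $F$. If $\operatorname{char} k=2$, let $\operatorname{Hess}(E)$ be the modified Hessian $$XY^2+a_1X^2Y+a_1^2Y^2Z+(a_1^3+a_3)XYZ+a_1^2a_3YZ^2+a_2X^3+(a_1^2a_2+a_1a_3+a_4)X^2Z+(a_1^2a_4+a_3^2+a_6)XZ^2+(a_1a_3a_4+a_2a_3^2+a_4^2)Z^3,$$ which for $y^2+xy=x^3+a_2x^2+a_6$ is, in affine form, $y^2+xy^2+x^2y+xy+a_2x^3+a_2x^2+a_6x$, and for $y^2+a_3y=x^3+a_4x+a_6$ is $xy^2+a_3xy+a_4x^2+(a_3^2+a_6)x+a_4^2$. The fibers of the Hesse pencil of $E$ are the plane cubics $E_{t_0}: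 t_0F+\operatorname{Hess}(E)=0$ for $t_0\in k$, and $E_\infty=E$. They all contain $O=(0:1:0)$, and a smooth fiber is an elliptic curve with unit element $O$. Then the following are equivalent: 1. there is an isomorphism of $G_k$-modules $\phi: E[3]\to E'[3]$ (of the $3$-torsion groups over $\bar k$) that is symplectic, i.e. $e_3(S,T)=e_3'(\phi(S),\phi(T))$ for all $S,T\in E[3]$, where $e_3,e_3'$ are the Weil pairings on $E[3]$ and $E'[3]$; 2. there is $t_0\in\mathbb P^1(k)=k\cup\{\infty\}$ such that $E_{t_0}$ is smooth and is isomorphic over $k$ to $E'$ as an elliptic curve. -/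

import Mathlib

namespace HessePencil

open MvPolynomial

universe u

/-! ### Plane projective curves over a field and their isomorphisms -/

section PlaneCurves

variable {k : Type u} [Field k]

/-- The set of geometric points (points over an algebraic closure of `k`) of the projective plane
curve `F = 0`, for a homogeneous polynomial `F` over `k`. -/
def planeCurve (F : MvPolynomial (Fin 3) k) :
    Set (Projectivization (AlgebraicClosure k) (Fin 3 → AlgebraicClosure k)) :=
  {P | aeval P.rep F = 0}

/-- The curve `F = 0` is smooth: at no geometric point do all the partial derivatives vanish. -/
def IsSmoothCurve (F : MvPolynomial (Fin 3) k) : Prop :=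
  ∀ P ∈ planeCurve F, ∃ i, aeval P.rep (pderiv i F) ≠ 0

/-- A map between the curves `F = 0` and `G = 0` is a morphism defined over `k`: around every
geometric point `P` it is given by three homogeneous polynomials over `k` of the same degree,
without common zero at `P`. -/
def IsMorphism {F G : MvPolynomial (Fin 3) k} (φ : planeCurve F → planeCurve G) : Prop :=
  ∀ P : planeCurve F, ∃ (d : ℕ) (f : Fin 3 → MvPolynomial (Fin 3) k),
    (∀ i, (f i).IsHomogeneous d) ∧
    (fun i ↦ aeval P.1.rep (f i)) ≠ 0 ∧
    ∀ (Q : planeCurve F) (hQ : (fun i ↦ aeval Q.1.rep (f i)) ≠ 0),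
      (φ Q).1 = Projectivization.mk (AlgebraicClosure k) (fun i ↦ aeval Q.1.rep (f i)) hQ

/-- The point `O = (0 : 1 : 0)`. -/
noncomputable def pointO (k : Type u) [Field k] :
    Projectivization (AlgebraicClosure k) (Fin 3 → AlgebraicClosure k) :=
  Projectivization.mk (AlgebraicClosure k) ![0, 1, 0] fun h ↦ one_ne_zero (congrFun h 1)

/-- The pointed curves `(F = 0, O)` and `(G = 0, O)` are isomorphic over `k`: there are mutually
inverse morphisms over `k` between them that respect `O = (0 : 1 : 0)`. For smooth cubics through
`O`, this is `k`-isomorphism of elliptic curves with unit element `O`. -/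
def IsomorphicOver (F G : MvPolynomial (Fin 3) k) : Prop :=
  ∃ φ : planeCurve F ≃ planeCurve G, IsMorphism φ ∧ IsMorphism φ.symm ∧
    ∃ (hF : pointO k ∈ planeCurve F) (hG : pointO k ∈ planeCurve G),
      φ ⟨pointO k, hF⟩ = ⟨pointO k, hG⟩

end PlaneCurves

/-! ### The Hesse pencil of a Weierstrass cubic -/

section Pencil

variable {k : Type u} [Field k]

/-- The classical Hessian: the determinant of the matrix of second partial derivatives. -/
noncomputable def hessian (F : MvPolynomial (Fin 3) k) : MvPolynomial (Fin 3) k :=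
  (Matrix.of fun i j ↦ pderiv i (pderiv j F)).det

/-- The modified Hessian, for a Weierstrass equation over a field of characteristic two. On the
normal forms `y² + xy = x³ + a₂x² + a₆` and `y² + a₃y = x³ + a₄x + a₆` it is given by the formulas
in the lemmas below; on every Weierstrass equation it cuts out on the affine curve the zeros of the
`3`-division polynomial. -/
noncomputable def hessianCharTwo (E : WeierstrassCurve k) : MvPolynomial (Fin 3) k :=
  X 0 * X 1 ^ 2 + C E.a₁ * X 0 ^ 2 * X 1 + C (E.a₁ ^ 2) * X 1 ^ 2 * X 2
    + C (E.a₁ ^ 3 + E.a₃) * X 0 * X 1 * X 2 + C (E.a₁ ^ 2 * E.a₃) * X 1 * X 2 ^ 2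
    + C E.a₂ * X 0 ^ 3 + C (E.a₁ ^ 2 * E.a₂ + E.a₁ * E.a₃ + E.a₄) * X 0 ^ 2 * X 2
    + C (E.a₁ ^ 2 * E.a₄ + E.a₃ ^ 2 + E.a₆) * X 0 * X 2 ^ 2
    + C (E.a₁ * E.a₃ * E.a₄ + E.a₂ * E.a₃ ^ 2 + E.a₄ ^ 2) * X 2 ^ 3

lemma hessianCharTwo_of_j_ne_zero (E : WeierstrassCurve k) (h₁ : E.a₁ = 1) (h₃ : E.a₃ = 0)
    (h₄ : E.a₄ = 0) : hessianCharTwo E =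
      X 1 ^ 2 * X 2 + X 0 * X 1 ^ 2 + X 0 ^ 2 * X 1 + X 0 * X 1 * X 2 + C E.a₂ * X 0 ^ 3
        + C E.a₂ * X 0 ^ 2 * X 2 + C E.a₆ * X 0 * X 2 ^ 2 := by
  simp [hessianCharTwo, h₁, h₃, h₄]
  ring

lemma hessianCharTwo_of_j_eq_zero (E : WeierstrassCurve k) (h₁ : E.a₁ = 0) (h₂ : E.a₂ = 0) :
    hessianCharTwo E =
      X 0 * X 1 ^ 2 + C E.a₃ * X 0 * X 1 * X 2 + C E.a₄ * X 0 ^ 2 * X 2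
        + C (E.a₃ ^ 2 + E.a₆) * X 0 * X 2 ^ 2 + C (E.a₄ ^ 2) * X 2 ^ 3 := by
  simp [hessianCharTwo, h₁, h₂]

lemma eval_hessianCharTwo (E : WeierstrassCurve k) (h : (2 : k) = 0) (x y : k)
    (hxy : E.toAffine.Equation x y) :
    eval ![x, y, 1] (hessianCharTwo E) = E.Ψ₃.eval x := by
  rw [WeierstrassCurve.Affine.equation_iff] at hxy
  simp [hessianCharTwo, WeierstrassCurve.Ψ₃, WeierstrassCurve.b₂, WeierstrassCurve.b₄,
    WeierstrassCurve.b₆, WeierstrassCurve.b₈]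
  grind

open Classical in
/-- The cubic `Hess(E)` of the elliptic curve `E`: the classical Hessian of its Weierstrass cubic,
or the modified Hessian if the characteristic is two. -/
noncomputable def hess (E : WeierstrassCurve k) : MvPolynomial (Fin 3) k :=
  if (2 : k) = 0 then hessianCharTwo E else hessian E.toProjective.polynomial

/-- The cubic form of the fiber at `t₀ ∈ ℙ¹(k) = k ∪ {∞}` of the Hesse pencil of `E = Z(F)`:
it is `F` at `∞ = (1 : 0)` and `t₀ F + Hess(E)` at `t₀ = (t₀ : 1)`. -/
noncomputable def fiber (E : WeierstrassCurve k) (t₀ : OnePoint k) : MvPolynomial (Fin 3) k :=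
  t₀.elim E.toProjective.polynomial fun t ↦ C t * E.toProjective.polynomial + hess E

end Pencil

/-! ### The Weil pairing on `3`-torsion -/

section WeilPairing

variable {K : Type u} [Field K] (W : WeierstrassCurve.Affine K)

/-- The value at a point of a function that is regular away from the point at infinity.
(At the point at infinity it is given a dummy value, which is never used.) -/
noncomputable def evalAt : W.Point → W.CoordinateRing → K
  | .zero, _ => 0
  | .some _ _ h, f => AdjoinRoot.evalEval h.1 f

/-- The ideal of functions, regular away from the point at infinity, that vanish at a point
(the unit ideal for the point at infinity). -/
noncomputable def pointIdeal : W.Point → Ideal W.CoordinateRing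
  | .zero => ⊤
  | .some x y _ => WeierstrassCurve.Affine.CoordinateRing.XYIdeal W x (Polynomial.C y)

/-- For a point `S` with `3S = O`, a function with divisor `3(S) - 3(O)`: as it has no pole away
from `O`, it is an element of the coordinate ring, and its divisor says that it generates the cube
of the ideal of `S`. It exists by the assumption on `S`, and is unique up to a nonzero constant. -/
noncomputable def torsionFunction (S : W.Point) : W.CoordinateRing :=
  Classical.epsilon fun f ↦ Ideal.span {f} = pointIdeal W S ^ 3

/-- The value of the function `f_S` with divisor `3 D_S` on the divisor `D_T`, where
`D_P = (-P) - (P)`. As `f_S` one takes the quotient of the functions with divisors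
`3(-S) - 3(O)` and `3(S) - 3(O)`. -/
noncomputable def divisorValue (S T : W.Point) : K :=
  (evalAt W (-T) (torsionFunction W (-S)) / evalAt W (-T) (torsionFunction W S)) /
    (evalAt W T (torsionFunction W (-S)) / evalAt W T (torsionFunction W S))

open Classical in
/-- The Weil pairing `e₃(S, T)` of `3`-torsion points. It is `f_S(D_T) / f_T(D_S)`, where `D_S` and
`D_T` are divisors with disjoint supports that are linearly equivalent to `(S) - (O)` and
`(T) - (O)`, and `div f_S = 3 D_S`, `div f_T = 3 D_T`. For `S` and `T` linearly independent over
the field with three elements, `D_S = (-S) - (S)` and `D_T = (-T) - (T)` are such divisors, because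
`3S = 3T = O`. For linearly dependent `S` and `T` the pairing is `1`, as it is alternating. -/
noncomputable def weilPairing (S T : W.Point) : K :=
  if S = 0 ∨ T = 0 ∨ S = T ∨ S = -T then 1 else divisorValue W S T / divisorValue W T S

end WeilPairing

/-! ### The Galois module `E[3]` -/

section Torsion

variable {k : Type u} [Field k]

noncomputable instance : DecidableEq (AlgebraicClosure k) := Classical.decEq _

/-- The group of geometric points of `E`. -/
abbrev GeomPoint (E : WeierstrassCurve k) : Type u :=
  (WeierstrassCurve.Affine.baseChange E (AlgebraicClosure k)).Point

/-- The group `E[3]` of geometric points `P` with `3P = O`. -/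
noncomputable def threeTorsion (E : WeierstrassCurve k) : AddSubgroup (GeomPoint E) :=
  AddSubgroup.torsionBy (GeomPoint E) 3

/-- The action on the geometric points of an element `σ` of the absolute Galois group of a perfect
field `k`, by `(x, y) ↦ (σ x, σ y)`. -/
noncomputable def galois (E : WeierstrassCurve k)
    (σ : AlgebraicClosure k ≃ₐ[k] AlgebraicClosure k) : GeomPoint E →+ GeomPoint E :=
  WeierstrassCurve.Affine.Point.map (W' := E) (σ : AlgebraicClosure k →ₐ[k] AlgebraicClosure k)

lemma galois_mem (E : WeierstrassCurve k) (σ : AlgebraicClosure k ≃ₐ[k] AlgebraicClosure k)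
    (P : threeTorsion E) : galois E σ P ∈ threeTorsion E := by
  have h : (3 : ℤ) • (P : GeomPoint E) = 0 := P.2
  change (3 : ℤ) • galois E σ P = 0
  rw [← map_zsmul, h, map_zero]

/-- The action of the absolute Galois group on `E[3]`. -/
noncomputable def galoisTorsion (E : WeierstrassCurve k)
    (σ : AlgebraicClosure k ≃ₐ[k] AlgebraicClosure k) (P : threeTorsion E) : threeTorsion E :=
  ⟨galois E σ P, galois_mem E σ P⟩

/-- An isomorphism `E[3] → E'[3]` is one of Galois modules. -/
def IsEquivariant {E E' : WeierstrassCurve k} (φ : threeTorsion E ≃+ threeTorsion E') : Prop :=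
  ∀ (σ : AlgebraicClosure k ≃ₐ[k] AlgebraicClosure k) (P : threeTorsion E),
    φ (galoisTorsion E σ P) = galoisTorsion E' σ (φ P)

/-- An isomorphism `E[3] → E'[3]` is symplectic: it preserves the Weil pairings. -/
def IsSymplectic {E E' : WeierstrassCurve k} (φ : threeTorsion E ≃+ threeTorsion E') : Prop :=
  ∀ S T : threeTorsion E,
    weilPairing (WeierstrassCurve.Affine.baseChange E (AlgebraicClosure k)) S T =
      weilPairing (WeierstrassCurve.Affine.baseChange E' (AlgebraicClosure k)) (φ S) (φ T)

end Torsion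

end HessePencil

/-! The nine points of `E[3]` are base points of the Hesse pencil, and their position in the plane
knows both the group law and the Weil pairing. Three distinct points sum to zero exactly when they
are collinear. For a basis `S`, `T` of `E[3]`, let `c` be the cross ratio of the four lines joining
`O` to `S`, `T`, `S + T`, `S - T`. The tangents at the points of order three express both sides of
`weilPairing_eq`: `e₃(S, T) = c²`. The four lines are equianharmonic, `c² - c + 1 = 0`
(`crossRatio_sq`), so `c = c² + 1` is determined by the pairing.

From 1 to 2: in the frame `O`, `S`, `T`, `S + T` the nine points have coordinates depending only on
`c` (`IndependentThree.exists_standard`). Hence a symplectic isomorphism is induced by a linear map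
(`exists_linear_of_symplectic`). Normalised at `O` it is unique, so equivariance and Galois descent
make it defined over `k` (`exists_descended_linear`). The equation of `E'` pulls back to a cubic
through `E[3]`, and such cubics form the pencil (`pencil_of_vanishing`, `exists_fiber_of_linear`).

From 2 to 1: a smooth fiber has a Weierstrass model by a linear change of coordinates over `k`
fixing `O` (`exists_weierstrass_model`). An isomorphism of Weierstrass cubics respecting `O` is
linear as well, by comparing pole orders at infinity (`exists_linear_of_isMorphism`). The composite
is linear on `E[3]`; it preserves collinearity, hence addition, and cross ratios, hence the pairing
(`exists_symplectic_of_linear`). It commutes with Galois because the morphism is defined over `k`.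
-/

namespace HessePencil

open WeierstrassCurve WeierstrassCurve.Affine

/-! ### Points of order three and the `3`-division polynomial -/

section DivisionPolynomial

lemma exists_root_quadratic {K : Type*} [Field K] [IsAlgClosed K] (b c : K) :
    ∃ y : K, y ^ 2 + b * y + c = 0 := by
  obtain ⟨y, hy⟩ := IsAlgClosed.exists_root
    (Polynomial.C 1 * Polynomial.X ^ 2 + Polynomial.C b * Polynomial.X + Polynomial.C c)
    (by rw [Polynomial.degree_quadratic one_ne_zero]; norm_num)
  exact ⟨y, by simpa using hy⟩

lemma Ψ₃_derivative {K : Type*} [Field K] (W : WeierstrassCurve.Affine K) (x : K) :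
    (Polynomial.derivative W.Ψ₃).eval x = 3 * (4 * x ^ 3 + W.b₂ * x ^ 2 + 2 * W.b₄ * x + W.b₆) := by
  simp only [Ψ₃, Polynomial.derivative_add, Polynomial.derivative_mul, Polynomial.derivative_pow,
    Polynomial.derivative_X, Polynomial.derivative_C, Polynomial.derivative_ofNat]
  simp
  ring

end DivisionPolynomial

section ThreeTorsionPoints

variable {K : Type*} [Field K] [DecidableEq K] {W : WeierstrassCurve.Affine K}

lemma three_zsmul_eq_zero_iff_add_self {G : Type*} [AddCommGroup G] (P : G) :
    (3 : ℤ) • P = 0 ↔ P + P = -P := by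
  rw [show (3 : ℤ) • P = P + P + P by abel, add_eq_zero_iff_eq_neg]

lemma three_zsmul_some_iff {x y : K} (h : W.Nonsingular x y) :
    (3 : ℤ) • Point.some x y h = 0 ↔
      y ≠ W.negY x y ∧ W.addX x x (W.slope x x y y) = x := by
  rw [three_zsmul_eq_zero_iff_add_self]
  by_cases hy : y = W.negY x y
  · rw [Point.add_self_of_Y_eq hy, ← neg_zero, neg_inj, eq_comm]
    exact iff_of_false (Point.some_ne_zero h) fun h' ↦ h'.1 hy
  · rw [Point.add_self_of_Y_ne hy, Point.neg_some]
    simp only [Point.some.injEq, ne_eq, hy, not_false_eq_true, true_and]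
    -- The third point of the tangent lies on the tangent, so once its abscissa is `x` its ordinate
    -- is `y`.
    refine ⟨fun h ↦ h.1, fun h ↦ ⟨h, ?_⟩⟩
    rw [addY, negAddY, h]
    simp

/-- The tangent at a point of order three: its slope `l` satisfies the two equations that say that
the line meets the curve triply there. -/
lemma flex_of_three_zsmul {x y : K} (h : W.Nonsingular x y)
    (h3 : (3 : ℤ) • Point.some x y h = 0) :
    2 * y + W.a₁ * x + W.a₃ ≠ 0 ∧
      W.slope x x y y * (2 * y + W.a₁ * x + W.a₃) = 3 * x ^ 2 + 2 * W.a₂ * x + W.a₄ - W.a₁ * y ∧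
      W.slope x x y y ^ 2 + W.a₁ * W.slope x x y y - W.a₂ = 3 * x := by
  obtain ⟨hy, hx⟩ := (three_zsmul_some_iff h).mp h3
  have hD : 2 * y + W.a₁ * x + W.a₃ ≠ 0 := fun h0 ↦ hy (by rw [negY]; linear_combination h0)
  refine ⟨hD, ?_, ?_⟩
  · rw [slope_of_Y_ne rfl hy, negY]
    rw [show y - (-y - W.a₁ * x - W.a₃) = 2 * y + W.a₁ * x + W.a₃ by ring, div_mul_cancel₀ _ hD]
  · rw [addX] at hx
    linear_combination hx

lemma three_zsmul_some_iff_Ψ₃ {x y : K} (h : W.Nonsingular x y) :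
    (3 : ℤ) • Point.some x y h = 0 ↔ W.Ψ₃.eval x = 0 := by
  have he := (equation_iff ..).mp h.1
  -- With `D = 2y + a₁x + a₃` and tangent slope `l = N / D`, this is `-D² (l² + a₁l - a₂ - 3x)`: the
  -- flex condition with denominators cleared.
  have hΨ : W.Ψ₃.eval x = (3 * x + W.a₂) * (2 * y + W.a₁ * x + W.a₃) ^ 2
      - (3 * x ^ 2 + 2 * W.a₂ * x + W.a₄ - W.a₁ * y) ^ 2
      - W.a₁ * (3 * x ^ 2 + 2 * W.a₂ * x + W.a₄ - W.a₁ * y) * (2 * y + W.a₁ * x + W.a₃) := by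
    simp only [Ψ₃, b₂, b₄, b₆, b₈, Polynomial.eval_add, Polynomial.eval_mul, Polynomial.eval_pow,
      Polynomial.eval_X, Polynomial.eval_C, Polynomial.eval_ofNat]
    linear_combination (-(12 * x + W.a₁ ^ 2 + 4 * W.a₂)) * he
  constructor
  · intro h3
    obtain ⟨-, h1, h2⟩ := flex_of_three_zsmul h h3
    rw [hΨ, ← h1]
    linear_combination (-(2 * y + W.a₁ * x + W.a₃) ^ 2) * h2
  · intro h0
    rw [hΨ] at h0
    -- If `D = 0`, only `-N²` remains, so both partial derivatives vanish, against nonsingularity.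
    have hD : 2 * y + W.a₁ * x + W.a₃ ≠ 0 := by
      intro hD
      rw [hD] at h0
      have hN : 3 * x ^ 2 + 2 * W.a₂ * x + W.a₄ - W.a₁ * y = 0 := by
        simpa using h0
      rcases ((nonsingular_iff' ..).mp h).2 with h' | h'
      · exact h' (by linear_combination -hN)
      · exact h' hD
    have hy : y ≠ W.negY x y := fun h ↦ hD (by rw [negY] at h; linear_combination h)
    refine (three_zsmul_some_iff h).mpr ⟨hy, ?_⟩
    have hl : W.slope x x y y * (2 * y + W.a₁ * x + W.a₃) =
        3 * x ^ 2 + 2 * W.a₂ * x + W.a₄ - W.a₁ * y := by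
      rw [slope_of_Y_ne rfl hy, negY,
        show y - (-y - W.a₁ * x - W.a₃) = 2 * y + W.a₁ * x + W.a₃ by ring, div_mul_cancel₀ _ hD]
    rw [← hl] at h0
    refine mul_left_cancel₀ (pow_ne_zero 2 hD) ?_
    rw [addX]
    linear_combination -h0

/-- The affine points of order three over a root of the `3`-division polynomial. -/
lemma exists_three_torsion_of_Ψ₃ [IsAlgClosed K] [W.IsElliptic] {x : K} (hx : W.Ψ₃.eval x = 0) :
    ∃ (y : K) (h : W.Nonsingular x y), (3 : ℤ) • Point.some x y h = 0 := by
  obtain ⟨y, hy⟩ := exists_root_quadratic (W.a₁ * x + W.a₃)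
    (-(x ^ 3 + W.a₂ * x ^ 2 + W.a₄ * x + W.a₆))
  have he : W.Equation x y := (equation_iff ..).mpr (by linear_combination hy)
  have hn := equation_iff_nonsingular.mp he
  exact ⟨y, hn, (three_zsmul_some_iff_Ψ₃ hn).mpr hx⟩

/-- On the curve the derivative of `Ψ₃` is `3 (2y + a₁x + a₃)²`, which vanishes only at points of
order two. -/
lemma Ψ₃_separable [IsAlgClosed K] [W.IsElliptic] (h3 : (3 : K) ≠ 0) {x : K}
    (hx : W.Ψ₃.eval x = 0) : (Polynomial.derivative W.Ψ₃).eval x ≠ 0 := by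
  obtain ⟨y, h, hP⟩ := exists_three_torsion_of_Ψ₃ hx
  have hD := (flex_of_three_zsmul h hP).1
  rw [Ψ₃_derivative]
  refine mul_ne_zero h3 ?_
  have he := (equation_iff ..).mp h.1
  rw [show 4 * x ^ 3 + W.b₂ * x ^ 2 + 2 * W.b₄ * x + W.b₆ = (2 * y + W.a₁ * x + W.a₃) ^ 2 by
    simp only [b₂, b₄, b₆]; linear_combination (-4) * he]
  exact pow_ne_zero 2 hD

/-- The `3`-division polynomial has two distinct roots. -/
lemma exists_two_roots_Ψ₃ [IsAlgClosed K] [W.IsElliptic] (h3 : (3 : K) ≠ 0) :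
    ∃ x₁ x₂ : K, x₁ ≠ x₂ ∧ W.Ψ₃.eval x₁ = 0 ∧ W.Ψ₃.eval x₂ = 0 := by
  have h0 : W.Ψ₃ ≠ 0 := W.Ψ₃_ne_zero h3
  have hcard : Multiset.card W.Ψ₃.roots = 4 := by
    rw [← W.natDegree_Ψ₃ h3]
    exact (IsAlgClosed.splits W.Ψ₃).natDegree_eq_card_roots.symm
  have hnd : W.Ψ₃.roots.Nodup := by
    rw [Multiset.nodup_iff_count_le_one]
    intro x
    rw [Polynomial.count_roots, ← not_lt, Polynomial.one_lt_rootMultiplicity_iff_isRoot h0]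
    exact fun h ↦ Ψ₃_separable h3 h.1 h.2
  have hc : 1 < W.Ψ₃.roots.toFinset.card := by
    rw [Multiset.toFinset_card_of_nodup hnd, hcard]
    norm_num
  obtain ⟨x₁, hx₁, x₂, hx₂, hne⟩ := Finset.one_lt_card.mp hc
  rw [Multiset.mem_toFinset, Polynomial.mem_roots h0] at hx₁ hx₂
  exact ⟨x₁, x₂, hne, hx₁, hx₂⟩

end ThreeTorsionPoints

end HessePencil

namespace HessePencil

open WeierstrassCurve WeierstrassCurve.Affine

/-! ### Collinearity and the group law -/

section Vectors

variable {K : Type*} [Field K]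

/-- The determinant with the given three rows. -/
def tripleProduct (a b c : Fin 3 → K) : K :=
  a 0 * (b 1 * c 2 - b 2 * c 1) - a 1 * (b 0 * c 2 - b 2 * c 0) + a 2 * (b 0 * c 1 - b 1 * c 0)

/-- The bracket of the projections of two points from `O = (0 : 1 : 0)`. -/
def bracket (a b : Fin 3 → K) : K :=
  a 0 * b 2 - a 2 * b 0

end Vectors

section Coordinates

variable {K : Type*} [Field K] {W : WeierstrassCurve.Affine K}

/-- Standard homogeneous coordinates of a point. -/
def vec : W.Point → Fin 3 → K
  | .zero => ![0, 1, 0]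
  | .some x y _ => ![x, y, 1]

@[simp] lemma vec_zero : vec (0 : W.Point) = ![0, 1, 0] := rfl

@[simp] lemma vec_some {x y : K} (h : W.Nonsingular x y) : vec (Point.some x y h) = ![x, y, 1] := rfl

lemma vec_ne_zero (P : W.Point) : vec P ≠ 0 := by
  rcases P with _ | ⟨x, y, h⟩
  · exact fun h ↦ one_ne_zero (congrFun h 1)
  · exact fun h ↦ one_ne_zero (congrFun h 2)

lemma vec_injective : Function.Injective (vec : W.Point → _) := by
  rintro (_ | ⟨x, y, h⟩) (_ | ⟨x', y', h'⟩) he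
  · rfl
  · exact absurd (congrFun he 2) (zero_ne_one)
  · exact absurd (congrFun he 2) (one_ne_zero)
  · obtain rfl : x = x' := congrFun he 0
    obtain rfl : y = y' := congrFun he 1
    rfl

lemma bracket_vec_eq_zero_iff {P Q : W.Point} (hP : P ≠ 0) (hQ : Q ≠ 0) :
    bracket (vec P) (vec Q) = 0 ↔ P = Q ∨ P = -Q := by
  rcases P with _ | ⟨x, y, h⟩
  · exact absurd rfl hP
  rcases Q with _ | ⟨x', y', h'⟩
  · exact absurd rfl hQ
  rw [← Point.X_eq_iff]
  simp [bracket, sub_eq_zero]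

variable [DecidableEq K]

lemma tripleProduct_vec_eq_zero {P Q R : W.Point} (hne : P ≠ Q) (h : P + Q + R = 0) :
    tripleProduct (vec P) (vec Q) (vec R) = 0 := by
  obtain rfl : R = -(P + Q) := by rw [eq_neg_iff_add_eq_zero, add_comm, h]
  clear h
  rcases P with _ | ⟨x, y, h⟩
  · change tripleProduct (vec 0) _ (vec (-(0 + Q))) = 0
    rw [zero_add]
    rcases Q with _ | ⟨x, y, h⟩
    · exact absurd rfl hne
    · simp [tripleProduct]
  rcases Q with _ | ⟨x', y', h'⟩
  · change tripleProduct _ (vec 0) (vec (-(_ + 0))) = 0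
    simp [tripleProduct]
  by_cases hx : x = x'
  · rcases Point.X_eq_iff (h₁ := h) (h₂ := h') |>.mp hx with h0 | h0
    · exact absurd h0 hne
    · rw [h0]
      subst hx
      simp [tripleProduct]
  · rw [Point.add_of_X_ne hx, Point.neg_some]
    simp only [vec_some, tripleProduct, addY, negY_negY, negAddY, slope_of_X_ne hx]
    have := sub_ne_zero.mpr hx
    simp
    field_simp
    ring

/-- The third intersection of the chord through `P` and `Q` is `-(P + Q)`. Distinctness is
essential: the determinant also vanishes when two rows agree. -/
lemma add_eq_zero_of_tripleProduct {P Q R : W.Point} (hPQ : P ≠ Q) (hPR : P ≠ R) (hQR : Q ≠ R)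
    (h : tripleProduct (vec P) (vec Q) (vec R) = 0) : P + Q + R = 0 := by
  rcases P with _ | ⟨x₁, y₁, h₁⟩
  · change 0 + Q + R = 0
    rcases Q with _ | ⟨x₂, y₂, h₂⟩
    · exact absurd rfl hPQ
    rcases R with _ | ⟨x₃, y₃, h₃⟩
    · exact absurd rfl hPR
    have hx : x₂ = x₃ := by
      simp [tripleProduct, vec] at h
      linear_combination -h
    rw [zero_add, add_eq_zero_iff_eq_neg]
    exact (Point.X_eq_iff.mp hx).resolve_left hQR
  rcases Q with _ | ⟨x₂, y₂, h₂⟩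
  · change _ + 0 + R = 0
    rcases R with _ | ⟨x₃, y₃, h₃⟩
    · exact absurd rfl hQR
    have hx : x₁ = x₃ := by
      simp [tripleProduct, vec] at h
      linear_combination h
    rw [add_zero, add_eq_zero_iff_eq_neg]
    exact (Point.X_eq_iff.mp hx).resolve_left hPR
  rcases R with _ | ⟨x₃, y₃, h₃⟩
  · change _ + _ + 0 = 0
    have hx : x₁ = x₂ := by
      simp [tripleProduct, vec] at h
      linear_combination -h
    rw [add_zero, add_eq_zero_iff_eq_neg]
    exact (Point.X_eq_iff.mp hx).resolve_left hPQ
  -- A vertical line contains at most two affine points, and here there are three.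
  have hx : x₁ ≠ x₂ := by
    rintro rfl
    simp [tripleProduct, vec] at h
    have h' : (y₂ - y₁) * (x₁ - x₃) = 0 := by linear_combination h
    rcases mul_eq_zero.mp h' with h' | h'
    · obtain rfl : y₂ = y₁ := by linear_combination h'
      exact hPQ rfl
    · obtain rfl : x₁ = x₃ := by linear_combination h'
      have h12 := (Point.X_eq_iff (h₁ := h₁) (h₂ := h₂)).mp rfl
      have h13 := (Point.X_eq_iff (h₁ := h₁) (h₂ := h₃)).mp rfl
      exact hQR (neg_injective ((h12.resolve_left hPQ).symm.trans (h13.resolve_left hPR)))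
  have hx' : x₁ - x₂ ≠ 0 := sub_ne_zero.mpr hx
  set l := W.slope x₁ x₂ y₁ y₂ with hl
  have hl' : l * (x₁ - x₂) = y₁ - y₂ := by
    rw [hl, slope_of_X_ne hx, div_mul_cancel₀ _ hx']
  have hy₃ : y₃ = l * (x₃ - x₁) + y₁ := by
    simp [tripleProduct, vec] at h
    refine mul_left_cancel₀ hx' ?_
    linear_combination -h - (x₃ - x₁) * hl'
  have hxy : ¬(x₁ = x₂ ∧ y₁ = W.negY x₂ y₂) := fun h ↦ hx h.1
  -- Restricted to the chord, the Weierstrass equation becomes a cubic in the abscissa with roots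
  -- `x₁`, `x₂` and `addX`; it vanishes at `x₃`.
  have hroot : (x₃ - x₁) * (x₃ - x₂) * (x₃ - W.addX x₁ x₂ l) = 0 := by
    have h0 := congrArg (Polynomial.eval x₃) (addPolynomial_slope h₁.1 h₂.1 hxy)
    have he := (equation_iff ..).mp h₃.1
    rw [addPolynomial_eq, Cubic.toPoly, ← hl] at h0
    simp at h0
    rw [hy₃] at he
    rw [addX]
    linear_combination h0 - he
  rw [add_eq_zero_iff_eq_neg, Point.add_of_X_ne hx, eq_comm, neg_eq_iff_eq_neg, Point.neg_some,
    Point.some.injEq]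
  have key : x₃ = W.addX x₁ x₂ l := by
    rcases mul_eq_zero.mp hroot with h' | h'
    · rcases mul_eq_zero.mp h' with h' | h'
      · obtain rfl : x₃ = x₁ := by linear_combination h'
        obtain rfl : y₃ = y₁ := by rw [hy₃]; ring
        exact absurd rfl hPR
      · obtain rfl : x₃ = x₂ := by linear_combination h'
        obtain rfl : y₃ = y₂ := by rw [hy₃]; linear_combination -hl'
        exact absurd rfl hQR
    · linear_combination h'
  rw [addY, negAddY, ← hl, ← key, hy₃, negY_negY]
  exact ⟨rfl, rfl⟩

end Coordinates

section Independent

/-- Two elements of order three of an abelian group generate a group of order nine. -/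
structure IndependentThree {G : Type*} [AddCommGroup G] (S T : G) : Prop where
  left : (3 : ℤ) • S = 0
  right : (3 : ℤ) • T = 0
  left_ne : S ≠ 0
  right_ne : T ≠ 0
  ne : S ≠ T
  ne_neg : S ≠ -T

namespace IndependentThree

variable {G : Type*} [AddCommGroup G] {S T : G}

lemma symm (h : IndependentThree S T) : IndependentThree T S :=
  ⟨h.right, h.left, h.right_ne, h.left_ne, h.ne.symm, fun h' ↦ h.ne_neg (by rw [h', neg_neg])⟩

lemma neg_right (h : IndependentThree S T) : IndependentThree S (-T) :=
  ⟨h.left, by rw [zsmul_neg, h.right, neg_zero], h.left_ne, neg_ne_zero.mpr h.right_ne, h.ne_neg,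
    by rw [neg_neg]; exact h.ne⟩

lemma add_right (h : IndependentThree S T) : IndependentThree S (S + T) := by
  obtain ⟨h1, h2, h3, h4, h5, h6⟩ := h
  refine ⟨h1, by rw [zsmul_add, h1, h2, add_zero], h3, ?_, ?_, ?_⟩
  · exact fun h ↦ h6 (by linear_combination (norm := module) h)
  · exact fun h ↦ h4 (by linear_combination (norm := module) -h)
  · exact fun h ↦ h5 (by linear_combination (norm := module) h1 - h)

lemma sub_right (h : IndependentThree S T) : IndependentThree S (S - T) := by
  rw [sub_eq_add_neg]; exact h.neg_right.add_right

lemma add_sub (h : IndependentThree S T) : IndependentThree (S + T) (S - T) := by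
  have h' := h.symm.add_right.symm.add_right
  rwa [show T + S + T = S - T by linear_combination (norm := module) h.right, add_comm T S] at h'

end IndependentThree

end Independent

end HessePencil

namespace HessePencil

open WeierstrassCurve WeierstrassCurve.Affine

/-! ### The cross ratio of the lines joining `O` to the points of order three -/

section Brackets

variable {K : Type*} [Field K] {W : WeierstrassCurve.Affine K}

lemma bracket_neg_right (P Q : W.Point) (hQ : Q ≠ 0) :
    bracket (vec P) (vec (-Q)) = bracket (vec P) (vec Q) := by
  rcases Q with _ | ⟨x₂, y₂, h₂⟩
  · exact absurd rfl hQ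
  · simp [bracket]

lemma bracket_some_some {x y x' y' : K} {h : W.Nonsingular x y} {h' : W.Nonsingular x' y'}
    (hb : bracket (vec (Point.some x y h)) (vec (Point.some x' y' h')) ≠ 0) : x ≠ x' := by
  simpa [bracket, sub_eq_zero] using hb

/-- The coefficients of the `3`-division polynomial in terms of its roots. -/
lemma Ψ₃_vieta {x₁ x₂ x₃ x₄ : K} (h3 : (3 : K) ≠ 0)
    (h₁ : W.Ψ₃.eval x₁ = 0) (h₂ : W.Ψ₃.eval x₂ = 0) (h₃ : W.Ψ₃.eval x₃ = 0)
    (h₄ : W.Ψ₃.eval x₄ = 0) (h₁₂ : x₁ ≠ x₂) (h₁₃ : x₁ ≠ x₃) (h₁₄ : x₁ ≠ x₄) (h₂₃ : x₂ ≠ x₃)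
    (h₂₄ : x₂ ≠ x₄) (h₃₄ : x₃ ≠ x₄) :
    W.b₂ = -3 * (x₁ + x₂ + x₃ + x₄) ∧
      W.b₄ = x₁ * x₂ + x₁ * x₃ + x₁ * x₄ + x₂ * x₃ + x₂ * x₄ + x₃ * x₄ ∧
      W.b₆ = -(x₁ * x₂ * x₃ + x₁ * x₂ * x₄ + x₁ * x₃ * x₄ + x₂ * x₃ * x₄) ∧
      W.b₈ = 3 * (x₁ * x₂ * x₃ * x₄) := by
  have ev (x : K) : W.Ψ₃.eval x =
      3 * x ^ 4 + W.b₂ * x ^ 3 + 3 * W.b₄ * x ^ 2 + 3 * W.b₆ * x + W.b₈ := by simp [Ψ₃]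
  rw [ev] at h₁ h₂ h₃ h₄
  -- Iterated divided differences at the four roots give the coefficients one after another, from
  -- the top.
  have first {x y : K} (hxy : x ≠ y)
      (hx : 3 * x ^ 4 + W.b₂ * x ^ 3 + 3 * W.b₄ * x ^ 2 + 3 * W.b₆ * x + W.b₈ = 0)
      (hy : 3 * y ^ 4 + W.b₂ * y ^ 3 + 3 * W.b₄ * y ^ 2 + 3 * W.b₆ * y + W.b₈ = 0) :
      3 * (x ^ 3 + x ^ 2 * y + x * y ^ 2 + y ^ 3) + W.b₂ * (x ^ 2 + x * y + y ^ 2) +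
        3 * W.b₄ * (x + y) + 3 * W.b₆ = 0 :=
    mul_left_cancel₀ (sub_ne_zero.mpr hxy) (by linear_combination hx - hy)
  have q12 := first h₁₂ h₁ h₂
  have q13 := first h₁₃ h₁ h₃
  have q14 := first h₁₄ h₁ h₄
  have q23 : 3 * (x₁ ^ 2 + x₁ * (x₂ + x₃) + x₂ ^ 2 + x₂ * x₃ + x₃ ^ 2) +
      W.b₂ * (x₁ + x₂ + x₃) + 3 * W.b₄ = 0 :=
    mul_left_cancel₀ (sub_ne_zero.mpr h₂₃) (by linear_combination q12 - q13)
  have q24 : 3 * (x₁ ^ 2 + x₁ * (x₂ + x₄) + x₂ ^ 2 + x₂ * x₄ + x₄ ^ 2) +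
      W.b₂ * (x₁ + x₂ + x₄) + 3 * W.b₄ = 0 :=
    mul_left_cancel₀ (sub_ne_zero.mpr h₂₄) (by linear_combination q12 - q14)
  have b2 : W.b₂ = -3 * (x₁ + x₂ + x₃ + x₄) :=
    mul_left_cancel₀ (sub_ne_zero.mpr h₃₄) (by linear_combination q23 - q24)
  rw [b2] at q23 q12 h₁
  have b4 : W.b₄ = x₁ * x₂ + x₁ * x₃ + x₁ * x₄ + x₂ * x₃ + x₂ * x₄ + x₃ * x₄ :=
    mul_left_cancel₀ h3 (by linear_combination q23)
  rw [b4] at q12 h₁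
  have b6 : W.b₆ = -(x₁ * x₂ * x₃ + x₁ * x₂ * x₄ + x₁ * x₃ * x₄ + x₂ * x₃ * x₄) :=
    mul_left_cancel₀ h3 (by linear_combination q12)
  rw [b6] at h₁
  exact ⟨b2, b4, b6, by linear_combination h₁⟩

end Brackets

section CrossRatio

variable {K : Type*} [Field K] [DecidableEq K] {W : WeierstrassCurve.Affine K}

/-- The value at the second point of the equation of the tangent at the first. -/
def tangentValue : W.Point → W.Point → K
  | .some x₁ y₁ _, .some x₂ y₂ _ => y₂ - y₁ - W.slope x₁ x₁ y₁ y₁ * (x₂ - x₁)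
  | _, _ => 0

/-- The value at a point of the derivative of the Weierstrass equation with respect to `y`. -/
def derivValue : W.Point → K
  | .some x y _ => 2 * y + W.a₁ * x + W.a₃
  | _ => 0

/-- The tangent at the flex `S` has divisor `3(S) - 3(O)`. Multiplied by its conjugate under
negation it has divisor `3(S) + 3(-S) - 6(O)`, that of the cube of `x_S - x`. -/
lemma tangentValue_mul_neg {S T : W.Point} (hS : (3 : ℤ) • S = 0) (hS0 : S ≠ 0) (hT0 : T ≠ 0) :
    tangentValue S T * tangentValue S (-T) = bracket (vec S) (vec T) ^ 3 := by
  rcases S with _ | ⟨x₁, y₁, h₁⟩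
  · exact absurd rfl hS0
  rcases T with _ | ⟨x₂, y₂, h₂⟩
  · exact absurd rfl hT0
  obtain ⟨-, hN, hf⟩ := flex_of_three_zsmul h₁ hS
  have he₁ := (equation_iff ..).mp h₁.1
  have he₂ := (equation_iff ..).mp h₂.1
  simp only [Point.neg_some, tangentValue, bracket, vec_some, negY]
  simp
  linear_combination -he₂ + he₁ + (x₂ - x₁) * hN + (x₂ - x₁) ^ 2 * hf

/-- As functions of `T`, both sides have divisor `3(S) - 3(O)`: the factor `x_S - x(S + T)` has
divisor `(O) + (S) - 2(-S)`, and the squared bracket has `2(S) + 2(-S) - 4(O)`. The constant is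
`derivValue S`. -/
lemma bracket_add {S T : W.Point} (hS : (3 : ℤ) • S = 0) (hS0 : S ≠ 0) (hT0 : T ≠ 0)
    (hne : bracket (vec S) (vec T) ≠ 0) :
    bracket (vec S) (vec (S + T)) * bracket (vec S) (vec T) ^ 2 =
      tangentValue S T * derivValue S := by
  have hmul := tangentValue_mul_neg hS hS0 hT0
  rcases S with _ | ⟨x₁, y₁, h₁⟩
  · exact absurd rfl hS0
  rcases T with _ | ⟨x₂, y₂, h₂⟩
  · exact absurd rfl hT0
  obtain ⟨-, hN, hf⟩ := flex_of_three_zsmul h₁ hS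
  have hx : x₁ - x₂ ≠ 0 := by simpa [bracket] using hne
  have hs : W.slope x₁ x₂ y₁ y₂ * (x₁ - x₂) = y₁ - y₂ := by
    rw [slope_of_X_ne (sub_ne_zero.mp hx), div_mul_cancel₀ _ hx]
  rw [Point.add_of_X_ne (sub_ne_zero.mp hx)]
  simp only [Point.neg_some, tangentValue, bracket, vec_some, negY, derivValue, addX] at hmul ⊢
  generalize W.slope x₁ x₂ y₁ y₂ = s at *
  generalize W.slope x₁ x₁ y₁ y₁ = l at *
  simp at hmul ⊢
  linear_combination -(s * (x₁ - x₂) + (y₁ - y₂) + W.a₁ * (x₁ - x₂)) * hs + hmul - (x₁ - x₂) ^ 2 * hf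

/-- The cross ratio of the lines that join `O` to `S`, `T`, `S + T` and `S - T`. -/
def crossRatio (S T : W.Point) : K :=
  (bracket (vec S) (vec (S + T)) * bracket (vec T) (vec (S - T))) /
    (bracket (vec S) (vec (S - T)) * bracket (vec T) (vec (S + T)))

lemma IndependentThree.bracket_ne_zero {S T : W.Point} (h : IndependentThree S T) :
    bracket (vec S) (vec T) ≠ 0 := by
  rw [Ne, bracket_vec_eq_zero_iff h.left_ne h.right_ne, not_or]
  exact ⟨h.ne, h.ne_neg⟩

lemma IndependentThree.tangentValue_ne_zero {S T : W.Point} (h : IndependentThree S T) :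
    tangentValue S T ≠ 0 :=
  left_ne_zero_of_mul (b := tangentValue S (-T)) (by
    rw [tangentValue_mul_neg h.left h.left_ne h.right_ne]
    exact pow_ne_zero 3 h.bracket_ne_zero)

lemma IndependentThree.derivValue_ne_zero {S T : W.Point} (h : IndependentThree S T) :
    derivValue S ≠ 0 := by
  have h0 := h.left_ne
  have h1 := h.left
  clear h
  rcases S with _ | ⟨x₁, y₁, h₁⟩
  · exact absurd rfl h0
  · exact (flex_of_three_zsmul h₁ h1).1

/-- By `bracket_add` each of the four brackets is a tangent value up to factors that cancel in the
cross ratio. Tangent values are also what the Weil pairing is made of. -/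
lemma crossRatio_eq {S T : W.Point} (h : IndependentThree S T) :
    crossRatio S T = (tangentValue S T * tangentValue T (-S)) /
      (tangentValue S (-T) * tangentValue T S) := by
  have hb := h.bracket_ne_zero
  have e1 := bracket_add h.left h.left_ne h.right_ne hb
  have e2 := bracket_add h.left h.left_ne (neg_ne_zero.mpr h.right_ne) h.neg_right.bracket_ne_zero
  have e3 := bracket_add h.right h.right_ne h.left_ne h.symm.bracket_ne_zero
  have e4 := bracket_add h.right h.right_ne (neg_ne_zero.mpr h.left_ne)
    h.symm.neg_right.bracket_ne_zero
  rw [bracket_neg_right _ _ h.right_ne] at e2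
  rw [bracket_neg_right _ _ h.left_ne] at e4
  rw [← sub_eq_add_neg] at e2
  rw [← sub_eq_add_neg, ← neg_sub, bracket_neg_right _ _ h.sub_right.right_ne] at e4
  rw [add_comm T S] at e3
  have b1 := h.sub_right.bracket_ne_zero
  have b2 : bracket (vec T) (vec (S + T)) ≠ 0 := by
    rw [add_comm]; exact h.symm.add_right.bracket_ne_zero
  have d1 := h.derivValue_ne_zero
  have d2 := h.symm.derivValue_ne_zero
  have t1 := h.neg_right.tangentValue_ne_zero
  have t2 := h.symm.tangentValue_ne_zero
  have hb' := h.symm.bracket_ne_zero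
  rw [crossRatio, div_eq_div_iff (mul_ne_zero b1 b2) (mul_ne_zero t1 t2)]
  refine mul_left_cancel₀ (mul_ne_zero (mul_ne_zero d1 d2)
    (mul_ne_zero (pow_ne_zero 2 hb) (pow_ne_zero 2 hb'))) ?_
  calc _ = (bracket (vec S) (vec (S + T)) * bracket (vec S) (vec T) ^ 2) *
        (bracket (vec T) (vec (S - T)) * bracket (vec T) (vec S) ^ 2) *
        (tangentValue S (-T) * derivValue S) * (tangentValue T S * derivValue T) := by ring
    _ = _ := by rw [e1, e4, ← e2, ← e3]; ring

lemma exists_some {P : W.Point} (hP : (3 : ℤ) • P = 0) (h0 : P ≠ 0) :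
    ∃ (x y : K) (h : W.Nonsingular x y), P = .some x y h ∧ W.Ψ₃.eval x = 0 := by
  rcases P with _ | ⟨x, y, h⟩
  · exact absurd rfl h0
  · exact ⟨x, y, h, rfl, (three_zsmul_some_iff_Ψ₃ h).mp hP⟩

/-- The four points have distinct abscissas, which are therefore all the roots of the quartic `Ψ₃`;
Vieta's formulas then give the `b`-invariants. -/
lemma IndependentThree.exists_coordinates (h3 : (3 : K) ≠ 0) {S T : W.Point}
    (h : IndependentThree S T) :
    ∃ x₁ x₂ x₃ x₄ : K, (∃ y h, S = .some x₁ y h) ∧ (∃ y h, T = .some x₂ y h) ∧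
      (∃ y h, S + T = .some x₃ y h) ∧ (∃ y h, S - T = .some x₄ y h) ∧
      x₁ ≠ x₂ ∧ x₁ ≠ x₃ ∧ x₁ ≠ x₄ ∧ x₂ ≠ x₃ ∧ x₂ ≠ x₄ ∧ x₃ ≠ x₄ ∧
      W.b₂ = -3 * (x₁ + x₂ + x₃ + x₄) ∧
      W.b₄ = x₁ * x₂ + x₁ * x₃ + x₁ * x₄ + x₂ * x₃ + x₂ * x₄ + x₃ * x₄ ∧
      W.b₆ = -(x₁ * x₂ * x₃ + x₁ * x₂ * x₄ + x₁ * x₃ * x₄ + x₂ * x₃ * x₄) ∧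
      W.b₈ = 3 * (x₁ * x₂ * x₃ * x₄) := by
  obtain ⟨x₁, y₁, h₁, e₁, r₁⟩ := exists_some h.left h.left_ne
  obtain ⟨x₂, y₂, h₂, e₂, r₂⟩ := exists_some h.right h.right_ne
  obtain ⟨x₃, y₃, h₃, e₃, r₃⟩ := exists_some h.add_right.right h.add_right.right_ne
  obtain ⟨x₄, y₄, h₄, e₄, r₄⟩ := exists_some h.sub_right.right h.sub_right.right_ne
  have d₁₂ := h.bracket_ne_zero
  have d₁₃ := h.add_right.bracket_ne_zero
  have d₁₄ := h.sub_right.bracket_ne_zero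
  have d₂₃ := h.symm.add_right.bracket_ne_zero
  rw [add_comm] at d₂₃
  have d₂₄ := h.symm.sub_right.bracket_ne_zero
  rw [← neg_sub, bracket_neg_right _ _ h.sub_right.right_ne] at d₂₄
  have d₃₄ := h.add_sub.bracket_ne_zero
  rw [e₃] at d₁₃ d₂₃ d₃₄
  rw [e₄] at d₁₄ d₂₄ d₃₄
  rw [e₁] at d₁₂ d₁₃ d₁₄
  rw [e₂] at d₁₂ d₂₃ d₂₄
  have n₁₂ := bracket_some_some d₁₂
  have n₁₃ := bracket_some_some d₁₃
  have n₁₄ := bracket_some_some d₁₄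
  have n₂₃ := bracket_some_some d₂₃
  have n₂₄ := bracket_some_some d₂₄
  have n₃₄ := bracket_some_some d₃₄
  exact ⟨x₁, x₂, x₃, x₄, ⟨y₁, h₁, e₁⟩, ⟨y₂, h₂, e₂⟩, ⟨y₃, h₃, e₃⟩, ⟨y₄, h₄, e₄⟩,
    n₁₂, n₁₃, n₁₄, n₂₃, n₂₄, n₃₄, Ψ₃_vieta h3 r₁ r₂ r₃ r₄ n₁₂ n₁₃ n₁₄ n₂₃ n₂₄ n₃₄⟩

/-- The four lines that join `O` to the points of order three are equianharmonic. -/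
lemma crossRatio_sq (h3 : (3 : K) ≠ 0) {S T : W.Point} (h : IndependentThree S T) :
    crossRatio S T ^ 2 - crossRatio S T + 1 = 0 := by
  obtain ⟨x₁, x₂, x₃, x₄, ⟨y₁, h₁, e₁⟩, ⟨y₂, h₂, e₂⟩, ⟨y₃, h₃, e₃⟩, ⟨y₄, h₄, e₄⟩,
    n₁₂, n₁₃, n₁₄, n₂₃, n₂₄, n₃₄, b2, b4, b6, b8⟩ := h.exists_coordinates h3
  -- In the elementary symmetric functions of the roots, `4b₈ = b₂b₆ - b₄²` reads `12e₄ = 3e₁e₃ -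
  -- e₂²`. This is the vanishing of the quadratic invariant of a quartic, which characterises
  -- equianharmonic roots.
  have hr := W.b_relation
  rw [b2, b4, b6, b8] at hr
  rw [crossRatio, e₃, e₄, e₁, e₂]
  simp only [bracket, vec_some]
  simp
  have := sub_ne_zero.mpr n₁₄
  have := sub_ne_zero.mpr n₂₃
  field_simp
  linear_combination hr

/-- A basis of the `3`-torsion generates it. -/
lemma IndependentThree.exhaust (h3 : (3 : K) ≠ 0) {S T : W.Point} (h : IndependentThree S T)
    {P : W.Point} (hP : (3 : ℤ) • P = 0) :
    P = 0 ∨ (P = S ∨ P = -S) ∨ (P = T ∨ P = -T) ∨ (P = S + T ∨ P = -(S + T)) ∨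
      (P = S - T ∨ P = -(S - T)) := by
  by_cases h0 : P = 0
  · exact Or.inl h0
  right
  obtain ⟨x, y, hn, rfl, hx⟩ := exists_some hP h0
  obtain ⟨x₁, x₂, x₃, x₄, ⟨y₁, h₁, e₁⟩, ⟨y₂, h₂, e₂⟩, ⟨y₃, h₃, e₃⟩, ⟨y₄, h₄, e₄⟩,
    n₁₂, n₁₃, n₁₄, n₂₃, n₂₄, n₃₄, b2, b4, b6, b8⟩ := h.exists_coordinates h3
  rw [e₃, e₄, e₁, e₂, ← Point.X_eq_iff, ← Point.X_eq_iff, ← Point.X_eq_iff, ← Point.X_eq_iff]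
  have h' : 3 * ((x - x₁) * ((x - x₂) * ((x - x₃) * (x - x₄)))) = 0 := by
    simp only [Ψ₃, b2, b4, b6, b8] at hx
    simp at hx
    linear_combination hx
  simpa [h3, sub_eq_zero] using h'

lemma exists_independentThree [IsAlgClosed K] [W.IsElliptic] (h3 : (3 : K) ≠ 0) :
    ∃ S T : W.Point, IndependentThree S T := by
  obtain ⟨x₁, x₂, hne, hx₁, hx₂⟩ := exists_two_roots_Ψ₃ (W := W) h3
  obtain ⟨y₁, h₁, t₁⟩ := exists_three_torsion_of_Ψ₃ hx₁
  obtain ⟨y₂, h₂, t₂⟩ := exists_three_torsion_of_Ψ₃ hx₂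
  have := mt (Point.X_eq_iff (h₁ := h₁) (h₂ := h₂)).mpr hne
  rw [not_or] at this
  exact ⟨_, _, t₁, t₂, Point.some_ne_zero h₁, Point.some_ne_zero h₂, this.1, this.2⟩

end CrossRatio

/-! ### The Weil pairing as the square of the cross ratio -/

section Weil

variable {K : Type*} [Field K] [DecidableEq K] {W : WeierstrassCurve.Affine K}

/-- The norm of `p + qY` to `K[X]` has degree `max (2 deg p) (2 deg q + 3)`. For a unit this is
zero, so `q = 0` and `p` is constant. -/
lemma exists_const_of_isUnit {u : W.CoordinateRing} (hu : IsUnit u) :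
    ∃ κ : K, κ ≠ 0 ∧ u = CoordinateRing.mk W (Polynomial.C (Polynomial.C κ)) := by
  obtain ⟨p, q, rfl⟩ := CoordinateRing.exists_smul_basis_eq u
  have hN := hu.map (Algebra.norm (Polynomial K))
  have hdeg := Polynomial.degree_eq_zero_of_isUnit hN
  rw [CoordinateRing.degree_norm_smul_basis] at hdeg
  have hq : q = 0 := by
    by_contra hq
    have h := (le_max_right _ _).trans hdeg.le
    rw [Polynomial.degree_eq_natDegree hq] at h
    have h' : ((2 * q.natDegree + 3 : ℕ) : WithBot ℕ) ≤ ((0 : ℕ) : WithBot ℕ) := by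
      simpa [two_nsmul, two_mul] using h
    exact absurd (WithBot.coe_le_coe.mp h') (by simp)
  subst hq
  have hp : p.degree ≤ 0 := by
    by_cases hp : p = 0
    · simp [hp]
    have h := (le_max_left _ _).trans hdeg.le
    rw [Polynomial.degree_eq_natDegree hp] at h ⊢
    have h' : ((2 * p.natDegree : ℕ) : WithBot ℕ) ≤ ((0 : ℕ) : WithBot ℕ) := by
      simpa [two_nsmul, two_mul] using h
    have := WithBot.coe_le_coe.mp h'
    exact WithBot.coe_le_coe.mpr (by simpa using this)
  have hp' := Polynomial.eq_C_of_degree_le_zero hp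
  have hu' : p.coeff 0 ≠ 0 := by
    intro h0
    rw [h0, Polynomial.C_0] at hp'
    simp [hp'] at hu
  refine ⟨p.coeff 0, hu', ?_⟩
  rw [zero_smul, add_zero, CoordinateRing.smul, mul_one, ← hp']

/-- Write `I_P` for the ideal of `P`. As `2S = -S`, the ideal form of the addition law is `(x - x_S)
I_S² = (tangent) I_{-S}`. Multiplying by `I_S` and using `I_S I_{-S} = (x - x_S)`, one cancels `x -
x_S`. -/
lemma span_tangent {x y : K} (h : W.Nonsingular x y) (h3 : (3 : ℤ) • Point.some x y h = 0) :
    Ideal.span {CoordinateRing.YClass W (linePolynomial x y (W.slope x x y y))} =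
      pointIdeal W (.some x y h) ^ 3 := by
  obtain ⟨hy, hx⟩ := (three_zsmul_some_iff h).mp h3
  have hmul := CoordinateRing.XYIdeal_mul_XYIdeal h.1 h.1 (fun h ↦ hy h.2)
  have hneg := CoordinateRing.XYIdeal_neg_mul h
  have hY : W.addY x x y (W.slope x x y y) = W.negY x y := by
    rw [addY, negAddY, hx]; simp
  rw [hx, hY] at hmul
  refine (Ideal.span_singleton_mul_right_inj (CoordinateRing.XClass_ne_zero x)).mp ?_
  change CoordinateRing.XIdeal W x * CoordinateRing.YIdeal W _ = CoordinateRing.XIdeal W x * _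
  rw [pow_succ, pow_two, ← mul_assoc]
  change _ = CoordinateRing.XIdeal W x * (CoordinateRing.XYIdeal W x (Polynomial.C y) *
    CoordinateRing.XYIdeal W x (Polynomial.C y)) * CoordinateRing.XYIdeal W x (Polynomial.C y)
  rw [hmul, mul_assoc, hneg, mul_comm]

/-- The chosen generator of the cubed ideal and the tangent differ by a unit, hence by a constant.
At `T = O` the dummy value of `evalAt` would not obey this. -/
lemma exists_evalAt_torsionFunction {S : W.Point} (hS : (3 : ℤ) • S = 0) (h0 : S ≠ 0) :
    ∃ κ : K, κ ≠ 0 ∧ ∀ T : W.Point, T ≠ 0 →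
      κ * evalAt W T (torsionFunction W S) = tangentValue S T := by
  rcases S with _ | ⟨x, y, h⟩
  · exact absurd rfl h0
  have hspan : Ideal.span {torsionFunction W (.some x y h)} = pointIdeal W (.some x y h) ^ 3 :=
    Classical.epsilon_spec (p := fun f ↦ Ideal.span {f} = pointIdeal W (.some x y h) ^ 3)
      ⟨_, span_tangent h hS⟩
  rw [← span_tangent h hS, Ideal.span_singleton_eq_span_singleton] at hspan
  obtain ⟨u, hu⟩ := hspan
  obtain ⟨κ, hκ, hκu⟩ := exists_const_of_isUnit u.isUnit
  refine ⟨κ, hκ, fun T hT ↦ ?_⟩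
  rcases T with _ | ⟨x', y', h'⟩
  · exact absurd rfl hT
  have hmk (p) : evalAt W (.some x' y' h') (CoordinateRing.mk W p) = p.evalEval x' y' :=
    AdjoinRoot.evalEval_mk _ _
  have hmap (f g : W.CoordinateRing) : evalAt W (.some x' y' h') (f * g) =
      evalAt W (.some x' y' h') f * evalAt W (.some x' y' h') g := map_mul (AdjoinRoot.evalEval _) f g
  have he := congrArg (evalAt W (.some x' y' h')) hu
  rw [hmap, hκu, CoordinateRing.YClass, hmk, hmk] at he
  simp [linePolynomial, Polynomial.evalEval_C] at he
  rw [tangentValue]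
  linear_combination he

/-- Negation is an affine map interchanging the tangents at `S` and `-S`; the coefficient of `y`
changes sign. -/
lemma tangentValue_neg_left {S T : W.Point} (hS : (3 : ℤ) • S = 0) :
    tangentValue (-S) T = -tangentValue S (-T) := by
  rcases S with _ | ⟨x, y, h⟩
  · exact neg_zero.symm
  rcases T with _ | ⟨x', y', h'⟩
  · exact neg_zero.symm
  obtain ⟨hD, hN, -⟩ := flex_of_three_zsmul h hS
  have hy := ((three_zsmul_some_iff h).mp hS).1
  have hs : W.slope x x (W.negY x y) (W.negY x y) = -W.slope x x y y - W.a₁ := by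
    rw [slope_of_Y_ne rfl (by rw [negY_negY]; exact hy.symm), negY_negY]
    rw [negY, show -y - W.a₁ * x - W.a₃ - y = -(2 * y + W.a₁ * x + W.a₃) by ring,
      div_eq_iff (neg_ne_zero.mpr hD)]
    linear_combination -hN
  simp only [Point.neg_some, tangentValue, hs]
  simp only [negY]
  ring

/-- The unknown constants cancel because `D_T` has degree zero. Replacing `-S` by `S` with
`tangentValue_neg_left` makes both quotients equal to the same ratio, whence the square. -/
lemma divisorValue_eq {S T : W.Point} (h : IndependentThree S T) :
    divisorValue W S T = (tangentValue S T / tangentValue S (-T)) ^ 2 := by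
  obtain ⟨κ, hκ, h1⟩ := exists_evalAt_torsionFunction h.left h.left_ne
  obtain ⟨κ', hκ', h2⟩ := exists_evalAt_torsionFunction (S := -S)
    (by rw [zsmul_neg, h.left, neg_zero]) (neg_ne_zero.mpr h.left_ne)
  have t1 := h.tangentValue_ne_zero
  have t2 := h.neg_right.tangentValue_ne_zero
  have e1 := h1 _ h.right_ne
  have e2 := h1 _ (neg_ne_zero.mpr h.right_ne)
  have e3 := h2 _ h.right_ne
  have e4 := h2 _ (neg_ne_zero.mpr h.right_ne)
  rw [tangentValue_neg_left h.left] at e3 e4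
  rw [neg_neg] at e4
  rw [mul_comm, ← eq_div_iff hκ] at e1 e2
  rw [mul_comm, ← eq_div_iff hκ'] at e3 e4
  rw [divisorValue, e1, e2, e3, e4]
  field_simp

/-- The Weil pairing is the square of the cross ratio of the four lines through `O`. -/
lemma weilPairing_eq {S T : W.Point} (h : IndependentThree S T) :
    weilPairing W S T = crossRatio S T ^ 2 := by
  rw [weilPairing, if_neg, divisorValue_eq h, divisorValue_eq h.symm, crossRatio_eq h]
  · simp only [div_pow, mul_pow]
    rw [div_div_div_eq]
  · rintro (h' | h' | h' | h')
    exacts [h.left_ne h', h.right_ne h', h.ne h', h.ne_neg h']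

end Weil

end HessePencil

namespace HessePencil

open WeierstrassCurve WeierstrassCurve.Affine
open Matrix

/-! ### Projective frames and the standard position of the nine points -/

section Proportional

variable {K : Type*} [Field K]

/-- Two vectors differ by a nonzero factor. -/
def Proportional (a b : Fin 3 → K) : Prop :=
  ∃ c : K, c ≠ 0 ∧ a = c • b

lemma Proportional.refl (a : Fin 3 → K) : Proportional a a :=
  ⟨1, one_ne_zero, (one_smul _ _).symm⟩

lemma Proportional.symm {a b : Fin 3 → K} (h : Proportional a b) : Proportional b a := by
  obtain ⟨c, hc, rfl⟩ := h
  exact ⟨c⁻¹, inv_ne_zero hc, by rw [smul_smul, inv_mul_cancel₀ hc, one_smul]⟩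

lemma Proportional.trans {a b c : Fin 3 → K} (h : Proportional a b) (h' : Proportional b c) :
    Proportional a c := by
  obtain ⟨x, hx, rfl⟩ := h
  obtain ⟨y, hy, rfl⟩ := h'
  exact ⟨x * y, mul_ne_zero hx hy, by rw [smul_smul]⟩

lemma Proportional.mulVec {a b : Fin 3 → K} (h : Proportional a b)
    (M : Matrix (Fin 3) (Fin 3) K) : Proportional (M *ᵥ a) (M *ᵥ b) := by
  obtain ⟨x, hx, rfl⟩ := h
  exact ⟨x, hx, mulVec_smul ..⟩

lemma tripleProduct_mulVec (M : Matrix (Fin 3) (Fin 3) K) (a b c : Fin 3 → K) :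
    tripleProduct (M *ᵥ a) (M *ᵥ b) (M *ᵥ c) = M.det * tripleProduct a b c := by
  simp only [tripleProduct, Matrix.mulVec, dotProduct, Fin.sum_univ_three, Matrix.det_fin_three]
  ring

lemma tripleProduct_smul (x y z : K) (a b c : Fin 3 → K) :
    tripleProduct (x • a) (y • b) (z • c) = x * y * z * tripleProduct a b c := by
  simp only [tripleProduct, Pi.smul_apply, smul_eq_mul]
  ring

lemma Proportional.tripleProduct_eq_zero_iff {a b c a' b' c' : Fin 3 → K} (ha : Proportional a a')
    (hb : Proportional b b') (hc : Proportional c c') :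
    tripleProduct a b c = 0 ↔ tripleProduct a' b' c' = 0 := by
  obtain ⟨x, hx, rfl⟩ := ha
  obtain ⟨y, hy, rfl⟩ := hb
  obtain ⟨z, hz, rfl⟩ := hc
  rw [tripleProduct_smul]
  simp [hx, hy, hz]

lemma exists_mulVec_eq {M : Matrix (Fin 3) (Fin 3) K} (hM : M.det ≠ 0) (v : Fin 3 → K) :
    ∃ w, M *ᵥ w = v :=
  ⟨M⁻¹ *ᵥ v, by rw [mulVec_mulVec, mul_nonsing_inv _ (isUnit_iff_ne_zero.mpr hM), one_mulVec]⟩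

lemma tripleProduct_eq_zero_of_mulVec {M : Matrix (Fin 3) (Fin 3) K} (hM : M.det ≠ 0)
    {a b w a' b' : Fin 3 → K} (ha : Proportional (M *ᵥ a) a') (hb : Proportional (M *ᵥ b) b')
    (h : tripleProduct a' b' (M *ᵥ w) = 0) : tripleProduct a b w = 0 := by
  rw [← ha.tripleProduct_eq_zero_iff hb (.refl _), tripleProduct_mulVec] at h
  exact (mul_eq_zero.mp h).resolve_left hM

/-- Allows a point to be located by linear equations alone: the factor found may be any coordinate
of the solution, and it is nonzero automatically. -/
lemma proportional_of_mulVec_eq {M : Matrix (Fin 3) (Fin 3) K} {u v w : Fin 3 → K} {c : K}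
    (hv : v ≠ 0) (hw : M *ᵥ w = v) (h : w = c • u) : Proportional (M *ᵥ u) v := by
  subst h
  rw [mulVec_smul] at hw
  have hc : c ≠ 0 := by
    rintro rfl
    rw [zero_smul] at hw
    exact hv hw.symm
  exact Proportional.symm ⟨c, hc, hw.symm⟩

lemma Proportional.transfer {M M' : Matrix (Fin 3) (Fin 3) K} (hM : M.det ≠ 0)
    {u v v' : Fin 3 → K} (h : Proportional (M *ᵥ u) v) (h' : Proportional (M' *ᵥ u) v') :
    Proportional ((M' * M⁻¹) *ᵥ v) v' := by
  refine (h.symm.mulVec _).trans ?_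
  rwa [mulVec_mulVec, mul_assoc, nonsing_inv_mul _ (isUnit_iff_ne_zero.mpr hM), mul_one]

lemma det_scaled_columns (x y z : K) (o s t : Fin 3 → K) :
    (Matrix.of fun i ↦ ![x * o i, y * s i, z * t i]).det = x * y * z * tripleProduct o s t := by
  simp [Matrix.det_fin_three, tripleProduct]
  ring

/-- Four points in general position can be moved to standard position. -/
lemma exists_frame {o s t p : Fin 3 → K} (h₁ : tripleProduct o s t ≠ 0)
    (h₂ : tripleProduct p s t ≠ 0) (h₃ : tripleProduct o p t ≠ 0) (h₄ : tripleProduct o s p ≠ 0) :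
    ∃ M : Matrix (Fin 3) (Fin 3) K, M.det ≠ 0 ∧ Proportional (M *ᵥ ![1, 0, 0]) o ∧
      Proportional (M *ᵥ ![0, 1, 0]) s ∧ Proportional (M *ᵥ ![0, 0, 1]) t ∧
      Proportional (M *ᵥ ![1, 1, 1]) p := by
  -- By Cramer's rule these columns add up to `tripleProduct o s t • p`.
  let M : Matrix (Fin 3) (Fin 3) K := Matrix.of fun i ↦
    ![tripleProduct p s t * o i, tripleProduct o p t * s i, tripleProduct o s p * t i]
  refine ⟨M, ?_, ⟨_, h₂, ?_⟩, ⟨_, h₃, ?_⟩, ⟨_, h₄, ?_⟩, ⟨_, h₁, ?_⟩⟩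
  · rw [show M.det = _ from det_scaled_columns ..]
    exact mul_ne_zero (mul_ne_zero (mul_ne_zero h₂ h₃) h₄) h₁
  · ext i; simp [M, Matrix.mulVec, dotProduct, Fin.sum_univ_three]
  · ext i; simp [M, Matrix.mulVec, dotProduct, Fin.sum_univ_three]
  · ext i; simp [M, Matrix.mulVec, dotProduct, Fin.sum_univ_three]
  · ext i
    simp [M, Matrix.mulVec, dotProduct, Fin.sum_univ_three]
    fin_cases i <;> simp [tripleProduct] <;> ring

lemma bracket_eq_tripleProduct {K : Type*} [Field K] {W : WeierstrassCurve.Affine K}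
    (P Q : W.Point) :
    bracket (vec P) (vec Q) = -tripleProduct (vec (0 : W.Point)) (vec P) (vec Q) := by
  simp [bracket, tripleProduct]

end Proportional

section StandardPosition

variable {K : Type*} [Field K] [DecidableEq K] {W : WeierstrassCurve.Affine K}

lemma tripleProduct_ne_zero {P Q R : W.Point} (hPQ : P ≠ Q) (hPR : P ≠ R) (hQR : Q ≠ R)
    (h : P + Q + R ≠ 0) : tripleProduct (vec P) (vec Q) (vec R) ≠ 0 :=
  fun h0 ↦ h (add_eq_zero_of_tripleProduct hPQ hPR hQR h0)

/-- The nine points of order dividing three in a frame that depends only on the cross ratio. -/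
lemma IndependentThree.exists_standard (h3 : (3 : K) ≠ 0) {S T : W.Point}
    (h : IndependentThree S T) :
    ∃ M : Matrix (Fin 3) (Fin 3) K, M.det ≠ 0 ∧
      Proportional (M *ᵥ ![1, 0, 0]) (vec (0 : W.Point)) ∧
      Proportional (M *ᵥ ![0, 1, 0]) (vec S) ∧
      Proportional (M *ᵥ ![0, 0, 1]) (vec T) ∧
      Proportional (M *ᵥ ![1, 1, 1]) (vec (S + T)) ∧
      Proportional (M *ᵥ ![1, crossRatio S T, 1]) (vec (S - T)) ∧
      Proportional (M *ᵥ ![1, crossRatio S T, 0]) (vec (-S)) ∧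
      Proportional (M *ᵥ ![crossRatio S T, 0, 1]) (vec (-T)) ∧
      Proportional (M *ᵥ ![0, 1, 1]) (vec (-(S + T))) ∧
      Proportional (M *ᵥ ![crossRatio S T, crossRatio S T, 1]) (vec (-(S - T))) := by
  have h0S := h.left_ne
  have h0T := h.right_ne
  have hadd := h.add_right
  have hadd' := h.symm.add_right
  rw [add_comm] at hadd'
  have hsub := h.sub_right
  have h3S := h.left
  have h3T := h.right
  have n1 : S - T ≠ 0 := hsub.right_ne
  have n2 : S + T ≠ 0 := hadd.right_ne
  obtain ⟨M, hM, hO, hS, hT, hST⟩ := exists_frame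
    (tripleProduct_ne_zero (W := W) h0S.symm h0T.symm h.ne (by rwa [zero_add]))
    (tripleProduct_ne_zero hadd.ne.symm hadd'.ne.symm h.ne
      (fun h' ↦ h.ne_neg (by
        have : (2 : ℤ) • (S + T) = 0 := by linear_combination (norm := module) h'
        exact absurd (show S + T = 0 by
          linear_combination (norm := module) h.add_right.right - this) n2)))
    (tripleProduct_ne_zero n2.symm h0T.symm hadd'.ne.symm
      (fun h' ↦ h.ne (by linear_combination (norm := module) h' - h3T)))
    (tripleProduct_ne_zero (W := W) h0S.symm n2.symm hadd.ne
      (fun h' ↦ h.ne (by linear_combination (norm := module) h3S - h')))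
  have hcr := crossRatio_sq h3 h
  have hc0 : crossRatio S T ≠ 0 := by
    intro h0
    rw [h0] at hcr
    simp at hcr
  have b1 := hsub.bracket_ne_zero
  have b2 := hadd'.bracket_ne_zero
  have hcdef : bracket (vec S) (vec (S + T)) * bracket (vec T) (vec (S - T)) =
      crossRatio S T * (bracket (vec S) (vec (S - T)) * bracket (vec T) (vec (S + T))) := by
    rw [crossRatio, div_mul_cancel₀ _ (mul_ne_zero b1 b2)]
  generalize crossRatio S T = c at *
  -- `S - T` lies on the line through `S` and `S + T`, since the three sum to `3S = 0`; the cross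
  -- ratio fixes its position there.
  have hD : Proportional (M *ᵥ ![1, c, 1]) (vec (S - T)) := by
    obtain ⟨w, hw⟩ := exists_mulVec_eq hM (vec (S - T))
    have l₁ : tripleProduct ![0, 1, 0] ![1, 1, 1] w = 0 :=
      tripleProduct_eq_zero_of_mulVec hM hS hST (by
        rw [hw]
        refine tripleProduct_vec_eq_zero hadd.ne ?_
        linear_combination (norm := module) h3S)
    have l₂ : w 1 = c * w 2 := by
      simp only [bracket_eq_tripleProduct, neg_mul_neg] at hcdef
      obtain ⟨x₀, hx₀, e₀⟩ := hO.symm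
      obtain ⟨x₁, hx₁, e₁⟩ := hS.symm
      obtain ⟨x₂, hx₂, e₂⟩ := hT.symm
      obtain ⟨x₃, hx₃, e₃⟩ := hST.symm
      rw [e₀, e₁, e₂, e₃, ← hw, ← one_smul K (M *ᵥ w)] at hcdef
      simp only [tripleProduct_smul, tripleProduct_mulVec] at hcdef
      simp [tripleProduct] at hcdef
      refine mul_left_cancel₀ (mul_ne_zero (mul_ne_zero (pow_ne_zero 2 hM) (pow_ne_zero 2 hx₀))
        (mul_ne_zero (mul_ne_zero hx₁ hx₂) hx₃)) ?_
      linear_combination hcdef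
    refine proportional_of_mulVec_eq (vec_ne_zero _) hw (c := w 2) ?_
    simp [tripleProduct] at l₁
    ext i
    fin_cases i <;> simp
    · linear_combination l₁
    · linear_combination l₂
  -- Each of the four remaining points is the intersection of two lines through points already
  -- placed.
  have hNS : Proportional (M *ᵥ ![1, c, 0]) (vec (-S)) := by
    obtain ⟨w, hw⟩ := exists_mulVec_eq hM (vec (-S))
    have l₁ := tripleProduct_eq_zero_of_mulVec hM hO hS (w := w) (by
      rw [hw]; exact tripleProduct_vec_eq_zero h0S.symm (by abel))
    have l₂ := tripleProduct_eq_zero_of_mulVec hM hT hD (w := w) (by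
      rw [hw]
      exact tripleProduct_vec_eq_zero
        (fun h' ↦ h.ne_neg (by linear_combination (norm := module) h3T - h')) (by abel))
    refine proportional_of_mulVec_eq (vec_ne_zero _) hw (c := w 0) ?_
    simp [tripleProduct] at l₁ l₂
    ext i
    fin_cases i <;> simp
    · linear_combination l₂
    · exact l₁
  have hNT : Proportional (M *ᵥ ![c, 0, 1]) (vec (-T)) := by
    obtain ⟨w, hw⟩ := exists_mulVec_eq hM (vec (-T))
    have l₁ := tripleProduct_eq_zero_of_mulVec hM hO hT (w := w) (by
      rw [hw]; exact tripleProduct_vec_eq_zero h0T.symm (by abel))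
    have l₂ := tripleProduct_eq_zero_of_mulVec hM hST hNS (w := w) (by
      rw [hw]
      exact tripleProduct_vec_eq_zero
        (fun h' ↦ h.ne (by linear_combination (norm := module) h3S - h')) (by abel))
    refine proportional_of_mulVec_eq (vec_ne_zero _) hw (c := w 2) ?_
    simp [tripleProduct] at l₁ l₂
    ext i
    fin_cases i <;> simp
    -- The two lines give `c w₀ = (c - 1) w₂`, and `c - 1 = c²` because the cross ratio is
    -- equianharmonic.
    · refine mul_left_cancel₀ hc0 ?_
      rw [l₁] at l₂
      linear_combination -l₂ - hcr * w 2
    · exact l₁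
  have hNST : Proportional (M *ᵥ ![0, 1, 1]) (vec (-(S + T))) := by
    obtain ⟨w, hw⟩ := exists_mulVec_eq hM (vec (-(S + T)))
    have l₁ := tripleProduct_eq_zero_of_mulVec hM hO hST (w := w) (by
      rw [hw]; exact tripleProduct_vec_eq_zero n2.symm (by abel))
    have l₂ := tripleProduct_eq_zero_of_mulVec hM hS hT (w := w) (by
      rw [hw]; exact tripleProduct_vec_eq_zero h.ne (by abel))
    refine proportional_of_mulVec_eq (vec_ne_zero _) hw (c := w 2) ?_
    simp [tripleProduct] at l₁ l₂
    ext i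
    fin_cases i <;> simp
    · exact l₂
    · linear_combination -l₁
  have hND : Proportional (M *ᵥ ![c, c, 1]) (vec (-(S - T))) := by
    obtain ⟨w, hw⟩ := exists_mulVec_eq hM (vec (-(S - T)))
    have l₁ := tripleProduct_eq_zero_of_mulVec hM hO hD (w := w) (by
      rw [hw]; exact tripleProduct_vec_eq_zero n1.symm (by abel))
    have l₂ := tripleProduct_eq_zero_of_mulVec hM hT hST (w := w) (by
      rw [hw]
      exact tripleProduct_vec_eq_zero hadd'.ne
        (by linear_combination (norm := module) h3T))
    refine proportional_of_mulVec_eq (vec_ne_zero _) hw (c := w 2) ?_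
    simp [tripleProduct] at l₁ l₂
    ext i
    fin_cases i <;> simp
    · linear_combination -l₁ - l₂
    · linear_combination -l₁
  exact ⟨M, hM, hO, hS, hT, hST, hD, hNS, hNT, hNST, hND⟩

end StandardPosition

end HessePencil

namespace HessePencil

open WeierstrassCurve WeierstrassCurve.Affine
open Matrix

lemma Proportional.eq_of_vec {K : Type*} [Field K] {W : WeierstrassCurve.Affine K} {P Q : W.Point}
    (h : Proportional (vec P) (vec Q)) : P = Q := by
  obtain ⟨c, hc, h⟩ := h
  have e2 := congrFun h 2
  rcases P with _ | ⟨x, y, hP⟩ <;> rcases Q with _ | ⟨x', y', hQ⟩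
  · rfl
  · exact absurd (e2.symm.trans rfl) (mul_ne_zero hc one_ne_zero)
  · exact absurd (e2.trans (mul_zero c)) one_ne_zero
  · obtain rfl : 1 = c := e2.trans (mul_one c)
    exact vec_injective (h.trans (one_smul _ _))

/-! ### Symplectic isomorphisms and linear maps -/

section LinearMaps

variable {K : Type*} [Field K] [DecidableEq K] {W W' : WeierstrassCurve.Affine K}

/-- The subgroup of points of order dividing three. -/
abbrev threeSubgroup (W : WeierstrassCurve.Affine K) : AddSubgroup W.Point :=
  AddSubgroup.torsionBy W.Point 3

lemma threeSubgroup_smul (P : threeSubgroup W) : (3 : ℤ) • P = 0 := Subtype.ext P.2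

lemma IndependentThree.map {G H : Type*} [AddCommGroup G] [AddCommGroup H] {S T : G}
    (h : IndependentThree S T) (f : G →+ H) (hf : Function.Injective f) :
    IndependentThree (f S) (f T) :=
  ⟨by rw [← map_zsmul, h.left, map_zero], by rw [← map_zsmul, h.right, map_zero],
    (map_ne_zero_iff f hf).mpr h.left_ne, (map_ne_zero_iff f hf).mpr h.right_ne,
    hf.ne h.ne, fun h' ↦ h.ne_neg (hf (by rw [h', map_neg]))⟩

lemma independentThree_or {S T : threeSubgroup W} :
    ((S : W.Point) = 0 ∨ (T : W.Point) = 0 ∨ (S : W.Point) = T ∨ (S : W.Point) = -T) ∨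
      IndependentThree (S : W.Point) (T : W.Point) := by
  by_cases h : ((S : W.Point) = 0 ∨ (T : W.Point) = 0 ∨ (S : W.Point) = T ∨ (S : W.Point) = -T)
  · exact Or.inl h
  · push Not at h
    exact Or.inr ⟨S.2, T.2, h.1, h.2.1, h.2.2.1, h.2.2.2⟩

lemma exists_independentThree_left [IsAlgClosed K] [W.IsElliptic] (h3 : (3 : K) ≠ 0)
    {P : W.Point} (hP : (3 : ℤ) • P = 0) (h0 : P ≠ 0) : ∃ Q : W.Point, IndependentThree P Q := by
  obtain ⟨S, T, h⟩ := exists_independentThree (W := W) h3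
  by_cases h1 : P = S
  · exact ⟨T, h1 ▸ h⟩
  by_cases h2 : P = -S
  · exact ⟨T, h2 ▸ h.symm.neg_right.symm⟩
  · exact ⟨S, hP, h.left, h0, h.left_ne, h1, h2⟩

/-- A symplectic isomorphism of the `3`-torsion groups comes from a linear map. -/
lemma exists_linear_of_symplectic [IsAlgClosed K] [W.IsElliptic] (h3 : (3 : K) ≠ 0)
    (φ : threeSubgroup W ≃+ threeSubgroup W')
    (hφ : ∀ S T : threeSubgroup W, weilPairing W S T = weilPairing W' (φ S) (φ T)) :
    ∃ g : Matrix (Fin 3) (Fin 3) K, g.det ≠ 0 ∧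
      ∀ P : threeSubgroup W, Proportional (g *ᵥ vec (P : W.Point)) (vec (φ P : W'.Point)) := by
  obtain ⟨S, T, h⟩ := exists_independentThree (W := W) h3
  let S₀ : threeSubgroup W := ⟨S, h.left⟩
  let T₀ : threeSubgroup W := ⟨T, h.right⟩
  have h₀ : IndependentThree S₀ T₀ :=
    ⟨threeSubgroup_smul _, threeSubgroup_smul _, fun h' ↦ h.left_ne (congrArg Subtype.val h'),
      fun h' ↦ h.right_ne (congrArg Subtype.val h'), fun h' ↦ h.ne (congrArg Subtype.val h'),
      fun h' ↦ h.ne_neg (congrArg Subtype.val h')⟩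
  have h' : IndependentThree (φ S₀ : W'.Point) (φ T₀ : W'.Point) :=
    h₀.map ((threeSubgroup W').subtype.comp φ.toAddMonoidHom)
      (Subtype.val_injective.comp φ.injective)
  -- Equal pairings mean equal squares of the cross ratios; since `c² = c - 1` for both, the cross
  -- ratios agree.
  have hcr : crossRatio (φ S₀ : W'.Point) (φ T₀ : W'.Point) = crossRatio S T := by
    have he := hφ S₀ T₀
    rw [weilPairing_eq (W := W) h, weilPairing_eq h'] at he
    have e₁ := crossRatio_sq h3 h
    have e₂ := crossRatio_sq h3 h'
    linear_combination e₁ - e₂ - he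
  obtain ⟨M, hM, m₁, m₂, m₃, m₄, m₅, m₆, m₇, m₈, m₉⟩ := h.exists_standard h3
  obtain ⟨M', hM', m₁', m₂', m₃', m₄', m₅', m₆', m₇', m₈', m₉'⟩ := h'.exists_standard h3
  rw [hcr] at m₅' m₆' m₇' m₉'
  refine ⟨M' * M⁻¹, ?_, ?_⟩
  · rw [det_mul]
    rw [det_nonsing_inv, Ring.inverse_eq_inv']
    exact mul_ne_zero hM' (inv_ne_zero hM)
  rintro ⟨P, hP⟩
  -- A point and its image have the same coordinates `u` in the two frames, so the change of frame
  -- matches them.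
  have key (Q : threeSubgroup W) (hQ : P = (Q : W.Point)) {u : Fin 3 → K}
      (hu : Proportional (M *ᵥ u) (vec (Q : W.Point)))
      (hu' : Proportional (M' *ᵥ u) (vec (φ Q : W'.Point))) :
      Proportional ((M' * M⁻¹) *ᵥ vec P) (vec (φ ⟨P, hP⟩ : W'.Point)) := by
    subst hQ
    exact hu.transfer hM hu'
  rcases h.exhaust h3 hP with h | (h | h) | (h | h) | (h | h) | (h | h)
  · exact key 0 h m₁ (by simpa using m₁')
  · exact key S₀ h m₂ (by simpa using m₂')
  · exact key (-S₀) h m₆ (by simpa using m₆')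
  · exact key T₀ h m₃ (by simpa using m₃')
  · exact key (-T₀) h m₇ (by simpa using m₇')
  · exact key (S₀ + T₀) h m₄ (by simpa using m₄')
  · exact key (-(S₀ + T₀)) h m₈ (by rw [map_neg, map_add]; exact m₈')
  · exact key (S₀ - T₀) h m₅ (by simpa using m₅')
  · exact key (-(S₀ - T₀)) h m₉ (by rw [map_neg, map_sub]; exact m₉')

section Transport

variable {g : Matrix (Fin 3) (Fin 3) K} {Φ : threeSubgroup W → W'.Point}

lemma transport_injective (hg : g.det ≠ 0)
    (hΦ : ∀ P : threeSubgroup W, Proportional (g *ᵥ vec (P : W.Point)) (vec (Φ P))) : Function.Injective Φ := by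
  intro P Q h
  have h' := (hΦ P).trans (h ▸ (hΦ Q).symm)
  have h1 : Proportional (vec (P : W.Point)) (vec (Q : W.Point)) := by
    have := h'.mulVec g⁻¹
    rwa [mulVec_mulVec, nonsing_inv_mul _ (isUnit_iff_ne_zero.mpr hg), one_mulVec,
      mulVec_mulVec, nonsing_inv_mul _ (isUnit_iff_ne_zero.mpr hg), one_mulVec] at this
  exact Subtype.ext h1.eq_of_vec

/-- Linear maps preserve collinearity. In a group of exponent three, `P + Q + R = 0` with `P ≠ Q`
forces all three to be distinct, as the collinearity criterion requires. -/
lemma transport_sum (hg : g.det ≠ 0)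
    (hΦ : ∀ P : threeSubgroup W, Proportional (g *ᵥ vec (P : W.Point)) (vec (Φ P))) {P Q R : threeSubgroup W}
    (hne : P ≠ Q) (h : P + Q + R = 0) : Φ P + Φ Q + Φ R = 0 := by
  have hi := transport_injective hg hΦ
  have hP := threeSubgroup_smul P
  have hQ := threeSubgroup_smul Q
  refine add_eq_zero_of_tripleProduct (hi.ne hne)
    (hi.ne fun h' ↦ hne ?_) (hi.ne fun h' ↦ hne ?_) ?_
  · subst h'; linear_combination (norm := module) hP - h
  · subst h'; linear_combination (norm := module) h - hQ
  · rw [← (hΦ P).tripleProduct_eq_zero_iff (hΦ Q) (hΦ R), tripleProduct_mulVec,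
      tripleProduct_vec_eq_zero (fun h' ↦ hne (Subtype.ext h')) (congrArg Subtype.val h), mul_zero]

/-- A linear map from the `3`-torsion points to points of another curve is additive: it preserves
collinearity. -/
lemma transport_add [IsAlgClosed K] [W.IsElliptic] (h3 : (3 : K) ≠ 0) (hg : g.det ≠ 0)
    (hΦ : ∀ P : threeSubgroup W, Proportional (g *ᵥ vec (P : W.Point)) (vec (Φ P))) (h0 : Φ 0 = 0)
    (P Q : threeSubgroup W) : Φ (P + Q) = Φ P + Φ Q := by
  have hneg (P : threeSubgroup W) : Φ (-P) = -Φ P := by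
    by_cases hP : P = 0
    · simp [hP, h0]
    · have := transport_sum hg hΦ (P := 0) (Q := P) (R := -P) (Ne.symm hP) (by abel)
      rw [h0, zero_add] at this
      exact (neg_eq_of_add_eq_zero_right this).symm
  have hadd {P Q : threeSubgroup W} (hne : P ≠ Q) : Φ (P + Q) = Φ P + Φ Q := by
    have := transport_sum hg hΦ hne (R := -(P + Q)) (by abel)
    rw [hneg] at this
    linear_combination (norm := module) -this
  by_cases hne : P = Q
  · subst hne
    by_cases hP : P = 0
    · simp [hP, h0]
    -- Doubling involves no three distinct collinear points. With `Q` independent of `P`, the sums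
    -- `P + (P + Q)` and `-P + Q` coincide and have distinct summands, which gives `2 Φ(P) = -Φ(P)`.
    obtain ⟨Q, hQ⟩ := exists_independentThree_left h3 P.2 (fun h ↦ hP (Subtype.ext h))
    let Q₀ : threeSubgroup W := ⟨Q, hQ.right⟩
    have n1 : P ≠ Q₀ := fun h ↦ hQ.ne (congrArg Subtype.val h)
    have n2 : P ≠ P + Q₀ := fun h ↦ hQ.add_right.ne (congrArg Subtype.val h)
    have n3 : -P ≠ Q₀ := fun h ↦ hQ.ne_neg (neg_eq_iff_eq_neg.mp (congrArg Subtype.val h))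
    have e1 := hadd n1
    have e2 := hadd n2
    have e3 := hadd n3
    have hPP : P + P = -P := by linear_combination (norm := module) threeSubgroup_smul P
    rw [← add_assoc, hPP, e3, hneg, e1] at e2
    rw [hPP, hneg]
    linear_combination (norm := module) e2
  · exact hadd hne

/-- Brackets are determinants with the row `O`. The determinant of `g` and the scalars of the five
points enter numerator and denominator equally. -/
lemma transport_crossRatio (hg : g.det ≠ 0)
    (hΦ : ∀ P : threeSubgroup W, Proportional (g *ᵥ vec (P : W.Point)) (vec (Φ P))) (h0 : Φ 0 = 0)
    {S T A B : threeSubgroup W} (hA : (A : W.Point) = S + T) (hB : (B : W.Point) = S - T)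
    (hA' : Φ A = Φ S + Φ T) (hB' : Φ B = Φ S - Φ T) :
    crossRatio (Φ S) (Φ T) = crossRatio (S : W.Point) (T : W.Point) := by
  obtain ⟨x₀, hx₀, e₀⟩ := (hΦ 0).symm
  obtain ⟨x₁, hx₁, e₁⟩ := (hΦ S).symm
  obtain ⟨x₂, hx₂, e₂⟩ := (hΦ T).symm
  obtain ⟨x₃, hx₃, e₃⟩ := (hΦ A).symm
  obtain ⟨x₄, hx₄, e₄⟩ := (hΦ B).symm
  rw [crossRatio, crossRatio, ← hA, ← hB, ← hA', ← hB']
  simp only [bracket_eq_tripleProduct, neg_mul_neg]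
  rw [h0] at e₀
  rw [e₀, e₁, e₂, e₃, e₄]
  simp only [tripleProduct_smul, tripleProduct_mulVec]
  have hf : x₀ * x₁ * x₃ * g.det * (x₀ * x₂ * x₄ * g.det) ≠ 0 := by simp [*]
  refine Eq.trans ?_ (mul_div_mul_left _ _ hf)
  congr 1
  · simp only [ZeroMemClass.coe_zero]; ring
  · simp only [ZeroMemClass.coe_zero]; ring

/-- A linear map between the sets of `3`-torsion points gives a symplectic isomorphism. -/
lemma exists_symplectic_of_linear [IsAlgClosed K] [W.IsElliptic] (h3 : (3 : K) ≠ 0)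
    (hg : g.det ≠ 0) (hΦ : ∀ P : threeSubgroup W, Proportional (g *ᵥ vec (P : W.Point)) (vec (Φ P)))
    (h0 : Φ 0 = 0) :
    ∃ φ : threeSubgroup W ≃+ threeSubgroup W', (∀ P, (φ P : W'.Point) = Φ P) ∧
      ∀ S T : threeSubgroup W, weilPairing W S T = weilPairing W' (φ S) (φ T) := by
  let f : threeSubgroup W →+ W'.Point := ⟨⟨Φ, h0⟩, transport_add h3 hg hΦ h0⟩
  have hf : Function.Injective f := transport_injective hg hΦ
  -- Additivity alone puts the images into the `3`-torsion; no flex property of the image points is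
  -- needed.
  have hmem (P : threeSubgroup W) : f P ∈ threeSubgroup W' := by
    change (3 : ℤ) • f P = 0
    rw [← map_zsmul, threeSubgroup_smul, map_zero]
  let f' : threeSubgroup W →+ threeSubgroup W' := f.codRestrict _ hmem
  have hf' : Function.Injective f' := fun P Q h ↦ hf (congrArg Subtype.val h)
  obtain ⟨S, T, h⟩ := exists_independentThree (W := W) h3
  let S₀ : threeSubgroup W := ⟨S, h.left⟩
  let T₀ : threeSubgroup W := ⟨T, h.right⟩
  have hind {S T : threeSubgroup W} (h : IndependentThree (S : W.Point) (T : W.Point)) :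
      IndependentThree (f S) (f T) :=
    IndependentThree.map (S := S) (T := T) ⟨threeSubgroup_smul _, threeSubgroup_smul _,
      fun h' ↦ h.left_ne (congrArg Subtype.val h'),
      fun h' ↦ h.right_ne (congrArg Subtype.val h'), fun h' ↦ h.ne (congrArg Subtype.val h'),
      fun h' ↦ h.ne_neg (congrArg Subtype.val h')⟩ f hf
  have h' : IndependentThree (f S₀) (f T₀) := hind h
  have hsurj : Function.Surjective f' := by
    rintro ⟨P, hP⟩
    have key (Q : threeSubgroup W) (hQ : P = f Q) : ∃ a, f' a = ⟨P, hP⟩ :=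
      ⟨Q, Subtype.ext hQ.symm⟩
    rcases h'.exhaust h3 hP with h | (h | h) | (h | h) | (h | h) | (h | h)
    · exact key 0 (by simpa using h)
    · exact key S₀ h
    · exact key (-S₀) (by simpa using h)
    · exact key T₀ h
    · exact key (-T₀) (by simpa using h)
    · exact key (S₀ + T₀) (by simpa using h)
    · exact key (-(S₀ + T₀)) (by rw [map_neg, map_add]; exact h)
    · exact key (S₀ - T₀) (by simpa using h)
    · exact key (-(S₀ - T₀)) (by rw [map_neg, map_sub]; exact h)
  refine ⟨AddEquiv.ofBijective f' ⟨hf', hsurj⟩, fun P ↦ rfl, fun S T ↦ ?_⟩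
  change _ = weilPairing W' (f S) (f T)
  rcases independentThree_or (S := S) (T := T) with h | h
  · rw [weilPairing, weilPairing, if_pos h, if_pos]
    have e {P Q : threeSubgroup W} : (P : W.Point) = Q → f P = f Q :=
      fun h ↦ congrArg f (Subtype.ext h)
    rcases h with h | h | h | h
    · exact Or.inl ((e (Q := 0) h).trans (map_zero f))
    · exact Or.inr (Or.inl ((e (Q := 0) h).trans (map_zero f)))
    · exact Or.inr (Or.inr (Or.inl (e h)))
    · exact Or.inr (Or.inr (Or.inr ((e (Q := -T) h).trans (map_neg f T))))
  · rw [weilPairing_eq h, weilPairing_eq (hind h)]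
    exact congrArg (· ^ 2) (transport_crossRatio (Φ := Φ) (A := S + T) (B := S - T) hg hΦ h0 rfl rfl
      (map_add f S T) (map_sub f S T)).symm

end Transport

end LinearMaps

end HessePencil

namespace HessePencil

open MvPolynomial Matrix

/-! ### Linear substitutions and isomorphisms of plane curves -/

section LinearSubstitution

variable {k : Type*} [Field k]

/-- The substitution of linear forms in a polynomial. -/
noncomputable def linSubst (g : Matrix (Fin 3) (Fin 3) k) (F : MvPolynomial (Fin 3) k) :
    MvPolynomial (Fin 3) k :=
  aeval (fun i ↦ ∑ j, C (g i j) * X j) F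

/-- A matrix over the base field as a matrix over the algebraic closure. -/
noncomputable abbrev geomMatrix (g : Matrix (Fin 3) (Fin 3) k) :
    Matrix (Fin 3) (Fin 3) (AlgebraicClosure k) :=
  g.map (algebraMap k (AlgebraicClosure k))

lemma det_geomMatrix_ne_zero {g : Matrix (Fin 3) (Fin 3) k} (hg : g.det ≠ 0) :
    (geomMatrix g).det ≠ 0 := by
  have : (geomMatrix g).det = algebraMap k (AlgebraicClosure k) g.det :=
    (RingHom.map_det _ _).symm
  rw [this]
  exact (map_ne_zero _).mpr hg

lemma aeval_linSubst (g : Matrix (Fin 3) (Fin 3) k) (F : MvPolynomial (Fin 3) k)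
    (v : Fin 3 → AlgebraicClosure k) :
    aeval v (linSubst g F) = aeval (geomMatrix g *ᵥ v) F := by
  have h : (aeval v).comp (aeval fun i ↦ ∑ j, C (g i j) * X j) = aeval (R := k) (geomMatrix g *ᵥ v) :=
    algHom_ext fun i ↦ by simp [Matrix.mulVec, dotProduct]
  exact DFunLike.congr_fun h F

lemma linSubst_isHomogeneous (g : Matrix (Fin 3) (Fin 3) k) {F : MvPolynomial (Fin 3) k} {d : ℕ}
    (hF : F.IsHomogeneous d) : (linSubst g F).IsHomogeneous d := by
  have := hF.aeval (fun i ↦ ∑ j, C (g i j) * X j) (n := 1) fun i ↦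
    IsHomogeneous.sum _ _ _ fun j _ ↦ by
      simpa using (isHomogeneous_C (Fin 3) (g i j)).mul (isHomogeneous_X k j)
  rwa [one_mul] at this

lemma pderiv_linSubst (g : Matrix (Fin 3) (Fin 3) k) (F : MvPolynomial (Fin 3) k) (i : Fin 3) :
    pderiv i (linSubst g F) = ∑ j, linSubst g (pderiv j F) * C (g j i) := by
  induction F using MvPolynomial.induction_on with
  | C a => simp [linSubst, algebraMap_eq]
  | add p q hp hq =>
    simp only [linSubst, map_add] at *
    rw [hp, hq, ← Finset.sum_add_distrib]
    exact Finset.sum_congr rfl fun j _ ↦ by ring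
  | mul_X p n hp =>
    have h1 : linSubst g (p * X n) = linSubst g p * ∑ j, C (g n j) * X j := by simp [linSubst]
    have h2 (j : Fin 3) : linSubst g (pderiv j (p * X n)) =
        linSubst g (pderiv j p) * (∑ j, C (g n j) * X j) +
          linSubst g p * (if j = n then 1 else 0) := by
      rw [pderiv_mul, pderiv_X]
      by_cases hj : j = n
      · subst hj; simp [linSubst]
      · simp [linSubst, hj, Ne.symm hj]
    have h3 : pderiv i (∑ j, C (g n j) * X j : MvPolynomial (Fin 3) k) = C (g n i) := by
      rw [map_sum]
      simp [pderiv_X, Pi.single_apply]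
    rw [h1, pderiv_mul, hp, h3]
    simp only [h2, add_mul, Finset.sum_add_distrib, Finset.sum_mul]
    refine congrArg₂ (· + ·) ?_ ?_
    · exact Finset.sum_congr rfl fun j _ ↦ by ring
    · simp

lemma aeval_smul {F : MvPolynomial (Fin 3) k} {d : ℕ} (hF : F.IsHomogeneous d)
    (a : AlgebraicClosure k) (v : Fin 3 → AlgebraicClosure k) :
    aeval (a • v) F = a ^ d * aeval v F := by
  rw [aeval_def, aeval_def, eval₂_eq', eval₂_eq', Finset.mul_sum]
  refine Finset.sum_congr rfl fun m hm ↦ ?_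
  have h := hF (mem_support_iff.mp hm)
  rw [Finsupp.weight_apply, Finsupp.sum_fintype _ _ (by simp)] at h
  simp only [Pi.one_apply, smul_eq_mul, mul_one, Fin.sum_univ_three] at h
  rw [← h]
  simp only [Fin.prod_univ_three, Pi.smul_apply, smul_eq_mul]
  ring

end LinearSubstitution

lemma det_inv_ne_zero {K : Type*} [Field K] {g : Matrix (Fin 3) (Fin 3) K} (hg : g.det ≠ 0) :
    (g⁻¹).det ≠ 0 := by
  rw [det_nonsing_inv, Ring.inverse_eq_inv']
  exact inv_ne_zero hg

section ProjectiveMaps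

variable {k : Type*} [Field k]

lemma mk_eq_mk_of_smul {v w : Fin 3 → AlgebraicClosure k} (hv : v ≠ 0) (hw : w ≠ 0)
    {a : AlgebraicClosure k} (h : v = a • w) :
    Projectivization.mk (AlgebraicClosure k) v hv = Projectivization.mk _ w hw :=
  (Projectivization.mk_eq_mk_iff' ..).mpr ⟨a, h.symm⟩

lemma mk_eq_mk_iff_proportional {v w : Fin 3 → AlgebraicClosure k} (hv : v ≠ 0) (hw : w ≠ 0) :
    Projectivization.mk (AlgebraicClosure k) v hv = Projectivization.mk _ w hw ↔
      Proportional v w := by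
  rw [Projectivization.mk_eq_mk_iff]
  constructor
  · rintro ⟨a, h⟩
    exact ⟨a, a.ne_zero, h.symm⟩
  · rintro ⟨a, ha, h⟩
    exact ⟨Units.mk0 a ha, h.symm⟩

lemma rep_mk_proportional {v : Fin 3 → AlgebraicClosure k} (hv : v ≠ 0) :
    Proportional (Projectivization.mk (AlgebraicClosure k) v hv).rep v := by
  obtain ⟨a, h⟩ := Projectivization.exists_smul_eq_mk_rep (AlgebraicClosure k) v hv
  exact ⟨a, a.ne_zero, h.symm⟩

lemma mk_mem_planeCurve {F : MvPolynomial (Fin 3) k} {d : ℕ} (hF : F.IsHomogeneous d)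
    {v : Fin 3 → AlgebraicClosure k} (hv : v ≠ 0) :
    Projectivization.mk _ v hv ∈ planeCurve F ↔ aeval v F = 0 := by
  obtain ⟨a, ha, h⟩ := rep_mk_proportional hv
  change aeval _ F = 0 ↔ _
  rw [h, aeval_smul hF]
  simp [ha]

lemma mulVec_ne_zero {g : Matrix (Fin 3) (Fin 3) (AlgebraicClosure k)} (hg : g.det ≠ 0)
    {v : Fin 3 → AlgebraicClosure k} (hv : v ≠ 0) : g *ᵥ v ≠ 0 :=
  fun h ↦ hg (exists_mulVec_eq_zero_iff.mp ⟨v, hv, h⟩)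

/-- The action of an invertible matrix on the projective plane. -/
noncomputable def projAction (g : Matrix (Fin 3) (Fin 3) (AlgebraicClosure k)) (hg : g.det ≠ 0)
    (P : Projectivization (AlgebraicClosure k) (Fin 3 → AlgebraicClosure k)) :
    Projectivization (AlgebraicClosure k) (Fin 3 → AlgebraicClosure k) :=
  Projectivization.mk _ (g *ᵥ P.rep) (mulVec_ne_zero hg P.rep_nonzero)

lemma projAction_mk {g : Matrix (Fin 3) (Fin 3) (AlgebraicClosure k)} (hg : g.det ≠ 0)
    {v : Fin 3 → AlgebraicClosure k} (hv : v ≠ 0) :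
    projAction g hg (Projectivization.mk _ v hv) =
      Projectivization.mk _ (g *ᵥ v) (mulVec_ne_zero hg hv) :=
  (mk_eq_mk_iff_proportional ..).mpr ((rep_mk_proportional hv).mulVec g)

lemma projAction_projAction {g h : Matrix (Fin 3) (Fin 3) (AlgebraicClosure k)} (hg : g.det ≠ 0)
    (hh : h.det ≠ 0) (hgh : g * h = 1)
    (P : Projectivization (AlgebraicClosure k) (Fin 3 → AlgebraicClosure k)) :
    projAction g hg (projAction h hh P) = P := by
  induction P using Projectivization.ind with
  | h v hv =>
    rw [projAction_mk, projAction_mk]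
    simp only [mulVec_mulVec, hgh, one_mulVec]

variable {F G H : MvPolynomial (Fin 3) k} {g : Matrix (Fin 3) (Fin 3) k} {c : k}

/-- The bijection between two curves that differ by a linear substitution. -/
noncomputable def linEquiv (hF : F.IsHomogeneous 3) (hG : G.IsHomogeneous 3) (hg : g.det ≠ 0)
    (hc : c ≠ 0) (h : linSubst g G = C c * F) : planeCurve F ≃ planeCurve G where
  toFun P := ⟨projAction (geomMatrix g) (det_geomMatrix_ne_zero hg) P.1, by
    rw [projAction, mk_mem_planeCurve hG, ← aeval_linSubst, h, map_mul,
      show aeval P.1.rep F = 0 from P.2, mul_zero]⟩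
  invFun P := ⟨projAction (geomMatrix g)⁻¹ (det_inv_ne_zero (det_geomMatrix_ne_zero hg)) P.1, by
    rw [projAction, mk_mem_planeCurve hF]
    have h' := aeval_linSubst g G ((geomMatrix g)⁻¹ *ᵥ P.1.rep)
    rw [mulVec_mulVec, mul_nonsing_inv _ (isUnit_iff_ne_zero.mpr (det_geomMatrix_ne_zero hg)),
      one_mulVec, show aeval P.1.rep G = 0 from P.2, h, map_mul] at h'
    refine (mul_eq_zero.mp h').resolve_left ?_
    simpa using hc⟩
  left_inv P := Subtype.ext (projAction_projAction
    (det_inv_ne_zero (det_geomMatrix_ne_zero hg)) (det_geomMatrix_ne_zero hg)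
    (nonsing_inv_mul _ (isUnit_iff_ne_zero.mpr (det_geomMatrix_ne_zero hg))) _)
  right_inv P := Subtype.ext (projAction_projAction
    (det_geomMatrix_ne_zero hg) (det_inv_ne_zero (det_geomMatrix_ne_zero hg))
    (mul_nonsing_inv _ (isUnit_iff_ne_zero.mpr (det_geomMatrix_ne_zero hg))) _)

lemma linEquiv_coe (hF : F.IsHomogeneous 3) (hG : G.IsHomogeneous 3) (hg : g.det ≠ 0)
    (hc : c ≠ 0) (h : linSubst g G = C c * F) (P : planeCurve F) :
    (linEquiv hF hG hg hc h P).1 = projAction (geomMatrix g) (det_geomMatrix_ne_zero hg) P.1 := rfl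

lemma linEquiv_symm_coe (hF : F.IsHomogeneous 3) (hG : G.IsHomogeneous 3) (hg : g.det ≠ 0)
    (hc : c ≠ 0) (h : linSubst g G = C c * F) (P : planeCurve G) :
    ((linEquiv hF hG hg hc h).symm P).1 =
      projAction (geomMatrix g)⁻¹ (det_inv_ne_zero (det_geomMatrix_ne_zero hg)) P.1 := rfl

/-- Composition of a morphism with a linear isomorphism. -/
lemma IsMorphism.comp_linEquiv {hF : F.IsHomogeneous 3} {hG : G.IsHomogeneous 3} {hg : g.det ≠ 0}
    {hc : c ≠ 0} {h : linSubst g G = C c * F} {φ : planeCurve G → planeCurve H}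
    (hφ : IsMorphism φ) : IsMorphism (φ ∘ linEquiv hF hG hg hc h) := by
  intro P
  obtain ⟨d, f, hf, hP, hQ⟩ := hφ (linEquiv hF hG hg hc h P)
  -- The chosen representative of the image point is only a multiple of `g *ᵥ Q.rep`; homogeneity
  -- turns the factor into its `d`-th power.
  have key (Q : planeCurve F) : ∃ a : AlgebraicClosure k, a ≠ 0 ∧
      (fun i ↦ aeval (linEquiv hF hG hg hc h Q).1.rep (f i)) =
        a • fun i ↦ aeval Q.1.rep (linSubst g (f i)) := by
    obtain ⟨a, ha, h'⟩ := rep_mk_proportional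
      (mulVec_ne_zero (det_geomMatrix_ne_zero hg) Q.1.rep_nonzero)
    refine ⟨a ^ d, pow_ne_zero d ha, ?_⟩
    ext i
    rw [linEquiv_coe, projAction, h', aeval_smul (hf i), Pi.smul_apply, aeval_linSubst, smul_eq_mul]
  refine ⟨d, fun i ↦ linSubst g (f i), fun i ↦ linSubst_isHomogeneous g (hf i), ?_, ?_⟩
  · obtain ⟨a, ha, h'⟩ := key P
    intro h0
    rw [h0, smul_zero] at h'
    exact hP h'
  · intro Q hQ0
    obtain ⟨a, ha, h'⟩ := key Q
    have hne := smul_ne_zero ha hQ0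
    rw [← h'] at hne
    rw [Function.comp_apply, hQ _ hne]
    exact mk_eq_mk_of_smul _ _ h'

/-- Composition of the inverse of a linear isomorphism with a morphism. -/
lemma IsMorphism.linEquiv_symm_comp {hF : F.IsHomogeneous 3} {hG : G.IsHomogeneous 3}
    {hg : g.det ≠ 0} {hc : c ≠ 0} {h : linSubst g G = C c * F} {φ : planeCurve H → planeCurve G}
    (hφ : IsMorphism φ) : IsMorphism ((linEquiv hF hG hg hc h).symm ∘ φ) := by
  intro P
  obtain ⟨d, f, hf, hP, hQ⟩ := hφ P
  have hinv : (geomMatrix g)⁻¹ = geomMatrix g⁻¹ := by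
    refine inv_eq_right_inv ?_
    rw [← Matrix.map_mul, mul_nonsing_inv _ (isUnit_iff_ne_zero.mpr hg)]
    simp
  have hg' := det_inv_ne_zero hg
  have key (Q : planeCurve H) : (fun i ↦ aeval Q.1.rep (∑ j, C (g⁻¹ i j) * f j)) =
      geomMatrix g⁻¹ *ᵥ fun i ↦ aeval Q.1.rep (f i) := by
    ext i
    simp [Matrix.mulVec, dotProduct]
  refine ⟨d, fun i ↦ ∑ j, C (g⁻¹ i j) * f j, fun i ↦ IsHomogeneous.sum _ _ _ fun j _ ↦ by
      simpa using (isHomogeneous_C (Fin 3) (g⁻¹ i j)).mul (hf j), ?_, ?_⟩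
  · rw [key]
    exact mulVec_ne_zero (det_geomMatrix_ne_zero hg') hP
  · intro Q hQ0
    have hne : (fun i ↦ aeval Q.1.rep (f i)) ≠ 0 := by
      intro h0
      rw [key, h0, mulVec_zero] at hQ0
      exact hQ0 rfl
    have hv := hQ Q hne
    rw [Function.comp_apply, linEquiv_symm_coe, hv, projAction_mk]
    simp only [key, hinv]

lemma isMorphism_id : IsMorphism (id : planeCurve F → planeCurve F) := by
  intro P
  refine ⟨1, fun i ↦ X i, fun i ↦ isHomogeneous_X k i, ?_, fun Q hQ ↦ ?_⟩
  · simpa using P.1.rep_nonzero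
  · conv_lhs => rw [id, ← Q.1.mk_rep]
    exact mk_eq_mk_of_smul _ _ (a := 1) (by ext i; simp)

lemma pointO_mem_iff (hF : F.IsHomogeneous 3) :
    pointO k ∈ planeCurve F ↔ aeval ![(0 : AlgebraicClosure k), 1, 0] F = 0 :=
  mk_mem_planeCurve hF _

/-- Linear isomorphisms respect isomorphism classes of pointed curves. -/
lemma IsomorphicOver.comp_linear (hF : F.IsHomogeneous 3) (hG : G.IsHomogeneous 3)
    (hg : g.det ≠ 0) (hc : c ≠ 0) (h : linSubst g G = C c * F) (h01 : g 0 1 = 0) (h21 : g 2 1 = 0)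
    (hGH : IsomorphicOver G H) : IsomorphicOver F H := by
  obtain ⟨φ, h₁, h₂, hO, hO', h₃⟩ := hGH
  have hgO : projAction (geomMatrix g) (det_geomMatrix_ne_zero hg) (pointO k) = pointO k := by
    rw [pointO, projAction_mk]
    refine mk_eq_mk_of_smul _ _ (a := algebraMap k _ (g 1 1)) ?_
    ext i
    fin_cases i <;> simp [Matrix.mulVec, dotProduct, Fin.sum_univ_three, h01, h21]
  have hOF : pointO k ∈ planeCurve F := by
    have h' := ((linEquiv hF hG hg hc h).symm ⟨pointO k, hO⟩).2
    convert h'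
    symm
    rw [linEquiv_symm_coe]
    change projAction _ _ (pointO k) = _
    rw [← hgO, projAction_projAction]
    · rw [hgO]
    · exact nonsing_inv_mul _ (isUnit_iff_ne_zero.mpr (det_geomMatrix_ne_zero hg))
  refine ⟨(linEquiv hF hG hg hc h).trans φ,
    h₁.comp_linEquiv (hF := hF) (hG := hG) (hg := hg) (hc := hc) (h := h),
    h₂.linEquiv_symm_comp (hF := hF) (hG := hG) (hg := hg) (hc := hc) (h := h), hOF, hO', ?_⟩
  have e : linEquiv hF hG hg hc h ⟨pointO k, hOF⟩ = ⟨pointO k, hO⟩ := Subtype.ext hgO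
  rw [Equiv.trans_apply, e, h₃]

lemma IsomorphicOver.refl (hO : pointO k ∈ planeCurve F) :
    IsomorphicOver F F :=
  ⟨Equiv.refl _, isMorphism_id, isMorphism_id, hO, hO, rfl⟩

/-- Smoothness is invariant under linear substitution. -/
lemma IsSmoothCurve.of_linSubst (hF : F.IsHomogeneous 3) (hG : G.IsHomogeneous 3)
    (hg : g.det ≠ 0) (hc : c ≠ 0) (h : linSubst g G = C c * F) (hs : IsSmoothCurve G) :
    IsSmoothCurve F := by
  intro P hP
  by_contra! h0
  obtain ⟨j, hj⟩ := hs _ (linEquiv hF hG hg hc h ⟨P, hP⟩).2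
  apply hj
  obtain ⟨a, ha, h'⟩ := rep_mk_proportional
    (mulVec_ne_zero (det_geomMatrix_ne_zero hg) P.rep_nonzero)
  rw [linEquiv_coe, projAction, h', aeval_smul (hG.pderiv), ← aeval_linSubst]
  -- By the chain rule, the gradient of `G` at the image point, multiplied by the invertible `g`, is
  -- a multiple of the vanishing gradient of `F`.
  have key : (fun j ↦ aeval P.rep (linSubst g (pderiv j G))) ᵥ* geomMatrix g = 0 := by
    ext i
    have e := congrArg (aeval P.rep) (congrArg (pderiv i) h)
    rw [pderiv_linSubst, pderiv_C_mul, map_mul, h0 i, mul_zero] at e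
    simpa [Matrix.vecMul, dotProduct] using e
  have := eq_zero_of_vecMul_eq_zero (det_geomMatrix_ne_zero hg) key
  rw [congrFun this j]
  simp

end ProjectiveMaps

end HessePencil

namespace HessePencil

open MvPolynomial Matrix WeierstrassCurve

/-! ### The Hesse pencil in coordinates -/

section PencilForms

variable {k : Type*} [Field k]

lemma C_two : (C 2 : MvPolynomial (Fin 3) k) = 2 := map_ofNat C 2

lemma C_three : (C 3 : MvPolynomial (Fin 3) k) = 3 := map_ofNat C 3

lemma C_four : (C 4 : MvPolynomial (Fin 3) k) = 4 := map_ofNat C 4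

lemma C_eight : (C 8 : MvPolynomial (Fin 3) k) = 8 := map_ofNat C 8

/-- A cubic form without the monomial `Y³`, given by its coefficients. -/
noncomputable def cubicForm (c : Fin 9 → k) : MvPolynomial (Fin 3) k :=
  C (c 0) * (X 0 * X 1 ^ 2) + C (c 1) * (X 0 ^ 2 * X 1) + C (c 2) * (X 1 ^ 2 * X 2)
    + C (c 3) * (X 0 * X 1 * X 2) + C (c 4) * (X 1 * X 2 ^ 2) + C (c 5) * X 0 ^ 3
    + C (c 6) * (X 0 ^ 2 * X 2) + C (c 7) * (X 0 * X 2 ^ 2) + C (c 8) * X 2 ^ 3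

lemma cubicForm_isHomogeneous (c : Fin 9 → k) : (cubicForm c).IsHomogeneous 3 := by
  have hX (i : Fin 3) := isHomogeneous_X k i
  have hC {a : k} {F : MvPolynomial (Fin 3) k} (hF : F.IsHomogeneous 3) :
      (C a * F).IsHomogeneous 3 := by simpa using (isHomogeneous_C (Fin 3) a).mul hF
  refine IsHomogeneous.add (IsHomogeneous.add (IsHomogeneous.add (IsHomogeneous.add
    (IsHomogeneous.add (IsHomogeneous.add (IsHomogeneous.add (IsHomogeneous.add
    (hC ?_) (hC ?_)) (hC ?_)) (hC ?_)) (hC ?_)) (hC ?_)) (hC ?_)) (hC ?_)) (hC ?_)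
  · exact (hX 0).mul ((hX 1).pow 2)
  · exact ((hX 0).pow 2).mul (hX 1)
  · exact ((hX 1).pow 2).mul (hX 2)
  · exact ((hX 0).mul (hX 1)).mul (hX 2)
  · exact (hX 1).mul ((hX 2).pow 2)
  · exact (hX 0).pow 3
  · exact ((hX 0).pow 2).mul (hX 2)
  · exact (hX 0).mul ((hX 2).pow 2)
  · exact (hX 2).pow 3

lemma aeval_cubicForm (c : Fin 9 → k) (v : Fin 3 → AlgebraicClosure k) :
    aeval v (cubicForm c) = algebraMap k _ (c 0) * (v 0 * v 1 ^ 2)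
      + algebraMap k _ (c 1) * (v 0 ^ 2 * v 1) + algebraMap k _ (c 2) * (v 1 ^ 2 * v 2)
      + algebraMap k _ (c 3) * (v 0 * v 1 * v 2) + algebraMap k _ (c 4) * (v 1 * v 2 ^ 2)
      + algebraMap k _ (c 5) * v 0 ^ 3 + algebraMap k _ (c 6) * (v 0 ^ 2 * v 2)
      + algebraMap k _ (c 7) * (v 0 * v 2 ^ 2) + algebraMap k _ (c 8) * v 2 ^ 3 := by
  simp [cubicForm]

variable (E : WeierstrassCurve k)

lemma polynomial_eq_cubicForm : E.toProjective.polynomial =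
    cubicForm ![0, 0, 1, E.a₁, E.a₃, -1, -E.a₂, -E.a₄, -E.a₆] := by
  simp [cubicForm, Projective.polynomial]
  ring

/-- The member `3 x F + Ψ₃` of the Hesse pencil. -/
noncomputable def hessForm : MvPolynomial (Fin 3) k :=
  cubicForm ![3, 3 * E.a₁, 0, 3 * E.a₃, 0, E.b₂ - 3 * E.a₂, 3 * E.b₄ - 3 * E.a₄,
    3 * E.b₆ - 3 * E.a₆, E.b₈]

/-- Modulo `F` the classical Hessian is `8` times `hessForm`, so in characteristic two it
degenerates to a multiple of `F`; hence the modified form there. -/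
lemma hessian_eq : hessian E.toProjective.polynomial =
    C 8 * hessForm E + C (8 * E.a₂ + 2 * E.a₁ ^ 2) * E.toProjective.polynomial := by
  have h0 : pderiv 0 E.toProjective.polynomial = C E.a₁ * X 1 * X 2 -
      (C 3 * X 0 ^ 2 + C 2 * C E.a₂ * X 0 * X 2 + C E.a₄ * X 2 ^ 2) := by
    refine (Projective.polynomialX_eq (W' := E)).trans ?_
    simp [C_two, C_three]
  have h1 : pderiv 1 E.toProjective.polynomial = C 2 * X 1 * X 2 + C E.a₁ * X 0 * X 2
      + C E.a₃ * X 2 ^ 2 := by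
    refine (Projective.polynomialY_eq (W' := E)).trans ?_
    simp [C_two]
  have h2 : pderiv 2 E.toProjective.polynomial = X 1 ^ 2 + C E.a₁ * X 0 * X 1 +
      C 2 * C E.a₃ * X 1 * X 2 - (C E.a₂ * X 0 ^ 2 + C 2 * C E.a₄ * X 0 * X 2
      + C 3 * C E.a₆ * X 2 ^ 2) := by
    refine (Projective.polynomialZ_eq (W' := E)).trans ?_
    simp [C_two, C_three]
  rw [hessian, Matrix.det_fin_three]
  simp only [Matrix.of_apply, h0, h1, h2]
  simp only [map_sub, map_add, pderiv_mul, pderiv_pow, pderiv_X, pderiv_C, Pi.single_apply]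
  simp [Projective.polynomial, hessForm, cubicForm, b₂, b₄, b₆, b₈, C_two, C_three, C_four, C_eight]
  ring

lemma hessianCharTwo_eq (h2 : (2 : k) = 0) : hessianCharTwo E =
    C 1 * hessForm E + C (E.a₁ ^ 2) * E.toProjective.polynomial := by
  have h2' : (2 : MvPolynomial (Fin 3) k) = 0 := by
    rw [← C_two, h2, C_0]
  simp [hessianCharTwo, Projective.polynomial, hessForm, cubicForm, b₂, b₄, b₆, b₈, C_two, C_three,
    C_four]
  linear_combination (-(X 0 * X 1 ^ 2 + C E.a₁ * X 0 ^ 2 * X 1 + C E.a₃ * X 0 * X 1 * X 2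
    + (C E.a₄ + C E.a₁ * C E.a₃ - C E.a₁ ^ 2 * C E.a₂) * X 0 ^ 2 * X 2
    + (C E.a₃ ^ 2 + 4 * C E.a₆ - C E.a₁ ^ 2 * C E.a₄) * X 0 * X 2 ^ 2
    + (2 * C E.a₂ * C E.a₆ - C E.a₁ * C E.a₃ * C E.a₄ - C E.a₄ ^ 2) * X 2 ^ 3)) * h2'

/-- The only property of `hess` used below; it makes the rest of the argument independent of the
characteristic. -/
lemma exists_hess_eq : ∃ u c : k, u ≠ 0 ∧
    hess E = C u * hessForm E + C c * E.toProjective.polynomial := by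
  by_cases h2 : (2 : k) = 0
  · exact ⟨1, _, one_ne_zero, by rw [hess, if_pos h2, hessianCharTwo_eq E h2]⟩
  · refine ⟨8, _, ?_, by rw [hess, if_neg h2, hessian_eq]⟩
    rw [show (8 : k) = 2 ^ 3 by norm_num]
    exact pow_ne_zero 3 h2

lemma fiber_infty : fiber E OnePoint.infty = E.toProjective.polynomial := rfl

lemma exists_fiber_coe (t : k) : ∃ u s : k, u ≠ 0 ∧
    fiber E (t : OnePoint k) = C u * (hessForm E + C s * E.toProjective.polynomial) := by
  obtain ⟨u, c, hu, h⟩ := exists_hess_eq E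
  refine ⟨u, (t + c) / u, hu, ?_⟩
  change C t * _ + hess E = _
  rw [h, mul_add, ← mul_assoc (C u) (C ((t + c) / u)), ← C_mul, mul_div_cancel₀ _ hu, C_add]
  ring

/-- Every form in the pencil spanned by the cubic and its Hessian is a fiber, up to a factor. -/
lemma exists_eq_fiber {a b : k} (hab : a ≠ 0 ∨ b ≠ 0) : ∃ (t : OnePoint k) (c : k), c ≠ 0 ∧
    C a * hessForm E + C b * E.toProjective.polynomial = C c * fiber E t := by
  by_cases ha : a = 0
  · subst ha
    exact ⟨OnePoint.infty, b, hab.resolve_left (by simp), by simp [fiber_infty]⟩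
  obtain ⟨u, c, hu, h⟩ := exists_hess_eq E
  -- The parameter solves `(a / u) (t + c) = b`.
  refine ⟨((b * u / a - c : k) : OnePoint k), a / u, div_ne_zero ha hu, ?_⟩
  change _ = C _ * (C _ * _ + hess E)
  have e1 : C (a / u) * C u = (C a : MvPolynomial (Fin 3) k) := by
    rw [← C_mul, div_mul_cancel₀ _ hu]
  have e2 : C (a / u) * C (b * u / a) = (C b : MvPolynomial (Fin 3) k) := by
    rw [← C_mul]; congr 1; field_simp
  rw [h, C_sub]
  linear_combination -hessForm E * e1 - E.toProjective.polynomial * e2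

lemma fiber_isHomogeneous (t : OnePoint k) : (fiber E t).IsHomogeneous 3 := by
  have hF : E.toProjective.polynomial.IsHomogeneous 3 := by
    rw [polynomial_eq_cubicForm]; exact cubicForm_isHomogeneous _
  induction t using OnePoint.rec with
  | infty => exact hF
  | coe t =>
    obtain ⟨u, s, -, h⟩ := exists_fiber_coe E t
    have hC {a : k} {F : MvPolynomial (Fin 3) k} (hF : F.IsHomogeneous 3) :
        (C a * F).IsHomogeneous 3 := by simpa using (isHomogeneous_C (Fin 3) a).mul hF
    rw [h]
    exact hC ((cubicForm_isHomogeneous _).add (hC hF))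

lemma polynomial_isHomogeneous : E.toProjective.polynomial.IsHomogeneous 3 :=
  fiber_isHomogeneous E OnePoint.infty

/-- The coefficients of a Weierstrass cubic after a linear substitution that fixes `O`. -/
lemma exists_linSubst_eq_cubicForm {g : Matrix (Fin 3) (Fin 3) k} (h01 : g 0 1 = 0)
    (h11 : g 1 1 = 1) (h21 : g 2 1 = 0) :
    ∃ c : Fin 9 → k, linSubst g E.toProjective.polynomial = cubicForm c := by
  obtain ⟨a, ha⟩ : ∃ a, a = g 0 0 := ⟨_, rfl⟩
  obtain ⟨b, hb⟩ : ∃ a, a = g 0 2 := ⟨_, rfl⟩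
  obtain ⟨d, hd⟩ : ∃ a, a = g 1 0 := ⟨_, rfl⟩
  obtain ⟨e, he⟩ : ∃ a, a = g 1 2 := ⟨_, rfl⟩
  obtain ⟨p, hp⟩ : ∃ a, a = g 2 0 := ⟨_, rfl⟩
  obtain ⟨q, hq⟩ : ∃ a, a = g 2 2 := ⟨_, rfl⟩
  -- After substitution, `y (y + a₁x + a₃z)` is `(Y + dX + eZ) (Y + rX + sZ)`, and `m = d + r`, `n =
  -- e + s`.
  let m := 2 * d + E.a₁ * a + E.a₃ * p
  let n := 2 * e + E.a₁ * b + E.a₃ * q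
  let r := d + E.a₁ * a + E.a₃ * p
  let s := e + E.a₁ * b + E.a₃ * q
  refine ⟨![p, m * p, q, m * q + n * p, n * q,
    d * r * p - (a ^ 3 + E.a₂ * a ^ 2 * p + E.a₄ * a * p ^ 2 + E.a₆ * p ^ 3),
    d * r * q + (d * s + e * r) * p - (3 * a ^ 2 * b + E.a₂ * (a ^ 2 * q + 2 * a * b * p)
      + E.a₄ * (b * p ^ 2 + 2 * a * p * q) + 3 * E.a₆ * p ^ 2 * q),
    (d * s + e * r) * q + e * s * p - (3 * a * b ^ 2 + E.a₂ * (b ^ 2 * p + 2 * a * b * q)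
      + E.a₄ * (a * q ^ 2 + 2 * b * p * q) + 3 * E.a₆ * p * q ^ 2),
    e * s * q - (b ^ 3 + E.a₂ * b ^ 2 * q + E.a₄ * b * q ^ 2 + E.a₆ * q ^ 3)], ?_⟩
  simp [linSubst, Projective.polynomial, cubicForm, Fin.sum_univ_three, h01, h11, h21, ← ha, ← hb,
    ← hd, ← he, ← hp, ← hq, m, n, r, s, algebraMap_eq,
    C_two, C_three]
  ring

end PencilForms

/-! ### Cubics through the nine points -/

section VanishingCubics

variable {K : Type*} [Field K]

lemma cubic_coeff_eq_zero {a b c d x₁ x₂ x₃ x₄ : K} (h₁₂ : x₁ ≠ x₂) (h₁₃ : x₁ ≠ x₃)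
    (h₁₄ : x₁ ≠ x₄) (h₂₃ : x₂ ≠ x₃) (h₂₄ : x₂ ≠ x₄) (h₃₄ : x₃ ≠ x₄)
    (h₁ : a * x₁ ^ 3 + b * x₁ ^ 2 + c * x₁ + d = 0) (h₂ : a * x₂ ^ 3 + b * x₂ ^ 2 + c * x₂ + d = 0)
    (h₃ : a * x₃ ^ 3 + b * x₃ ^ 2 + c * x₃ + d = 0)
    (h₄ : a * x₄ ^ 3 + b * x₄ ^ 2 + c * x₄ + d = 0) : a = 0 ∧ b = 0 ∧ c = 0 ∧ d = 0 := by
  have first {x y : K} (hxy : x ≠ y) (hx : a * x ^ 3 + b * x ^ 2 + c * x + d = 0)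
      (hy : a * y ^ 3 + b * y ^ 2 + c * y + d = 0) :
      a * (x ^ 2 + x * y + y ^ 2) + b * (x + y) + c = 0 :=
    mul_left_cancel₀ (sub_ne_zero.mpr hxy) (by linear_combination hx - hy)
  have q12 := first h₁₂ h₁ h₂
  have q13 := first h₁₃ h₁ h₃
  have q14 := first h₁₄ h₁ h₄
  have q23 : a * (x₁ + x₂ + x₃) + b = 0 :=
    mul_left_cancel₀ (sub_ne_zero.mpr h₂₃) (by linear_combination q12 - q13)
  have q24 : a * (x₁ + x₂ + x₄) + b = 0 :=
    mul_left_cancel₀ (sub_ne_zero.mpr h₂₄) (by linear_combination q12 - q14)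
  have ha : a = 0 := mul_left_cancel₀ (sub_ne_zero.mpr h₃₄) (by linear_combination q23 - q24)
  subst ha
  have hb : b = 0 := by linear_combination q23
  subst hb
  have hc : c = 0 := by linear_combination q12
  subst hc
  exact ⟨rfl, rfl, rfl, by linear_combination h₁⟩

variable [DecidableEq K] {W : WeierstrassCurve.Affine K}

/-- The cubics through the nine points of order dividing three form the Hesse pencil. -/
lemma pencil_of_vanishing [IsAlgClosed K] [W.IsElliptic] (h3 : (3 : K) ≠ 0) (c : Fin 9 → K)
    (h : ∀ (x y : K) (hn : W.Nonsingular x y), (3 : ℤ) • Affine.Point.some x y hn = 0 →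
      c 0 * (x * y ^ 2) + c 1 * (x ^ 2 * y) + c 2 * y ^ 2 + c 3 * (x * y) + c 4 * y + c 5 * x ^ 3
        + c 6 * x ^ 2 + c 7 * x + c 8 = 0) :
    c 1 = c 0 * W.a₁ ∧ c 3 = c 0 * W.a₃ + c 2 * W.a₁ ∧ c 4 = c 2 * W.a₃ ∧
      3 * c 5 = c 0 * (W.b₂ - 3 * W.a₂) - 3 * c 2 ∧
      3 * c 6 = c 0 * (3 * W.b₄ - 3 * W.a₄) - 3 * c 2 * W.a₂ ∧
      3 * c 7 = c 0 * (3 * W.b₆ - 3 * W.a₆) - 3 * c 2 * W.a₄ ∧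
      3 * c 8 = c 0 * W.b₈ - 3 * c 2 * W.a₆ := by
  obtain ⟨S, T, hST⟩ := exists_independentThree (W := W) h3
  obtain ⟨x₁, x₂, x₃, x₄, ⟨y₁, h₁, e₁⟩, ⟨y₂, h₂, e₂⟩, ⟨y₃, h₃, e₃⟩, ⟨y₄, h₄, e₄⟩,
    n₁₂, n₁₃, n₁₄, n₂₃, n₂₄, n₃₄, -⟩ := hST.exists_coordinates h3
  -- Subtracting the conditions at `P` and `-P` and dividing by `2y + a₁x + a₃` isolates a quadratic
  -- in `x`. The rest becomes a cubic in `x` after removing `y²` by the curve equation and `x⁴` by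
  -- `Ψ₃`, whence the factor `3`. Both vanish at four abscissas.
  have key {x y : K} (hn : W.Nonsingular x y) (h0 : (3 : ℤ) • Affine.Point.some x y hn = 0) :
      (0 * x ^ 3 + (c 1 - c 0 * W.a₁) * x ^ 2 + (c 3 - c 0 * W.a₃ - c 2 * W.a₁) * x
        + (c 4 - c 2 * W.a₃) = 0) ∧
      (3 * c 5 - (c 0 * (W.b₂ - 3 * W.a₂) - 3 * c 2)) * x ^ 3
        + (3 * c 6 - (c 0 * (3 * W.b₄ - 3 * W.a₄) - 3 * c 2 * W.a₂)) * x ^ 2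
        + (3 * c 7 - (c 0 * (3 * W.b₆ - 3 * W.a₆) - 3 * c 2 * W.a₄)) * x
        + (3 * c 8 - (c 0 * W.b₈ - 3 * c 2 * W.a₆)) = 0 := by
    have hD := (flex_of_three_zsmul hn h0).1
    have hΨ := (three_zsmul_some_iff_Ψ₃ hn).mp h0
    have he := (Affine.equation_iff ..).mp hn.1
    have h0' : (3 : ℤ) • Affine.Point.some x (W.negY x y) ((Affine.nonsingular_neg x y).mpr hn) = 0 := by
      rw [← Affine.Point.neg_some hn, zsmul_neg, h0, neg_zero]
    have v₁ := h x y hn h0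
    have v₂ := h x (W.negY x y) ((Affine.nonsingular_neg x y).mpr hn) h0'
    rw [Affine.negY] at v₂
    have hB : 0 * x ^ 3 + (c 1 - c 0 * W.a₁) * x ^ 2 + (c 3 - c 0 * W.a₃ - c 2 * W.a₁) * x
        + (c 4 - c 2 * W.a₃) = 0 :=
      mul_left_cancel₀ hD (by linear_combination v₁ - v₂)
    refine ⟨hB, ?_⟩
    simp [Ψ₃] at hΨ
    linear_combination 3 * v₁ - 3 * y * hB - 3 * (c 0 * x + c 2) * he - c 0 * hΨ
  have r₁ : (3 : ℤ) • Affine.Point.some x₁ y₁ h₁ = 0 := e₁ ▸ hST.left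
  have r₂ : (3 : ℤ) • Affine.Point.some x₂ y₂ h₂ = 0 := e₂ ▸ hST.right
  have r₃ : (3 : ℤ) • Affine.Point.some x₃ y₃ h₃ = 0 := e₃ ▸ hST.add_right.right
  have r₄ : (3 : ℤ) • Affine.Point.some x₄ y₄ h₄ = 0 := e₄ ▸ hST.sub_right.right
  obtain ⟨-, t₁, t₂, t₃⟩ := cubic_coeff_eq_zero n₁₂ n₁₃ n₁₄ n₂₃ n₂₄ n₃₄ (key h₁ r₁).1 (key h₂ r₂).1
    (key h₃ r₃).1 (key h₄ r₄).1
  obtain ⟨s₁, s₂, s₃, s₄⟩ := cubic_coeff_eq_zero n₁₂ n₁₃ n₁₄ n₂₃ n₂₄ n₃₄ (key h₁ r₁).2 (key h₂ r₂).2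
    (key h₃ r₃).2 (key h₄ r₄).2
  exact ⟨sub_eq_zero.mp t₁, by linear_combination t₂, sub_eq_zero.mp t₃, sub_eq_zero.mp s₁,
    sub_eq_zero.mp s₂, sub_eq_zero.mp s₃, sub_eq_zero.mp s₄⟩

end VanishingCubics

end HessePencil

namespace HessePencil

open MvPolynomial Matrix WeierstrassCurve

/-! ### Geometric points and Galois descent of the linear map -/

section GeometricPoints

variable {k : Type*} [Field k] (E : WeierstrassCurve k)

instance [E.IsElliptic] :
    WeierstrassCurve.IsElliptic (Affine.baseChange E (AlgebraicClosure k)) :=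
  inferInstanceAs (E.map (algebraMap k (AlgebraicClosure k))).IsElliptic

lemma algebraMap_two : algebraMap k (AlgebraicClosure k) 2 = 2 := map_ofNat _ 2

lemma algebraMap_three : algebraMap k (AlgebraicClosure k) 3 = 3 := map_ofNat _ 3

lemma three_ne_zero_algebraicClosure (h3 : (3 : k) ≠ 0) : (3 : AlgebraicClosure k) ≠ 0 := by
  rw [← algebraMap_three]
  exact (map_ne_zero _).mpr h3

lemma aeval_polynomial (v : Fin 3 → AlgebraicClosure k) : aeval v E.toProjective.polynomial =
    v 1 ^ 2 * v 2 + algebraMap k _ E.a₁ * v 0 * v 1 * v 2 + algebraMap k _ E.a₃ * v 1 * v 2 ^ 2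
      - (v 0 ^ 3 + algebraMap k _ E.a₂ * v 0 ^ 2 * v 2 + algebraMap k _ E.a₄ * v 0 * v 2 ^ 2
        + algebraMap k _ E.a₆ * v 2 ^ 3) := by
  simp [Projective.polynomial]

lemma equation_baseChange_iff (x y : AlgebraicClosure k) :
    (Affine.baseChange E (AlgebraicClosure k)).Equation x y ↔
      aeval ![x, y, 1] E.toProjective.polynomial = 0 := by
  rw [aeval_polynomial, Affine.equation_iff']
  simp [WeierstrassCurve.baseChange]

lemma aeval_vec_polynomial (P : GeomPoint E) : aeval (vec P) E.toProjective.polynomial = 0 := by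
  rcases P with _ | ⟨x, y, h⟩
  · rw [aeval_polynomial]
    simp [vec]
  · exact (equation_baseChange_iff E x y).mp h.1

lemma proportional_of_last_eq_zero {v : Fin 3 → AlgebraicClosure k} (hv : v ≠ 0)
    (h : aeval v E.toProjective.polynomial = 0) (h2 : v 2 = 0) : Proportional v ![0, 1, 0] := by
  rw [aeval_polynomial, h2] at h
  have h0 : v 0 = 0 := by simpa using h
  refine ⟨v 1, fun h1 ↦ hv ?_, ?_⟩ <;> ext i <;> fin_cases i <;> simp [*]

lemma proportional_of_last_ne_zero {v : Fin 3 → AlgebraicClosure k} (h2 : v 2 ≠ 0) :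
    Proportional v ![v 0 / v 2, v 1 / v 2, 1] := by
  refine ⟨v 2, h2, ?_⟩
  ext i
  fin_cases i <;> simp [mul_div_cancel₀ _ h2]

lemma exists_proportional_vec [E.IsElliptic] {v : Fin 3 → AlgebraicClosure k} (hv : v ≠ 0)
    (h : aeval v E.toProjective.polynomial = 0) : ∃ P : GeomPoint E, Proportional v (vec P) := by
  by_cases h2 : v 2 = 0
  · exact ⟨0, proportional_of_last_eq_zero E hv h h2⟩
  · obtain ⟨c, hc, e⟩ := proportional_of_last_ne_zero h2
    have h' := h
    rw [e, aeval_smul (polynomial_isHomogeneous E)] at h'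
    have h'' := (mul_eq_zero.mp h').resolve_left (pow_ne_zero 3 hc)
    exact ⟨Affine.Point.some _ _ (Affine.equation_iff_nonsingular.mp
      ((equation_baseChange_iff E _ _).mpr h'')), c, hc, e⟩

lemma isSmoothCurve_polynomial [E.IsElliptic] : IsSmoothCurve E.toProjective.polynomial := by
  intro P hP
  obtain ⟨Q, c, hc, e⟩ := exists_proportional_vec E P.rep_nonzero hP
  suffices ∃ i, aeval (vec Q) (pderiv i E.toProjective.polynomial) ≠ 0 by
    obtain ⟨i, hi⟩ := this
    refine ⟨i, ?_⟩
    rw [e, aeval_smul (polynomial_isHomogeneous E).pderiv]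
    exact mul_ne_zero (pow_ne_zero _ hc) hi
  rcases Q with _ | ⟨x, y, h⟩
  · refine ⟨2, ?_⟩
    rw [show pderiv 2 E.toProjective.polynomial = _ from Projective.polynomialZ_eq (W' := E)]
    simp [vec]
  · rcases ((Affine.nonsingular_iff' ..).mp h).2 with h | h
    · refine ⟨0, ?_⟩
      rw [show pderiv 0 E.toProjective.polynomial = _ from Projective.polynomialX_eq (W' := E)]
      simpa [vec, WeierstrassCurve.baseChange, algebraMap_two, algebraMap_three] using h
    · refine ⟨1, ?_⟩
      rw [show pderiv 1 E.toProjective.polynomial = _ from Projective.polynomialY_eq (W' := E)]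
      simpa [vec, WeierstrassCurve.baseChange, algebraMap_two] using h

lemma vec_galois (σ : AlgebraicClosure k ≃ₐ[k] AlgebraicClosure k) (P : GeomPoint E) :
    vec (galois E σ P) = σ ∘ vec P := by
  rcases P with _ | ⟨x, y, h⟩
  · change (![0, 1, 0] : Fin 3 → AlgebraicClosure k) = σ ∘ ![0, 1, 0]
    ext i
    fin_cases i <;> simp
  · change (![σ x, σ y, 1] : Fin 3 → AlgebraicClosure k) = σ ∘ ![x, y, 1]
    ext i
    fin_cases i <;> simp

end GeometricPoints

section Descent

/-- A matrix for which four points in general position are eigenvectors is scalar. -/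
lemma eq_smul_of_eigenvectors {K : Type*} [Field K] {h : Matrix (Fin 3) (Fin 3) K}
    {o s t p : Fin 3 → K} (h₁ : tripleProduct o s t ≠ 0)
    (h₂ : tripleProduct p s t ≠ 0) (h₃ : tripleProduct o p t ≠ 0) (h₄ : tripleProduct o s p ≠ 0)
    (ho : ∃ c : K, h *ᵥ o = c • o) (hs : ∃ c : K, h *ᵥ s = c • s)
    (ht : ∃ c : K, h *ᵥ t = c • t) (hp : ∃ c : K, h *ᵥ p = c • p) :
    ∃ c : K, h = c • (1 : Matrix (Fin 3) (Fin 3) K) := by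
  obtain ⟨M, hM, eo, es, et, ep⟩ := exists_frame h₁ h₂ h₃ h₄
  have transfer {u v : Fin 3 → K} (hu : ∃ c : K, h *ᵥ u = c • u) (e : Proportional (M *ᵥ v) u) :
      ∃ c : K, (M⁻¹ * (h * M)) *ᵥ v = c • v := by
    obtain ⟨c, hc⟩ := hu
    obtain ⟨a, ha, e⟩ := e
    refine ⟨c, ?_⟩
    rw [← mulVec_mulVec, ← mulVec_mulVec, e, mulVec_smul, hc, smul_comm, ← e, mulVec_smul,
      mulVec_mulVec, nonsing_inv_mul _ (isUnit_iff_ne_zero.mpr hM), one_mulVec]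
  obtain ⟨a, ha⟩ := transfer ho eo
  obtain ⟨b, hb⟩ := transfer hs es
  obtain ⟨c, hc⟩ := transfer ht et
  obtain ⟨d, hd⟩ := transfer hp ep
  -- In the frame, the coordinate eigenvectors make the matrix diagonal and `(1, 1, 1)` makes its
  -- diagonal entries equal.
  have hN : M⁻¹ * (h * M) = d • (1 : Matrix (Fin 3) (Fin 3) K) := by
    generalize M⁻¹ * (h * M) = N at *
    simp only [funext_iff, Matrix.mulVec, dotProduct, Fin.sum_univ_three, Fin.forall_fin_succ,
      Fin.isValue] at ha hb hc hd
    simp at ha hb hc hd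
    obtain ⟨ha0, ha1, ha2⟩ := ha
    obtain ⟨hb0, hb1, hb2⟩ := hb
    obtain ⟨hc0, hc1, hc2⟩ := hc
    obtain ⟨hd0, hd1, hd2⟩ := hd
    ext i j
    fin_cases i <;> fin_cases j <;> simp [*] <;> grind
  refine ⟨d, ?_⟩
  have hu := isUnit_iff_ne_zero.mpr hM
  calc h = M * (M⁻¹ * (h * M)) * M⁻¹ := by
        rw [mul_nonsing_inv_cancel_left _ _ hu, mul_nonsing_inv_cancel_right _ _ hu]
    _ = _ := by
        rw [hN, mul_smul_comm, mul_one, smul_mul_assoc, mul_nonsing_inv _ hu]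

variable {k : Type*} [Field k] {E E' : WeierstrassCurve k}

instance [PerfectField k] : IsGalois k (AlgebraicClosure k) where

/-- The linear map of an equivariant symplectic isomorphism, normalised at `O`, is defined over the
base field. -/
lemma exists_descended_linear [PerfectField k] [E.IsElliptic] (h3 : (3 : k) ≠ 0)
    (φ : threeTorsion E ≃+ threeTorsion E') (hσ : IsEquivariant φ) (hφ : IsSymplectic φ) :
    ∃ g : Matrix (Fin 3) (Fin 3) k, g.det ≠ 0 ∧ g 0 1 = 0 ∧ g 1 1 = 1 ∧ g 2 1 = 0 ∧
      ∀ P : threeTorsion E,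
        Proportional (geomMatrix g *ᵥ vec (P : GeomPoint E)) (vec (φ P : GeomPoint E')) := by
  have h3' := three_ne_zero_algebraicClosure h3
  obtain ⟨g, hg, hP⟩ : ∃ g : Matrix (Fin 3) (Fin 3) (AlgebraicClosure k), g.det ≠ 0 ∧
      ∀ P : threeTorsion E, Proportional (g *ᵥ vec (P : GeomPoint E)) (vec (φ P : GeomPoint E')) :=
    exists_linear_of_symplectic h3' φ hφ
  obtain ⟨η, hη, e⟩ := hP 0
  have e' : g *ᵥ ![0, 1, 0] = η • ![0, 1, 0] := by
    rw [map_zero] at e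
    exact e
  -- Fixing the vector `(0, 1, 0)` itself, not only its line, removes the scalar ambiguity that
  -- would obstruct descent.
  set G := η⁻¹ • g with hG
  have hGdet : G.det ≠ 0 := by
    rw [hG, det_smul]
    exact mul_ne_zero (pow_ne_zero _ (inv_ne_zero hη)) hg
  have hGO : G *ᵥ ![0, 1, 0] = ![0, 1, 0] := by
    rw [hG, smul_mulVec, e', smul_smul, inv_mul_cancel₀ hη, one_smul]
  have hGP (P : threeTorsion E) :
      Proportional (G *ᵥ vec (P : GeomPoint E)) (vec (φ P : GeomPoint E')) := by
    rw [hG, smul_mulVec]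
    exact Proportional.trans ⟨η⁻¹, inv_ne_zero hη, rfl⟩ (hP P)
  have hGu := isUnit_iff_ne_zero.mpr hGdet
  have fixed (σ : AlgebraicClosure k ≃ₐ[k] AlgebraicClosure k) : G.map σ = G := by
    have hmap (v : Fin 3 → AlgebraicClosure k) : σ ∘ (G *ᵥ v) = G.map σ *ᵥ (σ ∘ v) := by
      ext i
      simp [Matrix.mulVec, dotProduct]
    -- By equivariance, both `G` and its conjugate by `σ` carry `P` to `φ P`; this is seen by
    -- conjugating the relation at `σ⁻¹ P`.
    have eig (P : threeTorsion E) : ∃ c : AlgebraicClosure k,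
        (G⁻¹ * G.map σ) *ᵥ vec (P : GeomPoint E) = c • vec (P : GeomPoint E) := by
      let Q : threeTorsion E := galoisTorsion E σ.symm P
      have hQ : galoisTorsion E σ Q = P := by
        apply Subtype.ext
        apply vec_injective
        change vec (galois E σ (galois E σ.symm (P : GeomPoint E))) = _
        rw [vec_galois, vec_galois]
        ext i
        simp
      obtain ⟨c, hc, h⟩ := hGP Q
      obtain ⟨d, hd, h'⟩ := hGP P
      have hφQ : vec (φ P : GeomPoint E') = σ ∘ vec (φ Q : GeomPoint E') := by
        rw [← vec_galois, ← hQ, hσ]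
        rfl
      have hvP : vec (P : GeomPoint E) = σ ∘ vec (Q : GeomPoint E) := by
        rw [← vec_galois, ← hQ]
        rfl
      refine ⟨σ c * d⁻¹, ?_⟩
      have h1 : G.map σ *ᵥ vec (P : GeomPoint E) = σ c • vec (φ P : GeomPoint E') := by
        rw [hvP, ← hmap, h, hφQ]
        ext i
        simp
      rw [← mulVec_mulVec, h1, mulVec_smul, mul_smul]
      congr 1
      rw [← one_mulVec (vec (P : GeomPoint E)), ← nonsing_inv_mul _ hGu, ← mulVec_mulVec, h',
        mulVec_smul, smul_smul, inv_mul_cancel₀ hd, one_smul]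
    obtain ⟨S, T, h⟩ := exists_independentThree
      (W := Affine.baseChange E (AlgebraicClosure k)) h3'
    have hl := h.left
    have hr := h.right
    have hne := h.left_ne
    have hne' := h.right_ne
    have hST := h.add_right.right
    have two {P : GeomPoint E} (hP : (3 : ℤ) • P = 0) (h0 : P ≠ 0) : P + P ≠ 0 := fun h' ↦
      h0 (by rw [← hP, show (3 : ℤ) • P = P + P + P by abel, h', zero_add])
    obtain ⟨c, hc⟩ := eq_smul_of_eigenvectors (h := G⁻¹ * G.map σ)
      (o := vec (0 : GeomPoint E)) (s := vec S) (t := vec T) (p := vec (S + T))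
      (tripleProduct_ne_zero h.left_ne.symm h.right_ne.symm h.ne
        (by rw [zero_add]; exact h.add_right.right_ne))
      (tripleProduct_ne_zero (by simpa using hne') (by simpa using hne) h.ne
        (by
          rw [add_assoc]
          exact two hST h.add_right.right_ne))
      (tripleProduct_ne_zero h.add_right.right_ne.symm h.right_ne.symm (by simpa using hne)
        (by
          intro h'
          apply h.ne
          rw [zero_add, add_assoc] at h'
          have : S + (T + T) = S - T + (3 : ℤ) • T := by abel
          rwa [this, hr, add_zero, sub_eq_zero] at h'))
      (tripleProduct_ne_zero h.left_ne.symm h.add_right.right_ne.symm (by simpa using hne')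
        (by
          intro h'
          apply h.ne
          rw [zero_add, ← add_assoc] at h'
          have : S + S + T = (3 : ℤ) • S - (S - T) := by abel
          rwa [this, hl, zero_sub, neg_eq_zero, sub_eq_zero] at h'))
      (eig 0) (eig ⟨S, hl⟩) (eig ⟨T, hr⟩) (eig ⟨S + T, hST⟩)
    have hσO : G.map σ *ᵥ ![0, 1, 0] = ![0, 1, 0] := by
      have := hmap ![0, 1, 0]
      rw [hGO] at this
      have h0 : σ ∘ ![0, 1, 0] = (![0, 1, 0] : Fin 3 → AlgebraicClosure k) := by
        ext i
        fin_cases i <;> simp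
      rw [h0] at this
      exact this.symm
    have hO : (G⁻¹ * G.map σ) *ᵥ ![0, 1, 0] = ![0, 1, 0] := by
      rw [← mulVec_mulVec, hσO]
      conv_lhs => rw [← hGO]
      rw [mulVec_mulVec, nonsing_inv_mul _ hGu, one_mulVec]
    have hc1 : c = 1 := by
      rw [hc, smul_mulVec, one_mulVec] at hO
      simpa using congrFun hO 1
    rw [hc1, one_smul] at hc
    rw [← mul_nonsing_inv_cancel_left G (G.map σ) hGu, hc, mul_one]
  -- Over a perfect field the algebraic closure is Galois, so the fixed entries lie in `k`.
  have range (i j : Fin 3) : ∃ a, algebraMap k (AlgebraicClosure k) a = G i j :=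
    (InfiniteGalois.mem_range_algebraMap_iff_fixed (G i j)).mpr fun σ ↦
      congrFun (congrFun (fixed σ) i) j
  choose g₀ hg₀ using range
  have hmat : geomMatrix (Matrix.of g₀) = G := by
    ext i j
    exact hg₀ i j
  have col (i : Fin 3) : G i 1 = (![0, 1, 0] : Fin 3 → AlgebraicClosure k) i := by
    have := congrFun hGO i
    simpa [Matrix.mulVec, dotProduct, Fin.sum_univ_three] using this
  have hinj := (algebraMap k (AlgebraicClosure k)).injective
  refine ⟨Matrix.of g₀, fun h ↦ hGdet ?_, hinj ?_, hinj ?_, hinj ?_, fun P ↦ hmat ▸ hGP P⟩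
  · rw [← hmat, geomMatrix, ← RingHom.mapMatrix_apply, ← RingHom.map_det, h, map_zero]
  · rw [Matrix.of_apply, hg₀, col]; simp
  · rw [Matrix.of_apply, hg₀, col]; simp
  · rw [Matrix.of_apply, hg₀, col]; simp

end Descent

section Fibers

variable {k : Type*} [Field k] {E E' : WeierstrassCurve k}

/-- A linear map that carries `E[3]` into `E'` carries a fiber of the Hesse pencil of `E`
to `E'`. -/
lemma exists_fiber_of_linear [E.IsElliptic] (h3 : (3 : k) ≠ 0) {g : Matrix (Fin 3) (Fin 3) k}
    (hg : g.det ≠ 0) (h01 : g 0 1 = 0) (h11 : g 1 1 = 1) (h21 : g 2 1 = 0)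
    (h : ∀ P : threeTorsion E,
      aeval (geomMatrix g *ᵥ vec (P : GeomPoint E)) E'.toProjective.polynomial = 0) :
    ∃ (t : OnePoint k) (c : k), c ≠ 0 ∧
      linSubst g E'.toProjective.polynomial = C c * fiber E t := by
  have h3' := three_ne_zero_algebraicClosure h3
  obtain ⟨c, hc⟩ := exists_linSubst_eq_cubicForm E' h01 h11 h21
  obtain ⟨e1, e3, e4, e5, e6, e7, e8⟩ := pencil_of_vanishing
    (W := Affine.baseChange E (AlgebraicClosure k)) h3'
    (fun i ↦ algebraMap k (AlgebraicClosure k) (c i)) fun x y hn h0 ↦ by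
      have := h ⟨Affine.Point.some x y hn, h0⟩
      rw [← aeval_linSubst, hc, aeval_cubicForm] at this
      simpa using this
  have hinj := (algebraMap k (AlgebraicClosure k)).injective
  have f1 : c 1 = c 0 * E.a₁ := hinj (by simpa [WeierstrassCurve.baseChange] using e1)
  have f3 : c 3 = c 0 * E.a₃ + c 2 * E.a₁ := hinj (by
    simpa [WeierstrassCurve.baseChange, algebraMap_three] using e3)
  have f4 : c 4 = c 2 * E.a₃ := hinj (by simpa [WeierstrassCurve.baseChange] using e4)
  have f5 : 3 * c 5 = c 0 * (E.b₂ - 3 * E.a₂) - 3 * c 2 := hinj (by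
    simpa [WeierstrassCurve.baseChange, algebraMap_three] using e5)
  have f6 : 3 * c 6 = c 0 * (3 * E.b₄ - 3 * E.a₄) - 3 * c 2 * E.a₂ := hinj (by
    simpa [WeierstrassCurve.baseChange, algebraMap_three] using e6)
  have f7 : 3 * c 7 = c 0 * (3 * E.b₆ - 3 * E.a₆) - 3 * c 2 * E.a₄ := hinj (by
    simpa [WeierstrassCurve.baseChange, algebraMap_three] using e7)
  have f8 : 3 * c 8 = c 0 * E.b₈ - 3 * c 2 * E.a₆ := hinj (by
    simpa [WeierstrassCurve.baseChange, algebraMap_three] using e8)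
  -- `hessForm` has coefficient `3` at `XY²`, so its multiplicity in the pulled-back form is a third
  -- of `c 0`.
  obtain ⟨a, ha⟩ : ∃ a, c 0 = 3 * a := ⟨c 0 / 3, (mul_div_cancel₀ _ h3).symm⟩
  have key : linSubst g E'.toProjective.polynomial =
      C a * hessForm E + C (c 2) * E.toProjective.polynomial := by
    have g5 : c 5 = a * (E.b₂ - 3 * E.a₂) - c 2 :=
      mul_left_cancel₀ h3 (by rw [f5, ha]; ring)
    have g6 : c 6 = a * (3 * E.b₄ - 3 * E.a₄) - c 2 * E.a₂ :=
      mul_left_cancel₀ h3 (by rw [f6, ha]; ring)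
    have g7 : c 7 = a * (3 * E.b₆ - 3 * E.a₆) - c 2 * E.a₄ :=
      mul_left_cancel₀ h3 (by rw [f7, ha]; ring)
    have g8 : c 8 = a * E.b₈ - c 2 * E.a₆ :=
      mul_left_cancel₀ h3 (by rw [f8, ha]; ring)
    rw [hc, cubicForm, f1, f3, f4, g5, g6, g7, g8, ha, hessForm, cubicForm, Projective.polynomial]
    simp
    ring
  -- The pulled-back form is not zero: where `g *ᵥ v = (1, 0, 0)` it takes the value `-1`.
  have hne : a ≠ 0 ∨ c 2 ≠ 0 := by
    by_contra! h0
    obtain ⟨v, hv⟩ := exists_mulVec_eq (det_geomMatrix_ne_zero hg) ![1, 0, 0]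
    have := aeval_linSubst g E'.toProjective.polynomial v
    rw [key, h0.1, h0.2, hv, aeval_polynomial] at this
    simp at this
  obtain ⟨t, d, hd, e⟩ := exists_eq_fiber E hne
  exact ⟨t, d, hd, key.trans e⟩

lemma exists_fiber_isomorphic [PerfectField k] [E.IsElliptic] [E'.IsElliptic] (h3 : (3 : k) ≠ 0)
    (φ : threeTorsion E ≃+ threeTorsion E') (hσ : IsEquivariant φ) (hφ : IsSymplectic φ) :
    ∃ t₀ : OnePoint k, IsSmoothCurve (fiber E t₀) ∧
      IsomorphicOver (fiber E t₀) E'.toProjective.polynomial := by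
  obtain ⟨g, hg, h01, h11, h21, hP⟩ := exists_descended_linear h3 φ hσ hφ
  obtain ⟨t, c, hc, h⟩ := exists_fiber_of_linear (E' := E') h3 hg h01 h11 h21 fun P ↦ by
    obtain ⟨a, -, e⟩ := hP P
    rw [e, aeval_smul (polynomial_isHomogeneous E'), aeval_vec_polynomial, mul_zero]
  have hF := fiber_isHomogeneous E t
  have hG := polynomial_isHomogeneous E'
  refine ⟨t, .of_linSubst hF hG hg hc h (isSmoothCurve_polynomial E'),
    .comp_linear hF hG hg hc h h01 h21 (.refl ?_)⟩
  rw [pointO_mem_iff hG, aeval_polynomial]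
  simp

end Fibers

end HessePencil

namespace HessePencil

open WeierstrassCurve WeierstrassCurve.Affine

/-! ### Regular functions on affine Weierstrass curves -/

section RegularFunctions

variable {K : Type*} [Field K]

/-- The affine points of a Weierstrass cubic. -/
def AffinePoint (W : WeierstrassCurve.Affine K) : Type _ := {p : K × K // W.Equation p.1 p.2}

namespace AffinePoint

variable {W W' : WeierstrassCurve.Affine K}

/-- Homogeneous coordinates of an affine point. -/
def coords (Q : AffinePoint W) : Fin 3 → K := ![Q.1.1, Q.1.2, 1]

/-- Evaluation of the elements of the coordinate ring at an affine point. -/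
noncomputable def evalHom (Q : AffinePoint W) : W.CoordinateRing →+* K := AdjoinRoot.evalEval Q.2

lemma evalHom_mk (Q : AffinePoint W) (p : Polynomial (Polynomial K)) :
    Q.evalHom (CoordinateRing.mk W p) = p.evalEval Q.1.1 Q.1.2 :=
  AdjoinRoot.evalEval_mk _ _

lemma evalHom_algebraMap (Q : AffinePoint W) (c : K) :
    Q.evalHom (algebraMap K W.CoordinateRing c) = c :=
  (Q.evalHom_mk (Polynomial.C (Polynomial.C c))).trans (Polynomial.evalEval_CC ..)

lemma evalHom_basis (Q : AffinePoint W) (p q : Polynomial K) :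
    Q.evalHom (p • (1 : W.CoordinateRing) + q • CoordinateRing.mk W Polynomial.X) =
      p.eval Q.1.1 + q.eval Q.1.1 * Q.1.2 := by
  rw [CoordinateRing.smul, CoordinateRing.smul, map_add, mul_one, map_mul, evalHom_mk, evalHom_mk,
    evalHom_mk, Polynomial.evalEval_C, Polynomial.evalEval_C, Polynomial.evalEval_X]

lemma exists_of_fst [IsAlgClosed K] (x : K) : ∃ Q : AffinePoint W, Q.1.1 = x := by
  obtain ⟨y, hy⟩ := exists_root_quadratic (W.a₁ * x + W.a₃)
    (-(x ^ 3 + W.a₂ * x ^ 2 + W.a₄ * x + W.a₆))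
  exact ⟨⟨(x, y), (Affine.equation_iff ..).mpr (by linear_combination hy)⟩, rfl⟩

/-- The norm of `f` is `f` times its conjugate, so it vanishes at the abscissa of every point. Every
element of `K` is such an abscissa, so the norm is zero, hence `f` is. -/
lemma eq_zero_of_evalHom [IsAlgClosed K] {f : W.CoordinateRing}
    (h : ∀ Q : AffinePoint W, Q.evalHom f = 0) : f = 0 := by
  obtain ⟨p, q, rfl⟩ := CoordinateRing.exists_smul_basis_eq f
  rw [← Algebra.norm_eq_zero_iff_of_basis (CoordinateRing.basis W), CoordinateRing.norm_smul_basis]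
  refine Polynomial.funext fun x ↦ ?_
  obtain ⟨Q, rfl⟩ := exists_of_fst (W := W) x
  have hQ := h Q
  rw [evalHom_basis] at hQ
  have e := (Affine.equation_iff ..).mp Q.2
  simp
  linear_combination (p.eval Q.1.1 - q.eval Q.1.1 * Q.1.2 - q.eval Q.1.1 *
    (W.a₁ * Q.1.1 + W.a₃)) * hQ + (q.eval Q.1.1) ^ 2 * e

lemma ext_of_evalHom [IsAlgClosed K] {f g : W.CoordinateRing}
    (h : ∀ Q : AffinePoint W, Q.evalHom f = Q.evalHom g) : f = g :=
  sub_eq_zero.mp (eq_zero_of_evalHom fun Q ↦ by rw [map_sub, h, sub_self])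

end AffinePoint

open AffinePoint

variable {W W' : WeierstrassCurve.Affine K}

/-- A function on the affine points is regular if it is locally a quotient of polynomials. -/
def IsRegular (u : AffinePoint W → K) : Prop :=
  ∀ P : AffinePoint W, ∃ a b : MvPolynomial (Fin 3) K, b.eval P.coords ≠ 0 ∧
    ∀ Q : AffinePoint W, b.eval Q.coords * u Q = a.eval Q.coords

/-- Regular functions are elements of the coordinate ring. -/
lemma IsRegular.exists_evalHom [IsAlgClosed K] {u : AffinePoint W → K} (hu : IsRegular u) :
    ∃ f : W.CoordinateRing, ∀ Q : AffinePoint W, Q.evalHom f = u Q := by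
  -- The ideal of denominators of `u`. Regularity leaves it no common zero, so by the
  -- Nullstellensatz it contains `1`, and `u` is a polynomial.
  let J : Ideal (MvPolynomial (Fin 3) K) :=
    { carrier := {b | ∃ a : MvPolynomial (Fin 3) K,
        ∀ Q : AffinePoint W, b.eval Q.coords * u Q = a.eval Q.coords}
      add_mem' := by
        rintro b b' ⟨a, ha⟩ ⟨a', ha'⟩
        exact ⟨a + a', fun Q ↦ by rw [map_add, map_add, add_mul, ha, ha']⟩
      zero_mem' := ⟨0, fun Q ↦ by simp⟩
      smul_mem' := by
        rintro c b ⟨a, ha⟩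
        exact ⟨c * a, fun Q ↦ by rw [smul_eq_mul, map_mul, map_mul, mul_assoc, ha]⟩ }
  have hempty : MvPolynomial.zeroLocus K J = ∅ := by
    rw [Set.eq_empty_iff_forall_notMem]
    intro v hv
    rw [MvPolynomial.mem_zeroLocus_iff] at hv
    -- `Z - 1` and the Weierstrass form vanish on all affine points, so they are denominators with
    -- numerator `0`; a common zero of `J` is thus an affine point.
    have h2 := hv (MvPolynomial.X 2 - 1) ⟨0, fun Q ↦ by simp [coords]⟩
    have h0 := hv (WeierstrassCurve.toProjective W).polynomial ⟨0, fun Q ↦ by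
      have := (Projective.equation_some (W' := W) Q.1.1 Q.1.2).mpr Q.2
      rw [Projective.Equation] at this
      rw [coords, this]
      simp⟩
    have h2' : v 2 = 1 := sub_eq_zero.mp (by simpa using h2)
    have hveq : v = ![v 0, v 1, 1] := by
      ext i
      fin_cases i <;> simp [h2']
    rw [MvPolynomial.aeval_eq_eval, hveq] at h0
    obtain ⟨a, b, hb, h⟩ := hu ⟨(v 0, v 1), (Projective.equation_some (W' := W) _ _).mp h0⟩
    have := hv b ⟨a, h⟩
    rw [MvPolynomial.aeval_eq_eval, hveq] at this
    exact hb this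
  have htop : J.radical = ⊤ := by
    rw [← MvPolynomial.vanishingIdeal_zeroLocus_eq_radical (K := K), hempty,
      MvPolynomial.vanishingIdeal_empty]
  obtain ⟨a, ha⟩ : (1 : MvPolynomial (Fin 3) K) ∈ J := by
    rw [Ideal.radical_eq_top.mp htop]
    trivial
  let κ : MvPolynomial (Fin 3) K →ₐ[K] Polynomial (Polynomial K) :=
    MvPolynomial.aeval ![Polynomial.C Polynomial.X, Polynomial.X, 1]
  refine ⟨CoordinateRing.mk W (κ a), fun Q ↦ ?_⟩
  have key : (Polynomial.evalEvalRingHom Q.1.1 Q.1.2).comp κ.toRingHom =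
      MvPolynomial.eval Q.coords := by
    refine MvPolynomial.ringHom_ext (fun r ↦ ?_) fun i ↦ ?_
    · simp [κ]
    · fin_cases i <;> simp [κ, coords]
  rw [evalHom_mk, ← one_mul (u Q), ← map_one (MvPolynomial.eval Q.coords), ha, ← key]
  rfl

/-- Pullback of functions along a regular map. -/
lemma exists_pullback [IsAlgClosed K] {ψ : AffinePoint W → AffinePoint W'}
    (h₁ : IsRegular fun Q ↦ (ψ Q).1.1) (h₂ : IsRegular fun Q ↦ (ψ Q).1.2) :
    ∃ θ : W'.CoordinateRing →+* W.CoordinateRing, ∀ Q f, Q.evalHom (θ f) = (ψ Q).evalHom f := by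
  obtain ⟨α, hα⟩ := h₁.exists_evalHom
  obtain ⟨β, hβ⟩ := h₂.exists_evalHom
  let ι : Polynomial K →+* W.CoordinateRing :=
    Polynomial.eval₂RingHom (algebraMap K W.CoordinateRing) α
  have key (Q : AffinePoint W) : Q.evalHom.comp (Polynomial.eval₂RingHom ι β) =
      Polynomial.evalEvalRingHom (ψ Q).1.1 (ψ Q).1.2 := by
    refine Polynomial.ringHom_ext' (Polynomial.ringHom_ext (fun a ↦ ?_) ?_) ?_
    · simp [ι, evalHom_algebraMap]
    · simp [ι, hα]
    · simp [hβ]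
  have hroot : W'.polynomial.eval₂ ι β = 0 := eq_zero_of_evalHom fun Q ↦
    (DFunLike.congr_fun (key Q) W'.polynomial).trans (ψ Q).2
  refine ⟨AdjoinRoot.lift ι β hroot, fun Q f ↦ ?_⟩
  obtain ⟨p, rfl⟩ := AdjoinRoot.mk_surjective f
  rw [AdjoinRoot.lift_mk]
  exact (DFunLike.congr_fun (key Q) p).trans (evalHom_mk (ψ Q) p).symm

/-- The isomorphism of coordinate rings of an isomorphism of affine curves. -/
lemma exists_algEquiv [IsAlgClosed K] {ψ : AffinePoint W ≃ AffinePoint W'}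
    (h₁ : IsRegular fun Q ↦ (ψ Q).1.1) (h₂ : IsRegular fun Q ↦ (ψ Q).1.2)
    (h₁' : IsRegular fun Q ↦ (ψ.symm Q).1.1) (h₂' : IsRegular fun Q ↦ (ψ.symm Q).1.2) :
    ∃ θ : W'.CoordinateRing ≃ₐ[K] W.CoordinateRing,
      ∀ Q f, Q.evalHom (θ f) = (ψ Q).evalHom f := by
  obtain ⟨θ, hθ⟩ := exists_pullback h₁ h₂
  obtain ⟨θ', hθ'⟩ := exists_pullback h₁' h₂'
  let e : W'.CoordinateRing ≃+* W.CoordinateRing := RingEquiv.ofRingHom θ θ'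
    (RingHom.ext fun f ↦ ext_of_evalHom fun Q ↦ by simp [hθ, hθ'])
    (RingHom.ext fun f ↦ ext_of_evalHom fun Q ↦ by simp [hθ, hθ'])
  refine ⟨AlgEquiv.ofRingEquiv (f := e) fun c ↦ ext_of_evalHom fun Q ↦ ?_, hθ⟩
  rw [evalHom_algebraMap]
  exact (hθ Q _).trans (evalHom_algebraMap _ c)

end RegularFunctions

/-! ### Pole orders and linearity of isomorphisms -/

section Degrees

variable {K : Type*} [Field K] {W W' : WeierstrassCurve.Affine K}

/-- The order of the pole at infinity of an element of the coordinate ring. -/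
noncomputable def poleOrder (f : W.CoordinateRing) : ℕ :=
  Module.finrank K (W.CoordinateRing ⧸ Ideal.span {f})

/-- Defining the pole order as the dimension of a quotient ring makes it an invariant of the
`K`-algebra. -/
lemma poleOrder_algEquiv (θ : W'.CoordinateRing ≃ₐ[K] W.CoordinateRing) (f : W'.CoordinateRing) :
    poleOrder (θ f) = poleOrder f :=
  (Ideal.quotientEquivAlg (R₁ := K) (Ideal.span {f}) (Ideal.span {θ f}) θ (by
    rw [Ideal.map_span, Set.image_singleton]
    rfl)).toLinearEquiv.finrank_eq.symm

lemma degree_norm_eq_poleOrder {f : W.CoordinateRing} (hf : f ≠ 0) :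
    (Algebra.norm (Polynomial K) f).degree = poleOrder f := by
  rw [poleOrder, finrank_quotient_span_eq_natDegree_norm (CoordinateRing.basis W) hf]
  exact Polynomial.degree_eq_natDegree 
    ((Algebra.norm_ne_zero_iff_of_basis (CoordinateRing.basis W)).mpr hf)

lemma poleOrder_X : poleOrder (CoordinateRing.mk W (Polynomial.C Polynomial.X)) = 2 := by
  have e : CoordinateRing.mk W (Polynomial.C Polynomial.X) =
      (Polynomial.X : Polynomial K) • (1 : W.CoordinateRing) +
        (0 : Polynomial K) • CoordinateRing.mk W Polynomial.X := by
    rw [CoordinateRing.smul, mul_one, zero_smul, add_zero]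
  have hne : CoordinateRing.mk W (Polynomial.C Polynomial.X) ≠ 0 := fun h ↦
    Polynomial.X_ne_zero (CoordinateRing.smul_basis_eq_zero (e.symm.trans h)).1
  have h := degree_norm_eq_poleOrder hne
  rw [e, CoordinateRing.degree_norm_smul_basis, ← e] at h
  exact Nat.cast_injective (R := WithBot ℕ) (by simpa using h.symm)

lemma poleOrder_Y : poleOrder (CoordinateRing.mk W Polynomial.X) = 3 := by
  have e : CoordinateRing.mk W Polynomial.X =
      (0 : Polynomial K) • (1 : W.CoordinateRing) +
        (1 : Polynomial K) • CoordinateRing.mk W Polynomial.X := by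
    rw [zero_smul, one_smul, zero_add]
  have hne : CoordinateRing.mk W Polynomial.X ≠ 0 := fun h ↦
    one_ne_zero (CoordinateRing.smul_basis_eq_zero (e.symm.trans h)).2
  have h := degree_norm_eq_poleOrder hne
  rw [e, CoordinateRing.degree_norm_smul_basis, ← e] at h
  exact Nat.cast_injective (R := WithBot ℕ) (by simpa using h.symm)

/-- The functions with a double pole at infinity. -/
lemma exists_linear_of_poleOrder_two {f : W.CoordinateRing} (hf : f ≠ 0) (h : poleOrder f = 2) :
    ∃ u r : K, u ≠ 0 ∧ ∀ Q : AffinePoint W, Q.evalHom f = u * Q.1.1 + r := by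
  obtain ⟨p, q, rfl⟩ := CoordinateRing.exists_smul_basis_eq f
  have hd := degree_norm_eq_poleOrder hf
  rw [CoordinateRing.degree_norm_smul_basis, h] at hd
  have hq : q = 0 := by
    by_contra hq
    have h' := (le_max_right _ _).trans hd.le
    rw [Polynomial.degree_eq_natDegree hq] at h'
    have : ((2 * q.natDegree + 3 : ℕ) : WithBot ℕ) ≤ ((2 : ℕ) : WithBot ℕ) := by
      simpa [two_nsmul, two_mul] using h'
    exact absurd (Nat.cast_le.mp this) (by omega)
  subst hq
  have hp : p ≠ 0 := fun h ↦ hf (by simp [h])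
  rw [Polynomial.degree_eq_natDegree hp] at hd
  have hd' : ((2 * p.natDegree : ℕ) : WithBot ℕ) = ((2 : ℕ) : WithBot ℕ) := by
    simpa [two_nsmul, two_mul] using hd
  have hp1 : p.natDegree = 1 := by have := Nat.cast_injective hd'; omega
  obtain ⟨a, ha, b, hb⟩ := Polynomial.natDegree_eq_one.mp hp1
  exact ⟨a, b, ha, fun Q ↦ by rw [AffinePoint.evalHom_basis, ← hb]; simp⟩

/-- The functions with a triple pole at infinity. -/
lemma exists_linear_of_poleOrder_three {f : W.CoordinateRing} (hf : f ≠ 0) (h : poleOrder f = 3) :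
    ∃ v s t : K, v ≠ 0 ∧ ∀ Q : AffinePoint W, Q.evalHom f = s * Q.1.1 + v * Q.1.2 + t := by
  obtain ⟨p, q, rfl⟩ := CoordinateRing.exists_smul_basis_eq f
  have hd := degree_norm_eq_poleOrder hf
  rw [CoordinateRing.degree_norm_smul_basis, h] at hd
  have hp : p.natDegree ≤ 1 := by
    by_cases hp : p = 0
    · simp [hp]
    have h' := (le_max_left _ _).trans hd.le
    rw [Polynomial.degree_eq_natDegree hp] at h'
    have : ((2 * p.natDegree : ℕ) : WithBot ℕ) ≤ ((3 : ℕ) : WithBot ℕ) := by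
      simpa [two_nsmul, two_mul] using h'
    have := Nat.cast_le.mp this
    omega
  have hq : q ≠ 0 := by
    rintro rfl
    by_cases hp : p = 0
    · exact hf (by simp [hp])
    rw [Polynomial.degree_eq_natDegree hp] at hd
    have hd' : ((2 * p.natDegree : ℕ) : WithBot ℕ) = ((3 : ℕ) : WithBot ℕ) := by
      simpa [two_nsmul, two_mul] using hd
    have := Nat.cast_injective hd'
    omega
  have hq' : q.natDegree = 0 := by
    have h' := (le_max_right _ _).trans hd.le
    rw [Polynomial.degree_eq_natDegree hq] at h'
    have : ((2 * q.natDegree + 3 : ℕ) : WithBot ℕ) ≤ ((3 : ℕ) : WithBot ℕ) := by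
      simpa [two_nsmul, two_mul] using h'
    have := Nat.cast_le.mp this
    omega
  obtain ⟨v, rfl⟩ := Polynomial.natDegree_eq_zero.mp hq'
  obtain ⟨s, t, rfl⟩ := Polynomial.exists_eq_X_add_C_of_natDegree_le_one hp
  refine ⟨v, s, t, fun h ↦ hq (by rw [h, map_zero]), fun Q ↦ ?_⟩
  rw [AffinePoint.evalHom_basis]
  simp
  ring

/-- An isomorphism of affine Weierstrass curves is given by linear polynomials. -/
lemma exists_linear_of_isRegular [IsAlgClosed K] {ψ : AffinePoint W ≃ AffinePoint W'}
    (h₁ : IsRegular fun Q ↦ (ψ Q).1.1) (h₂ : IsRegular fun Q ↦ (ψ Q).1.2)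
    (h₁' : IsRegular fun Q ↦ (ψ.symm Q).1.1) (h₂' : IsRegular fun Q ↦ (ψ.symm Q).1.2) :
    ∃ u r v s t : K, u ≠ 0 ∧ v ≠ 0 ∧ ∀ Q, (ψ Q).1.1 = u * Q.1.1 + r ∧
      (ψ Q).1.2 = s * Q.1.1 + v * Q.1.2 + t := by
  obtain ⟨θ, hθ⟩ := exists_algEquiv h₁ h₂ h₁' h₂'
  have hx : CoordinateRing.mk W' (Polynomial.C Polynomial.X) ≠ 0 := by
    intro h
    have := CoordinateRing.smul_basis_eq_zero (W' := W') (p := Polynomial.X) (q := 0) (by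
      rw [CoordinateRing.smul, mul_one, zero_smul, add_zero, h])
    exact Polynomial.X_ne_zero this.1
  have hy : CoordinateRing.mk W' Polynomial.X ≠ 0 := by
    intro h
    have := CoordinateRing.smul_basis_eq_zero (W' := W') (p := 0) (q := 1) (by
      rw [zero_smul, one_smul, zero_add, h])
    exact one_ne_zero this.2
  obtain ⟨u, r, hu, e₁⟩ := exists_linear_of_poleOrder_two ((map_ne_zero_iff θ θ.injective).mpr hx)
    ((poleOrder_algEquiv θ _).trans poleOrder_X)
  obtain ⟨v, s, t, hv, e₂⟩ := exists_linear_of_poleOrder_three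
    ((map_ne_zero_iff θ θ.injective).mpr hy) ((poleOrder_algEquiv θ _).trans poleOrder_Y)
  refine ⟨u, r, v, s, t, hu, hv, fun Q ↦ ⟨?_, ?_⟩⟩
  · rw [← e₁, hθ, AffinePoint.evalHom_mk, Polynomial.evalEval_C, Polynomial.eval_X]
  · rw [← e₂, hθ, AffinePoint.evalHom_mk, Polynomial.evalEval_X]

end Degrees

end HessePencil

namespace HessePencil

open MvPolynomial Matrix WeierstrassCurve

/-! ### Morphisms of projective curves in homogeneous coordinates -/

section Morphisms

variable {k : Type*} [Field k] {F H : MvPolynomial (Fin 3) k}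

/-- Frees the definition of a morphism from chosen representatives: by homogeneity any coordinate
vectors will do. -/
lemma IsMorphism.exists_forms {φ : planeCurve F → planeCurve H} (hφ : IsMorphism φ)
    {v : Fin 3 → AlgebraicClosure k} (hv : v ≠ 0)
    (hm : Projectivization.mk (AlgebraicClosure k) v hv ∈ planeCurve F) :
    ∃ f : Fin 3 → MvPolynomial (Fin 3) k, (fun i ↦ aeval v (f i)) ≠ 0 ∧
      ∀ (w u : Fin 3 → AlgebraicClosure k) (hw : w ≠ 0) (hu : u ≠ 0)
        (hm : Projectivization.mk (AlgebraicClosure k) w hw ∈ planeCurve F),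
        (fun i ↦ aeval w (f i)) ≠ 0 →
        (φ ⟨_, hm⟩).1 = Projectivization.mk (AlgebraicClosure k) u hu →
        Proportional u fun i ↦ aeval w (f i) := by
  obtain ⟨d, f, hf, h0, h⟩ := hφ ⟨_, hm⟩
  have key {w : Fin 3 → AlgebraicClosure k} (hw : w ≠ 0) :
      Proportional (fun i ↦ aeval (Projectivization.mk (AlgebraicClosure k) w hw).rep (f i))
        fun i ↦ aeval w (f i) := by
    obtain ⟨a, ha, e⟩ := rep_mk_proportional hw
    refine ⟨a ^ d, pow_ne_zero d ha, ?_⟩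
    ext i
    rw [e, aeval_smul (hf i)]
    rfl
  have ne {a b : Fin 3 → AlgebraicClosure k} (hab : Proportional a b) (ha : a ≠ 0) : b ≠ 0 := by
    rintro rfl
    obtain ⟨c, -, e⟩ := hab
    exact ha (by rw [e, smul_zero])
  refine ⟨f, ne (key hv) h0, fun w u hw hu hm' hne e ↦ ?_⟩
  have h' := h ⟨_, hm'⟩ (ne (key hw).symm hne)
  exact ((mk_eq_mk_iff_proportional ..).mp (e.symm.trans h')).trans (key hw)

/-- Morphisms over the base field commute with the Galois action. -/
lemma IsMorphism.map_conj {φ : planeCurve F → planeCurve H} (hφ : IsMorphism φ)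
    (σ : AlgebraicClosure k ≃ₐ[k] AlgebraicClosure k) {v u w : Fin 3 → AlgebraicClosure k}
    {hv : v ≠ 0} {hu : u ≠ 0} {hw : w ≠ 0}
    {hm : Projectivization.mk (AlgebraicClosure k) v hv ∈ planeCurve F}
    (h : (φ ⟨_, hm⟩).1 = Projectivization.mk _ u hu) {hσv : σ ∘ v ≠ 0}
    {hσm : Projectivization.mk (AlgebraicClosure k) (σ ∘ v) hσv ∈ planeCurve F}
    (h' : (φ ⟨_, hσm⟩).1 = Projectivization.mk _ w hw) : Proportional w (σ ∘ u) := by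
  obtain ⟨f, hf, hP⟩ := hφ.exists_forms hv hm
  have conj (p : MvPolynomial (Fin 3) k) : aeval (σ ∘ v) p = σ (aeval v p) := by
    have : aeval (R := k) (σ ∘ v) = (σ : AlgebraicClosure k →ₐ[k] AlgebraicClosure k).comp
        (aeval v) := algHom_ext fun i ↦ by simp
    exact DFunLike.congr_fun this p
  -- The forms have coefficients in `k`, so those describing the morphism at `v` also describe it at
  -- `σ ∘ v`.
  have hne : (fun i ↦ aeval (σ ∘ v) (f i)) ≠ 0 := by
    intro h0
    refine hf (funext fun i ↦ ?_)
    have := congrFun h0 i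
    rw [conj] at this
    simpa using this
  refine (hP _ w hσv hw hσm hne h').trans ?_
  obtain ⟨c, hc, e⟩ := hP v u hv hu hm hf h
  refine Proportional.symm ⟨σ c, (map_ne_zero σ).mpr hc, ?_⟩
  ext i
  rw [Function.comp_apply, e, Pi.smul_apply, Pi.smul_apply, conj, smul_eq_mul, smul_eq_mul, map_mul]

end Morphisms

section LinearIsomorphisms

variable {k : Type*} [Field k] {W W' : WeierstrassCurve k}

/-- The geometric affine points of a Weierstrass cubic. -/
abbrev GeomAffinePoint (W : WeierstrassCurve k) : Type _ :=
  AffinePoint (Affine.baseChange W (AlgebraicClosure k))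

lemma AffinePoint.coords_ne_zero {K : Type*} [Field K] {W : WeierstrassCurve.Affine K}
    (Q : AffinePoint W) : Q.coords ≠ 0 :=
  fun h ↦ one_ne_zero (congrFun h 2)

lemma AffinePoint.eq_of_coords_proportional {K : Type*} [Field K] {W : WeierstrassCurve.Affine K}
    {Q R : AffinePoint W} (h : Proportional Q.coords R.coords) : Q = R := by
  obtain ⟨c, -, e⟩ := h
  have e2 : 1 = c * 1 := congrFun e 2
  have hc : c = 1 := by rw [e2, mul_one]
  subst hc
  rw [one_smul] at e
  exact Subtype.ext (Prod.ext (congrFun e 0) (congrFun e 1))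

lemma AffinePoint.mk_mem (Q : GeomAffinePoint W) :
    Projectivization.mk (AlgebraicClosure k) Q.coords Q.coords_ne_zero ∈
      planeCurve W.toProjective.polynomial :=
  (mk_mem_planeCurve (polynomial_isHomogeneous W) _).mpr ((equation_baseChange_iff W _ _).mp Q.2)

/-- An affine point as a point of the projective curve. -/
noncomputable def AffinePoint.toCurve (Q : GeomAffinePoint W) :
    planeCurve W.toProjective.polynomial :=
  ⟨_, Q.mk_mem⟩

lemma AffinePoint.toCurve_injective :
    Function.Injective (toCurve : GeomAffinePoint W → planeCurve W.toProjective.polynomial) :=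
  fun _ _ h ↦ eq_of_coords_proportional
    ((mk_eq_mk_iff_proportional ..).mp (congrArg Subtype.val h))

lemma AffinePoint.toCurve_ne (Q : GeomAffinePoint W) : Q.toCurve.1 ≠ pointO k := by
  intro h
  obtain ⟨c, -, e⟩ := (mk_eq_mk_iff_proportional ..).mp h
  have : (1 : AlgebraicClosure k) = c * 0 := congrFun e 2
  simp at this

lemma AffinePoint.exists_toCurve {R : planeCurve W.toProjective.polynomial} (hR : R.1 ≠ pointO k) :
    ∃ Q : GeomAffinePoint W, Q.toCurve = R := by
  have h2 : R.1.rep 2 ≠ 0 := by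
    intro h2
    have := proportional_of_last_eq_zero W R.1.rep_nonzero R.2 h2
    exact hR (by
      rw [← R.1.mk_rep]
      exact (mk_eq_mk_iff_proportional ..).mpr this)
  have hp := proportional_of_last_ne_zero h2
  obtain ⟨c, hc, e⟩ := hp
  have h : aeval R.1.rep W.toProjective.polynomial = 0 := R.2
  rw [e, aeval_smul (polynomial_isHomogeneous W)] at h
  refine ⟨⟨(R.1.rep 0 / R.1.rep 2, R.1.rep 1 / R.1.rep 2), (equation_baseChange_iff W _ _).mpr
    ((mul_eq_zero.mp h).resolve_left (pow_ne_zero 3 hc))⟩, Subtype.ext ?_⟩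
  conv_rhs => rw [← R.1.mk_rep]
  exact (mk_eq_mk_iff_proportional ..).mpr (Proportional.symm ⟨c, hc, e⟩)

lemma IsMorphism.isRegular
    {φ : planeCurve W.toProjective.polynomial → planeCurve W'.toProjective.polynomial}
    (hφ : IsMorphism φ) {ψ : GeomAffinePoint W → GeomAffinePoint W'}
    (h : ∀ Q : GeomAffinePoint W, φ Q.toCurve = (ψ Q).toCurve) :
    IsRegular (fun Q ↦ (ψ Q).1.1) ∧ IsRegular (fun Q ↦ (ψ Q).1.2) := by
  have key (P : GeomAffinePoint W) : ∃ f : Fin 3 → MvPolynomial (Fin 3) (AlgebraicClosure k),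
      (f 2).eval P.coords ≠ 0 ∧ ∀ Q : GeomAffinePoint W,
        (f 2).eval Q.coords * (ψ Q).1.1 = (f 0).eval Q.coords ∧
        (f 2).eval Q.coords * (ψ Q).1.2 = (f 1).eval Q.coords := by
    obtain ⟨f, hf, hP⟩ := hφ.exists_forms P.coords_ne_zero P.mk_mem
    have e (Q : GeomAffinePoint W) (i : Fin 3) :
        (map (algebraMap k (AlgebraicClosure k)) (f i)).eval Q.coords = aeval Q.coords (f i) := by
      rw [eval_map, aeval_def]
    have hQ (Q : GeomAffinePoint W) (hne : (fun i ↦ aeval Q.coords (f i)) ≠ 0) :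
        Proportional (ψ Q).coords fun i ↦ aeval Q.coords (f i) :=
      hP _ _ Q.coords_ne_zero (ψ Q).coords_ne_zero Q.mk_mem hne (congrArg Subtype.val (h Q))
    refine ⟨fun i ↦ map (algebraMap k (AlgebraicClosure k)) (f i), ?_, fun Q ↦ ?_⟩
    · obtain ⟨c, hc, e'⟩ := hQ P hf
      have h2 : 1 = c * aeval P.coords (f 2) := congrFun e' 2
      rw [e]
      intro h0
      rw [h0, mul_zero] at h2
      exact one_ne_zero h2
    · rw [e, e, e]
      -- Where all three forms vanish they say nothing about `ψ Q`, but the identities with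
      -- denominators cleared read `0 = 0`.
      by_cases hne : (fun i ↦ aeval Q.coords (f i)) = 0
      · simp [congrFun hne 0, congrFun hne 1, congrFun hne 2]
      · obtain ⟨c, hc, e'⟩ := hQ Q hne
        have h0 : (ψ Q).1.1 = c * aeval Q.coords (f 0) := congrFun e' 0
        have h1 : (ψ Q).1.2 = c * aeval Q.coords (f 1) := congrFun e' 1
        have h2 : 1 = c * aeval Q.coords (f 2) := congrFun e' 2
        rw [h0, h1]
        exact ⟨by linear_combination -aeval Q.coords (f 0) * h2,
          by linear_combination -aeval Q.coords (f 1) * h2⟩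
  refine ⟨fun P ↦ ?_, fun P ↦ ?_⟩ <;> obtain ⟨f, h0, hf⟩ := key P
  · exact ⟨f 0, f 2, h0, fun Q ↦ (hf Q).1⟩
  · exact ⟨f 1, f 2, h0, fun Q ↦ (hf Q).2⟩

/-- `O` is the only point at infinity, so a bijection respecting it preserves the affine parts. -/
lemma exists_affine_map
    {φ : planeCurve W.toProjective.polynomial ≃ planeCurve W'.toProjective.polynomial}
    (hO : pointO k ∈ planeCurve W.toProjective.polynomial)
    (hO' : pointO k ∈ planeCurve W'.toProjective.polynomial)
    (h : φ ⟨pointO k, hO⟩ = ⟨pointO k, hO'⟩) (Q : GeomAffinePoint W) :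
    ∃ R : GeomAffinePoint W', φ Q.toCurve = R.toCurve := by
  obtain ⟨R, hR⟩ := AffinePoint.exists_toCurve (R := φ Q.toCurve) fun h' ↦ Q.toCurve_ne (by
    have : φ Q.toCurve = φ ⟨pointO k, hO⟩ := Subtype.ext (by rw [h', h])
    rw [φ.injective this])
  exact ⟨R, hR.symm⟩

/-- An isomorphism of Weierstrass cubics that respects `O` is linear. -/
lemma exists_linear_of_isMorphism
    {φ : planeCurve W.toProjective.polynomial ≃ planeCurve W'.toProjective.polynomial}
    (hφ : IsMorphism φ) (hφ' : IsMorphism φ.symm)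
    (hO : pointO k ∈ planeCurve W.toProjective.polynomial)
    (hO' : pointO k ∈ planeCurve W'.toProjective.polynomial)
    (h : φ ⟨pointO k, hO⟩ = ⟨pointO k, hO'⟩) :
    ∃ (g : Matrix (Fin 3) (Fin 3) (AlgebraicClosure k)) (hg : g.det ≠ 0),
      Proportional (g *ᵥ ![0, 1, 0]) ![0, 1, 0] ∧
      ∀ (v : Fin 3 → AlgebraicClosure k) (hv : v ≠ 0)
        (hm : Projectivization.mk (AlgebraicClosure k) v hv ∈
          planeCurve W.toProjective.polynomial),
        (φ ⟨_, hm⟩).1 = Projectivization.mk _ (g *ᵥ v) (mulVec_ne_zero hg hv) := by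
  choose a ha using exists_affine_map hO hO' h
  choose b hb using exists_affine_map (φ := φ.symm) hO' hO (by rw [← h, φ.symm_apply_apply])
  let ψ : GeomAffinePoint W ≃ GeomAffinePoint W' :=
    { toFun := a
      invFun := b
      left_inv := fun Q ↦ AffinePoint.toCurve_injective (by
        rw [← hb, ← ha, φ.symm_apply_apply])
      right_inv := fun Q ↦ AffinePoint.toCurve_injective (by
        rw [← ha, ← hb, φ.apply_symm_apply]) }
  obtain ⟨h₁, h₂⟩ := hφ.isRegular (ψ := ψ) ha
  obtain ⟨h₁', h₂'⟩ := hφ'.isRegular (ψ := ψ.symm) hb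
  obtain ⟨u, r, v, s, t, hu, hv, hψ⟩ := exists_linear_of_isRegular h₁ h₂ h₁' h₂'
  let g : Matrix (Fin 3) (Fin 3) (AlgebraicClosure k) := !![u, 0, r; s, v, t; 0, 0, 1]
  have hg : g.det ≠ 0 := by
    have : g.det = u * v := by simp [g, Matrix.det_fin_three]
    rw [this]
    exact mul_ne_zero hu hv
  have hgO : Proportional (g *ᵥ ![0, 1, 0]) ![0, 1, 0] := by
    refine ⟨v, hv, ?_⟩
    ext i
    fin_cases i <;> simp [g, Matrix.mulVec, dotProduct, Fin.sum_univ_three]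
  have hgQ (Q : GeomAffinePoint W) : g *ᵥ Q.coords = (ψ Q).coords := by
    ext i
    fin_cases i
    · simp [g, AffinePoint.coords, Matrix.mulVec, dotProduct, Fin.sum_univ_three, (hψ Q).1]
    · simp [g, AffinePoint.coords, Matrix.mulVec, dotProduct, Fin.sum_univ_three, (hψ Q).2]
    · simp [g, AffinePoint.coords, Matrix.mulVec, dotProduct, Fin.sum_univ_three]
  refine ⟨g, hg, hgO, fun w hw hm ↦ ?_⟩
  by_cases hwO : Projectivization.mk (AlgebraicClosure k) w hw = pointO k
  · have e : (⟨_, hm⟩ : planeCurve W.toProjective.polynomial) = ⟨pointO k, hO⟩ := Subtype.ext hwO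
    rw [e, h]
    refine (mk_eq_mk_iff_proportional ..).mpr ?_
    exact ((((mk_eq_mk_iff_proportional ..).mp hwO).mulVec g).trans hgO).symm
  · obtain ⟨Q, hQ⟩ := AffinePoint.exists_toCurve (R := ⟨_, hm⟩) hwO
    rw [← hQ, ha]
    refine (mk_eq_mk_iff_proportional ..).mpr ?_
    change Proportional (ψ Q).coords _
    rw [← hgQ]
    exact ((mk_eq_mk_iff_proportional ..).mp (congrArg Subtype.val hQ)).mulVec g

end LinearIsomorphisms

end HessePencil

namespace HessePencil

open MvPolynomial Matrix WeierstrassCurve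

/-! ### Weierstrass models of smooth fibers -/

section WeierstrassModel

variable {k : Type*} [Field k]

lemma aeval_pderiv_cubicForm (c : Fin 9 → AlgebraicClosure k) (c₀ : Fin 9 → k)
    (hc : ∀ i, algebraMap k _ (c₀ i) = c i) (v : Fin 3 → AlgebraicClosure k) :
    aeval v (pderiv 0 (cubicForm c₀)) = c 0 * v 1 ^ 2 + 2 * c 1 * v 0 * v 1 + c 3 * v 1 * v 2
      + 3 * c 5 * v 0 ^ 2 + 2 * c 6 * v 0 * v 2 + c 7 * v 2 ^ 2 ∧
    aeval v (pderiv 1 (cubicForm c₀)) = 2 * c 0 * v 0 * v 1 + c 1 * v 0 ^ 2 + 2 * c 2 * v 1 * v 2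
      + c 3 * v 0 * v 2 + c 4 * v 2 ^ 2 ∧
    aeval v (pderiv 2 (cubicForm c₀)) = c 2 * v 1 ^ 2 + c 3 * v 0 * v 1 + 2 * c 4 * v 1 * v 2
      + c 6 * v 0 ^ 2 + 2 * c 7 * v 0 * v 2 + 3 * c 8 * v 2 ^ 2 := by
  refine ⟨?_, ?_, ?_⟩ <;> simp [cubicForm, pderiv_X, hc] <;> ring

/-- The cubics `(3 x + s z) (y² + a₁ x y + a₃ y z) + c(x, z)`. -/
noncomputable def pencilForm (a₁ a₃ s α β γ δ : k) : MvPolynomial (Fin 3) k :=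
  cubicForm ![3, 3 * a₁, s, 3 * a₃ + s * a₁, s * a₃, α, β, γ, δ]

lemma hessForm_add_eq_pencilForm (E : WeierstrassCurve k) (s : k) :
    hessForm E + C s * E.toProjective.polynomial = pencilForm E.a₁ E.a₃ s (E.b₂ - 3 * E.a₂ - s)
      (3 * E.b₄ - 3 * E.a₄ - s * E.a₂) (3 * E.b₆ - 3 * E.a₆ - s * E.a₄) (E.b₈ - s * E.a₆) := by
  rw [polynomial_eq_cubicForm, hessForm, pencilForm]
  simp [cubicForm]
  ring

variable {a₁ a₃ s ε β γ δ : k}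

/-- Let `c(x, z)` be the part of the form free of `y`. The stated quantity is `c(-s, 3) / 3`. If it
vanished, `3x + sz` would divide the form, and the curve would be singular where this line meets the
residual conic; `y` solves the equation of the conic on the line. -/
lemma pencilForm_smooth (h3 : (3 : k) ≠ 0)
    (hs : IsSmoothCurve (pencilForm a₁ a₃ s (3 * ε) β γ δ)) :
    -ε * s ^ 3 + β * s ^ 2 - 3 * γ * s + 9 * δ ≠ 0 := by
  intro h0
  have h3' := three_ne_zero_algebraicClosure h3
  let ι := algebraMap k (AlgebraicClosure k)
  obtain ⟨y, hy⟩ := exists_root_quadratic (3 * ι a₃ - ι a₁ * ι s)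
    (3 * ι ε * ι s ^ 2 - 2 * ι β * ι s + 3 * ι γ)
  have h0' : -ι ε * ι s ^ 3 + ι β * ι s ^ 2 - 3 * ι γ * ι s + 9 * ι δ = 0 := by
    have := congrArg ι h0
    have e3 : ι 3 = 3 := map_ofNat ι 3
    have e9 : ι 9 = 9 := map_ofNat ι 9
    simpa [e3, e9] using this
  let v : Fin 3 → AlgebraicClosure k := ![-ι s, y, 3]
  have hv : v ≠ 0 := fun h ↦ h3' (congrFun h 2)
  have hc : ∀ i, ι ((![3, 3 * a₁, s, 3 * a₃ + s * a₁, s * a₃, 3 * ε, β, γ, δ] : Fin 9 → k) i) =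
      (![3, 3 * ι a₁, ι s, 3 * ι a₃ + ι s * ι a₁, ι s * ι a₃, 3 * ι ε, ι β, ι γ, ι δ] :
        Fin 9 → AlgebraicClosure k) i := by
    have e3 : ι 3 = 3 := map_ofNat ι 3
    intro i
    fin_cases i <;> simp [e3]
  obtain ⟨d0, d1, d2⟩ := aeval_pderiv_cubicForm _ _ hc v
  have hm : Projectivization.mk (AlgebraicClosure k) v hv ∈
      planeCurve (pencilForm a₁ a₃ s (3 * ε) β γ δ) := by
    rw [pencilForm, mk_mem_planeCurve (cubicForm_isHomogeneous _), aeval_cubicForm]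
    simp only [show ∀ a, algebraMap k (AlgebraicClosure k) a = ι a from fun _ ↦ rfl, hc]
    simp [v]
    linear_combination 3 * h0'
  obtain ⟨i, hi⟩ := hs _ hm
  obtain ⟨a, ha, e⟩ := rep_mk_proportional hv
  rw [e, pencilForm, aeval_smul (cubicForm_isHomogeneous _).pderiv] at hi
  apply hi
  refine mul_eq_zero_of_right _ ?_
  fin_cases i
  · refine d0.trans ?_
    simp [v]
    linear_combination 3 * hy
  · refine d1.trans ?_
    simp [v]
    ring
  · refine d2.trans ?_
    simp [v]
    refine mul_left_cancel₀ h3' ?_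
    linear_combination 3 * ι s * hy + 9 * h0'

/-- The substitution turns the flex tangent `3x + sz` at `O` into `3dZ`, the line at infinity. The
coefficient of `X³` becomes `c(s, -3) = -3d`, with `c` the part free of `y`, so division by `3d`
leaves a Weierstrass form. -/
lemma exists_weierstrass_pencilForm (d : k)
    (hd : d = -ε * s ^ 3 + β * s ^ 2 - 3 * γ * s + 9 * δ) :
    ∃ W : WeierstrassCurve k,
      linSubst !![s, 0, d; 0, 1, 0; -3, 0, 0] (pencilForm a₁ a₃ s (3 * ε) β γ δ) =
        C (3 * d) * W.toProjective.polynomial := by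
  refine ⟨⟨a₁ * s - 3 * a₃, -(3 * ε * s ^ 2 - 2 * β * s + 3 * γ), a₁ * d, (β - 3 * ε * s) * d,
    -ε * d ^ 2⟩, ?_⟩
  have hd' : C d = (-C ε * C s ^ 3 + C β * C s ^ 2 - 3 * C γ * C s + 9 * C δ :
      MvPolynomial (Fin 3) k) := by
    rw [hd]
    have e9 : (C 9 : MvPolynomial (Fin 3) k) = 9 := map_ofNat C 9
    simp [C_three, e9]
  simp [linSubst, pencilForm, cubicForm, Projective.polynomial, Fin.sum_univ_three, algebraMap_eq]
  simp only [C_two, C_three]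
  linear_combination 3 * X 0 ^ 3 * hd'

/-- A smooth fiber of the Hesse pencil has a Weierstrass model by a linear change of coordinates
that fixes `O`. -/
lemma exists_weierstrass_model (h3 : (3 : k) ≠ 0) (E : WeierstrassCurve k) (t : OnePoint k)
    (hs : IsSmoothCurve (fiber E t)) :
    ∃ (W : WeierstrassCurve k) (M : Matrix (Fin 3) (Fin 3) k) (c : k), M.det ≠ 0 ∧ c ≠ 0 ∧
      M 0 1 = 0 ∧ M 2 1 = 0 ∧ linSubst M (fiber E t) = C c * W.toProjective.polynomial := by
  induction t using OnePoint.rec with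
  | infty =>
    refine ⟨E, 1, 1, by simp, one_ne_zero, by simp, by simp, ?_⟩
    have : (fun i ↦ ∑ j, C ((1 : Matrix (Fin 3) (Fin 3) k) i j) * X j) =
        (X : Fin 3 → MvPolynomial (Fin 3) k) := by
      ext1 i
      rw [Finset.sum_eq_single i]
      · simp
      · intro j _ hj
        simp [Matrix.one_apply_ne hj.symm]
      · simp
    rw [linSubst, this, aeval_X_left, fiber_infty, map_one, one_mul]
    rfl
  | coe t =>
    obtain ⟨u, s, hu, h⟩ := exists_fiber_coe E t
    obtain ⟨ε, hε⟩ : ∃ ε, E.b₂ - 3 * E.a₂ - s = 3 * ε := ⟨_, (mul_div_cancel₀ _ h3).symm⟩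
    rw [hessForm_add_eq_pencilForm, hε] at h
    generalize 3 * E.b₄ - 3 * E.a₄ - s * E.a₂ = β at h
    generalize 3 * E.b₆ - 3 * E.a₆ - s * E.a₄ = γ at h
    generalize E.b₈ - s * E.a₆ = δ at h
    have hs' : IsSmoothCurve (pencilForm E.a₁ E.a₃ s (3 * ε) β γ δ) := by
      intro P hP
      have hP' : P ∈ planeCurve (fiber E t) := by
        change aeval _ _ = _
        rw [h, map_mul, show aeval P.rep _ = 0 from hP, mul_zero]
      obtain ⟨i, hi⟩ := hs P hP'
      rw [h, pderiv_C_mul, map_mul] at hi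
      exact ⟨i, right_ne_zero_of_mul hi⟩
    have hd := pencilForm_smooth h3 hs'
    obtain ⟨d, hd'⟩ : ∃ d, d = -ε * s ^ 3 + β * s ^ 2 - 3 * γ * s + 9 * δ := ⟨_, rfl⟩
    rw [← hd'] at hd
    obtain ⟨W, hW⟩ := exists_weierstrass_pencilForm (a₁ := E.a₁) (a₃ := E.a₃) d hd'
    refine ⟨W, !![s, 0, d; 0, 1, 0; -3, 0, 0], u * (3 * d), ?_,
      mul_ne_zero hu (mul_ne_zero h3 hd), ?_, ?_, ?_⟩
    · simp [Matrix.det_fin_three, hd, h3]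
    · simp
    · simp
    · rw [h, C_mul, mul_assoc, ← hW]
      simp [linSubst, algebraMap_eq]

end WeierstrassModel

/-! ### From a fiber isomorphic to `E'` to a symplectic isomorphism -/

section TorsionTransport

variable {k : Type*} [Field k] {E E' : WeierstrassCurve k}

lemma aeval_vec_hessForm (P : threeTorsion E) : aeval (vec (P : GeomPoint E)) (hessForm E) = 0 := by
  obtain ⟨P, hP⟩ := P
  rcases P with _ | ⟨x, y, h⟩
  · rw [hessForm, aeval_cubicForm]
    simp [vec]
  · have hΨ := (three_zsmul_some_iff_Ψ₃ h).mp hP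
    have he := (Affine.equation_iff ..).mp h.1
    rw [hessForm, aeval_cubicForm]
    simp [Ψ₃, WeierstrassCurve.baseChange] at hΨ he
    simp [algebraMap_three]
    linear_combination hΨ + 3 * x * he

lemma aeval_vec_fiber (t : OnePoint k) (P : threeTorsion E) :
    aeval (vec (P : GeomPoint E)) (fiber E t) = 0 := by
  induction t using OnePoint.rec with
  | infty => exact aeval_vec_polynomial E _
  | coe t =>
    obtain ⟨u, s, -, h⟩ := exists_fiber_coe E t
    rw [h, map_mul, map_add, map_mul, aeval_vec_hessForm, aeval_vec_polynomial]
    simp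

lemma exists_symplectic_of_fiber [E.IsElliptic] [E'.IsElliptic] (h3 : (3 : k) ≠ 0)
    {t : OnePoint k} (hs : IsSmoothCurve (fiber E t))
    (hi : IsomorphicOver (fiber E t) E'.toProjective.polynomial) :
    ∃ φ : threeTorsion E ≃+ threeTorsion E', IsEquivariant φ ∧ IsSymplectic φ := by
  have h3' := three_ne_zero_algebraicClosure h3
  obtain ⟨W, M, c, hM, hc, h01, h21, hW⟩ := exists_weierstrass_model h3 E t hs
  have hE := fiber_isHomogeneous E t
  have hWhom := polynomial_isHomogeneous W
  have hi' : IsomorphicOver W.toProjective.polynomial E'.toProjective.polynomial :=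
    .comp_linear hWhom hE hM hc hW h01 h21 hi
  obtain ⟨f, hf, hf', hO, hO', hfO⟩ := hi'
  obtain ⟨g, hg, hgO, hgf⟩ := exists_linear_of_isMorphism hf hf' hO hO' hfO
  have hMdet := det_geomMatrix_ne_zero hM
  have hMu := isUnit_iff_ne_zero.mpr hMdet
  set N := (geomMatrix M)⁻¹ with hN
  have hNdet : N.det ≠ 0 := det_inv_ne_zero hMdet
  have hMN : geomMatrix M * N = 1 := mul_nonsing_inv _ hMu
  have hNM : N * geomMatrix M = 1 := nonsing_inv_mul _ hMu
  have hNne (P : GeomPoint E) : N *ᵥ vec P ≠ 0 := mulVec_ne_zero hNdet (vec_ne_zero P)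
  have hmem (P : threeTorsion E) :
      Projectivization.mk (AlgebraicClosure k) (N *ᵥ vec (P : GeomPoint E)) (hNne P) ∈
        planeCurve W.toProjective.polynomial := by
    rw [mk_mem_planeCurve hWhom]
    have h := aeval_linSubst M (fiber E t) (N *ᵥ vec (P : GeomPoint E))
    rw [mulVec_mulVec, hMN, one_mulVec, aeval_vec_fiber, hW, map_mul] at h
    exact (mul_eq_zero.mp h).resolve_left (by simpa using hc)
  -- The path runs from `E[3]` inside the fiber to the Weierstrass model by `N`, then to `E'` by
  -- `g`.
  have himage (P : threeTorsion E) : ∃ Q : GeomPoint E',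
      Proportional ((g * N) *ᵥ vec (P : GeomPoint E)) (vec Q) := by
    rw [← mulVec_mulVec]
    refine exists_proportional_vec E' (mulVec_ne_zero hg (hNne P)) ?_
    rw [← mk_mem_planeCurve (polynomial_isHomogeneous E') (mulVec_ne_zero hg (hNne P)),
      ← hgf _ _ (hmem P)]
    exact Subtype.property _
  choose Φ hΦ using himage
  have hNO : Proportional (N *ᵥ ![0, 1, 0]) ![0, 1, 0] := by
    have hMO : Proportional (geomMatrix M *ᵥ ![0, 1, 0]) ![0, 1, 0] := by
      refine ⟨algebraMap k _ (M 1 1), fun h ↦ hM ?_, ?_⟩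
      · have : M 1 1 = 0 := by simpa using h
        rw [Matrix.det_fin_three, h01, h21, this]
        ring
      · ext i
        fin_cases i <;> simp [Matrix.mulVec, dotProduct, Fin.sum_univ_three, h01, h21]
    have := hMO.mulVec N
    rw [mulVec_mulVec, hNM, one_mulVec] at this
    exact this.symm
  have h0 : Φ 0 = 0 := by
    refine Proportional.eq_of_vec ((hΦ 0).symm.trans ?_)
    rw [← mulVec_mulVec]
    exact (hNO.mulVec g).trans hgO
  obtain ⟨φ, hφ, hsym⟩ : ∃ φ : threeTorsion E ≃+ threeTorsion E',
      (∀ P, (φ P : GeomPoint E') = Φ P) ∧ IsSymplectic φ := exists_symplectic_of_linear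
    (W := Affine.baseChange E (AlgebraicClosure k)) (W' := Affine.baseChange E' (AlgebraicClosure k))
    h3' (g := g * N) (Φ := Φ) (by rw [det_mul]; exact mul_ne_zero hg hNdet) hΦ h0
  refine ⟨φ, fun σ P ↦ Subtype.ext ?_, hsym⟩
  refine Proportional.eq_of_vec ?_
  have hNσ (v : Fin 3 → AlgebraicClosure k) : σ ∘ (N *ᵥ v) = N *ᵥ (σ ∘ v) := by
    have hMσ (v : Fin 3 → AlgebraicClosure k) :
        σ ∘ (geomMatrix M *ᵥ v) = geomMatrix M *ᵥ (σ ∘ v) := by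
      ext i
      simp [Matrix.mulVec, dotProduct]
    rw [← one_mulVec (σ ∘ (N *ᵥ v)), ← hNM, ← mulVec_mulVec, ← hMσ, mulVec_mulVec, hMN, one_mulVec]
  have hσ : σ ∘ (N *ᵥ vec (P : GeomPoint E)) =
      N *ᵥ vec (galoisTorsion E σ P : GeomPoint E) := by
    rw [hNσ, ← vec_galois]
    rfl
  have e₁ := hgf _ _ (hmem P)
  have e₂ := hgf _ _ (hmem (galoisTorsion E σ P))
  simp only [← hσ] at e₂
  -- `g` is only known over the algebraic closure; equivariance comes from `f` being a morphism over
  -- `k`, together with `N` commuting with `σ`.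
  have e := hf.map_conj σ e₁ e₂
  have eφ : (φ (galoisTorsion E σ P) : GeomPoint E') = Φ (galoisTorsion E σ P) := hφ _
  have eφ' : (galoisTorsion E' σ (φ P) : GeomPoint E') = galois E' σ (Φ P) :=
    congrArg (galois E' σ) (hφ P)
  refine (eφ ▸ (hΦ (galoisTorsion E σ P)).symm).trans ?_
  rw [← mulVec_mulVec, ← hσ]
  refine e.trans ?_
  rw [eφ', vec_galois]
  obtain ⟨a, ha, e'⟩ := hΦ P
  rw [← mulVec_mulVec] at e'
  refine ⟨σ a, (map_ne_zero σ).mpr ha, ?_⟩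
  rw [e']
  ext i
  simp

end TorsionTransport

end HessePencil

theorem theorem1p1 {k : Type*} [Field k] [PerfectField k] (h3 : (3 : k) ≠ 0)
    (E E' : WeierstrassCurve k) [E.IsElliptic] [E'.IsElliptic] :
    (∃ φ : HessePencil.threeTorsion E ≃+ HessePencil.threeTorsion E',
        HessePencil.IsEquivariant φ ∧ HessePencil.IsSymplectic φ) ↔
      ∃ t₀ : OnePoint k, HessePencil.IsSmoothCurve (HessePencil.fiber E t₀) ∧
        HessePencil.IsomorphicOver (HessePencil.fiber E t₀) E'.toProjective.polynomial :=
  ⟨fun ⟨φ, hσ, hφ⟩ ↦ HessePencil.exists_fiber_isomorphic h3 φ hσ hφ,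
    fun ⟨_, hs, hi⟩ ↦ HessePencil.exists_symplectic_of_fiber h3 hs hi⟩
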